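/- Let $w_0,w_1\in\mathbb{C}$, $\Lambda=\frac14(w_0-w_1)^2$, and consider the spectral curve $(\mathbb{CP}^1,x,y)$ over $\mathbb{C}^*\times\mathbb{C}$ with $$x(z)=z^2-\Lambda,\qquad y(z)=z+\tfrac12(w_0+w_1),$$ which parametrizes $y^2-(w_0+w_1)y+w_0w_1-x=0$. Its only zero of $dx$ is $z=0$, with local Galois conjugation $\bar z=-z$. Put $\omega=y\,dx/x$ and $B(z_1,z_2)=\frac{dz_1dz_2}{(z_1-z_2)^2}$, and define $\omega_n^{(g)}$ ($g\ge0$, $n\ge1$) by $\omega_1^{(0)}=0$, $\omega_2^{(0)}=B$ and, for all other $(g,n+1)$, the local topological recursion $$\omega^{(g)}_{n+1}(z,z_N)=\mathop{\mathrm{Res}}_{w=0}\frac{\frac12\int_{\bar w}^{w}B(\cdot,z)}{\omega(w)-\omega(\bar w)}\Big(\omega^{(g-1)}_{n+2}(w,\bar w,z_N)+\sum_{\ell=0}^{g}\sum_{J\subseteq N}\omega^{(g-\ell)}_{|J|+1}(w,z_J)\,\omega^{(\ell)}_{|N\setminus J|+1}(\bar w,z_{N\setminus J})\Big),$$ where $N=\{1,\dots,n\}$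 and $\omega^{(-1)}_{n}=0$. For $2g-2+n>0$ let $$F_n^{(g)}(z_1,\dots,z_n)=\int_\infty^{z_1}\!\!\cdots\int_\infty^{z_n}\omega_n^{(g)}$$ (for $z_1,\dots,z_n\neq 0$); these integrals converge. Let $F_1^{(0)}(z)$ and $F_2^{(0)}(z_1,z_2)$ (the latter near the diagonal) be the divergent integrals from $\infty$ of $\omega$ and of $B(z_1,z_2)-\frac{dx(z_1)dx(z_2)}{(x(z_1)-x(z_2))^2}$, regularized by an additive constant. That is, $dF_1^{(0)}=\omega$, and the partial derivatives of $F_2^{(0)}$ in $z_1$ and in $z_2$ are the convergent single integrals from $\infty$ in the other variable. Such local regularizations exist near every $z$ with $z\ne0$ and $x(z)\neq0$. On an open subset of the $x$-plane minus $\{0,-\Lambda\}$ with a continuous branch $z=z(x)$ of the inverse of $x(z)$ and with regularizations as above, define the wave function with integration divisor $[z]-[\infty]$ as the formal WKB series $$\psi(x)=\exp\Big(\sum_{m\ge0}\hbar^{m-1}F_m(x)\Big),\qquad F_m(x)=\sum_{\substack{g\ge0,\ n\ge1\\ 2g-1+n=m}}\frac1{n!}F_n^{(g)}(z(x),\dots,z(x)),$$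 that is, $\psi=e^{F_0/\hbar}\sum_{k\ge0}\hbar^k\varphi_k(x)$ with $\sum_k\hbar^k\varphi_k=e^{F_1}\exp\big(\sum_{m\ge2}\hbar^{m-1}F_m\big)$. Then $F_0$ and all $\varphi_k$ are holomorphic in $x$, and $\psi$ satisfies the GKZ equation $$\Big(\hbar x\frac{d}{dx}-w_0\Big)\Big(\hbar x\frac{d}{dx}-w_1\Big)\psi=x\,\psi$$ as an identity of formal WKB series, i.e. coefficientwise in $\hbar$ after division by $e^{F_0/\hbar}$. -/

import Mathlib

open Filter Topology MeasureTheory Set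

namespace TopRec

/-- The residue at `q` of the differential `f(w) dw`: the integral of `f` over the positively
oriented circle of radius `r` about `q`, divided by `2πi`, for `r → 0`.  For `f` meromorphic at `q`
the value does not depend on small `r`. -/
noncomputable def residue (f : ℂ → ℂ) (q : ℂ) : ℂ :=
  limUnder (𝓝[>] (0 : ℝ)) fun r => (2 * Real.pi * Complex.I)⁻¹ * ∮ w in C(q, r), f w

/-- A simply ramified spectral curve with `C = ℂP¹`, given in an affine coordinate `z` in which
`x` and `y` are entire: `ram` is the (finite) set of zeros of `dx`, all of them simple and none a
zero of `dy`, and `conj q` is the local Galois conjugation near the ramification point `q`. -/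
structure SpectralCurve where
  x : ℂ → ℂ
  y : ℂ → ℂ
  ram : Finset ℂ
  conj : ℂ → ℂ → ℂ
  x_differentiable : Differentiable ℂ x
  y_differentiable : Differentiable ℂ y
  mem_ram : ∀ q, q ∈ ram ↔ deriv x q = 0
  simple : ∀ q ∈ ram, deriv (deriv x) q ≠ 0
  deriv_y_ne : ∀ q ∈ ram, deriv y q ≠ 0
  conj_analytic : ∀ q ∈ ram, AnalyticAt ℂ (conj q) q
  conj_self : ∀ q ∈ ram, conj q q = q
  x_conj : ∀ q ∈ ram, ∀ᶠ w in 𝓝 q, x (conj q w) = x w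
  conj_ne : ∀ q ∈ ram, ∀ᶠ w in 𝓝[≠] q, conj q w ≠ w

/-- The Bergman kernel of `ℂP¹`: `B(z₁, z₂) = bergman z₁ z₂ dz₁ dz₂`. -/
noncomputable def bergman (z₁ z₂ : ℂ) : ℂ := 1 / (z₁ - z₂) ^ 2

/-- The integral of `f(t) dt` along the straight segment from `a` to `b`. -/
noncomputable def segmentIntegral (a b : ℂ) (f : ℂ → ℂ) : ℂ :=
  ∫ t in (0 : ℝ)..1, f (a + t * (b - a)) * (b - a)

namespace SpectralCurve

variable (C : SpectralCurve)

/-- The one-form `y dx / x` of a curve in `ℂ* × ℂ`, as a coefficient of `dz`. -/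
noncomputable def oneForm (z : ℂ) : ℂ := C.y z * deriv C.x z / C.x z

/-- The recursion kernel near the ramification point `q`, with `w̄ = conj q w`:
`(½ ∫_{w̄}^{w} B(·, z)) / (ω(x(w)) - ω(x(w̄))) = kernel q w z dz / dw`.
The form `ω(x(w̄))` is pulled back along `conj q`. -/
noncomputable def kernel (q w z : ℂ) : ℂ :=
  (1 / 2 * segmentIntegral (C.conj q w) w fun t => bergman t z) /
    (C.oneForm w - C.oneForm (C.conj q w) * deriv (C.conj q) w)

/-- The correlators: `ω_n^{(g)} = omega g n (z₁, …, z_n) dz₁ ⋯ dz_n`, defined by the local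
topological recursion.  `J` runs over all subsets of the index set of the last variables. The
factor `deriv (C.conj q) w` comes from `d w̄`.  The summands left out in the `if` are
exactly those with a factor `ω_1^{(0)} = 0`; see `omega_recursion` for the full formula.
(The value for `n = 0` is not used.) -/
noncomputable def omega : (g n : ℕ) → (Fin n → ℂ) → ℂ
  | _, 0, _ => 0
  | 0, 1, _ => 0
  | 0, 2, z => bergman (z 0) (z 1)
  | g, n + 1, z => ∑ q ∈ C.ram, residue (fun w =>
      C.kernel q w (z 0) * deriv (C.conj q) w *
        ((if _h : g = 0 then 0 else
            omega (g - 1) (n + 2) (Fin.cons w (Fin.cons (C.conj q w) (Fin.tail z)))) +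
          ∑ l : Fin (g + 1), ∑ J : Finset (Fin n),
            if _h : (l.val = g ∧ J.card = 0) ∨ (l.val = 0 ∧ J.card = n) then 0 else
              omega (g - l) (J.card + 1)
                  (Fin.cons w fun i => Fin.tail z (J.orderEmbOfFin rfl i)) *
                omega l (Jᶜ.card + 1)
                  (Fin.cons (C.conj q w) fun i => Fin.tail z (Jᶜ.orderEmbOfFin rfl i)))) q
termination_by g n => 2 * g + n
decreasing_by
  all_goals
    first
    | omega
    | (have h1 := Finset.card_le_univ J
       have h2 := Finset.card_compl J
       have h3 := l.isLt
       simp only [Fintype.card_fin] at h1 h2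
       omega)

theorem omega_zero_one (z : Fin 1 → ℂ) : C.omega 0 1 z = 0 := by
  rw [omega]

theorem omega_zero_two (z : Fin 2 → ℂ) : C.omega 0 2 z = bergman (z 0) (z 1) := by
  rw [omega]

/-- The local topological recursion, for `(g, n + 1) ≠ (0, 1), (0, 2)`. -/
theorem omega_recursion (g n : ℕ) (h : g ≠ 0 ∨ 2 ≤ n) (z : Fin (n + 1) → ℂ) :
    C.omega g (n + 1) z = ∑ q ∈ C.ram, residue (fun w =>
      C.kernel q w (z 0) * deriv (C.conj q) w *
        ((if g = 0 then 0 else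
            C.omega (g - 1) (n + 2) (Fin.cons w (Fin.cons (C.conj q w) (Fin.tail z)))) +
          ∑ l : Fin (g + 1), ∑ J : Finset (Fin n),
            C.omega (g - l) (J.card + 1)
                (Fin.cons w fun i => Fin.tail z (J.orderEmbOfFin rfl i)) *
              C.omega l (Jᶜ.card + 1)
                (Fin.cons (C.conj q w) fun i => Fin.tail z (Jᶜ.orderEmbOfFin rfl i)))) q := by
  have h01 : ∀ a b, a = 0 → b = 0 → ∀ v : Fin (b + 1) → ℂ, C.omega a (b + 1) v = 0 := by
    rintro a b rfl rfl v
    exact C.omega_zero_one v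
  rw [omega]
  · simp only [dite_eq_ite]
    refine Finset.sum_congr rfl fun q _ => ?_
    congr 1
    funext w
    congr 2
    refine Finset.sum_congr rfl fun l _ => Finset.sum_congr rfl fun J _ => ?_
    split_ifs with hif
    · rcases hif with ⟨h1, h2⟩ | ⟨h1, h2⟩
      · rw [h01 (g - l) J.card (by omega) h2, zero_mul]
      · rw [h01 l Jᶜ.card h1 (by simp [Finset.card_compl, h2]), mul_zero]
    · rfl
  · intro h1 h2
    omega
  · intro h1 h2
    omega

end SpectralCurve

/-- `∫_∞^z f(t) dt`, along the straight ray from `∞` through `z`. -/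
noncomputable def integralFromInfinity (f : ℂ → ℂ) (z : ℂ) : ℂ :=
  -z * ∫ t in Ioi (1 : ℝ), f (t * z)

/-- `∫_∞^{z₁} ⋯ ∫_∞^{z_n} f(t₁, …, t_n) dt₁ ⋯ dt_n`, along the straight rays from `∞` through the
`z_i`. -/
noncomputable def multiIntegralFromInfinity {n : ℕ} (f : (Fin n → ℂ) → ℂ) (z : Fin n → ℂ) : ℂ :=
  (∏ i, -z i) * ∫ t in {t : Fin n → ℝ | ∀ i, 1 < t i}, f fun i => t i * z i

/-- Absolute convergence of the integral `multiIntegralFromInfinity f z`. -/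
def ConvergesFromInfinity {n : ℕ} (f : (Fin n → ℂ) → ℂ) (z : Fin n → ℂ) : Prop :=
  IntegrableOn (fun t : Fin n → ℝ => f fun i => t i * z i) {t | ∀ i, 1 < t i}

namespace SpectralCurve

variable (C : SpectralCurve)

/-- `B(z₁, z₂) - dx(z₁) dx(z₂) / (x(z₁) - x(z₂))²`, as a coefficient of `dz₁ dz₂`. -/
noncomputable def hatOmega₂ (z₁ z₂ : ℂ) : ℂ :=
  bergman z₁ z₂ - deriv C.x z₁ * deriv C.x z₂ / (C.x z₁ - C.x z₂) ^ 2

/-- The functions `F_n^{(g)}(z₁, …, z_n)` with reference point `∞`.  The two unstable ones need a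
regularization and are taken as arguments, see `IsLocalBranch`. -/
noncomputable def freeEnergy (F₁ : ℂ → ℂ) (F₂ : ℂ → ℂ → ℂ) : (g n : ℕ) → (Fin n → ℂ) → ℂ
  | 0, 1, z => F₁ (z 0)
  | 0, 2, z => F₂ (z 0) (z 1)
  | g, n, z => multiIntegralFromInfinity (C.omega g n) z

/-- `F_m = ∑_{g ≥ 0, n ≥ 1, 2g - 1 + n = m} F_n^{(g)}(z, …, z) / n!`, as a function of `z`. -/
noncomputable def wkbF (F₁ : ℂ → ℂ) (F₂ : ℂ → ℂ → ℂ) (m : ℕ) (z : ℂ) : ℂ :=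
  ∑ p ∈ (Finset.range (m + 1) ×ˢ Finset.Icc 1 (m + 1)).filter (fun p => 2 * p.1 + p.2 = m + 1),
    1 / (p.2.factorial : ℂ) * C.freeEnergy F₁ F₂ p.1 p.2 fun _ => z

/-- The data of a local branch of the wave function on an open set `V` of the `x`-plane `ℂ*`:
a branch `s` of the inverse of `x(z)` away from ramification points; a regularized integral `F₁` of
`ω = y dx / x` (a primitive: the divergent integral from `∞`, up to an additive constant);
a regularized double integral `F₂` of `hatOmega₂`, near the diagonal (the divergent double integral
from `∞`, up to an additive constant: the partial derivatives are the convergent single integrals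
from `∞`). -/
structure IsLocalBranch (V : Set ℂ) (s : ℂ → ℂ) (F₁ : ℂ → ℂ) (F₂ : ℂ → ℂ → ℂ) : Prop where
  isOpen : IsOpen V
  ne_zero : ∀ x ∈ V, x ≠ 0
  continuousOn : ContinuousOn s V
  x_s : ∀ x ∈ V, C.x (s x) = x
  not_ram : ∀ x ∈ V, s x ∉ C.ram
  hasDerivAt_F₁ : ∀ x ∈ V, HasDerivAt F₁ (C.oneForm (s x)) (s x)
  hasDerivAt_F₂_left : ∀ x ∈ V, ∀ᶠ p : ℂ × ℂ in 𝓝 (s x, s x),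
    HasDerivAt (fun u => F₂ u p.2) (integralFromInfinity (fun t => C.hatOmega₂ p.1 t) p.2) p.1
  hasDerivAt_F₂_right : ∀ x ∈ V, ∀ᶠ p : ℂ × ℂ in 𝓝 (s x, s x),
    HasDerivAt (fun u => F₂ p.1 u) (integralFromInfinity (fun t => C.hatOmega₂ t p.2) p.1) p.2

end SpectralCurve

/-- A formal WKB series `e^{S(x)/ħ} ∑_k ħ^k φ_k(x)` with phase `S`.  The power series variable
is `ħ`, so that `φ_k(x)` is the `k`-th coefficient of `amp x`. -/
@[ext] structure WKBSeries (S : ℂ → ℂ) where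
  amp : ℂ → PowerSeries ℂ

namespace WKBSeries

variable {S : ℂ → ℂ}

instance : Sub (WKBSeries S) := ⟨fun φ ψ => ⟨fun x => φ.amp x - ψ.amp x⟩⟩

/-- Multiplication by a function of `x`. -/
noncomputable def mulFun (a : ℂ → ℂ) (ψ : WKBSeries S) : WKBSeries S :=
  ⟨fun x => PowerSeries.C (a x) * ψ.amp x⟩

/-- `ħ x d/dx`: it takes `e^{S/ħ} φ` to `e^{S/ħ} (x S' φ + ħ x ∂φ/∂x)`. -/
noncomputable def hbarTheta (ψ : WKBSeries S) : WKBSeries S :=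
  ⟨fun x => PowerSeries.C (x * deriv S x) * ψ.amp x +
    PowerSeries.X * PowerSeries.C x *
      PowerSeries.mk fun k => deriv (fun t => PowerSeries.coeff k (ψ.amp t)) x⟩

/-- `(ħ x d/dx - w) ψ`. -/
noncomputable def thetaSub (w : ℂ) (ψ : WKBSeries S) : WKBSeries S :=
  hbarTheta ψ - mulFun (fun _ => w) ψ

/-- Holomorphy on `V` of the phase and of all coefficients of the amplitude. -/
def HolomorphicOn (ψ : WKBSeries S) (V : Set ℂ) : Prop :=
  DifferentiableOn ℂ S V ∧
    ∀ k, DifferentiableOn ℂ (fun x => PowerSeries.coeff k (ψ.amp x)) V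

end WKBSeries

/-- The wave function `exp(∑_{m ≥ 0} ħ^{m-1} F_m(x))`, `F_m(x) = F_m(s(x))`, for the divisor
`[z] - [∞]`: its phase is `F_0`, its amplitude `e^{F_1} exp(∑_{m ≥ 2} ħ^{m-1} F_m)`, where the second
factor is the exponential of a formal power series in `ħ` without constant term. -/
noncomputable def SpectralCurve.waveFunction (C : SpectralCurve) (s : ℂ → ℂ) (F₁ : ℂ → ℂ)
    (F₂ : ℂ → ℂ → ℂ) : WKBSeries (fun x => C.wkbF F₁ F₂ 0 (s x)) :=
  ⟨fun x => PowerSeries.C (Complex.exp (C.wkbF F₁ F₂ 1 (s x))) *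
    (PowerSeries.exp ℂ).subst
      (PowerSeries.mk fun k => if k = 0 then 0 else C.wkbF F₁ F₂ (k + 1) (s x))⟩

/-- The curve of the equivariant `ℂP¹` model:
`x = z² - Λ`, `y = z + (w₀ + w₁)/2`, `Λ = (w₀ - w₁)²/4`. -/
noncomputable def gkzCurve (w₀ w₁ : ℂ) : SpectralCurve where
  x z := z ^ 2 - (w₀ - w₁) ^ 2 / 4
  y z := z + (w₀ + w₁) / 2
  ram := {0}
  conj _ z := -z
  x_differentiable := by fun_prop
  y_differentiable := by fun_prop
  mem_ram q := by simp
  simple q _ := by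
    have h : deriv (fun z : ℂ => z ^ 2 - (w₀ - w₁) ^ 2 / 4) = fun z => 2 * z := by
      funext z; simp
    rw [h]; simp
  deriv_y_ne q _ := by simp
  conj_analytic q _ := by fun_prop
  conj_self q hq := by simp at hq; simp [hq]
  x_conj q _ := by simp
  conj_ne q hq := by
    simp at hq
    subst hq
    filter_upwards [self_mem_nhdsWithin] with w hw h
    have : w ≠ 0 := hw
    exact this (self_eq_neg.mp h.symm)

/-- The parametrized curve is `{(x, y) : y² - (w₀ + w₁) y + w₀ w₁ - x = 0}`. -/
theorem gkzCurve_eq (w₀ w₁ z : ℂ) :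
    ((gkzCurve w₀ w₁).y z) ^ 2 - (w₀ + w₁) * (gkzCurve w₀ w₁).y z + w₀ * w₁
      - (gkzCurve w₀ w₁).x z = 0 := by
  simp only [gkzCurve]; ring

end TopRec

namespace TopRec

open MvPolynomial

/-! The recursion on this curve is a system of Virasoro constraints in disguise, and the GKZ
equation is the restriction of these constraints to the times of the divisor `[z] - [∞]`.

With `u = z⁻²`, each stable correlator is a polynomial in the variables `u_i`, without constant term
in any of them. It can therefore be stored as an iterated derivative at the origin of a function of
times `t₀, t₁, …`, the variable `z` corresponding to the direction `∑ u^{a+1} ∂_a`. The generating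
function is `log Z`, where `Z = ∑ ħ^n Z_n`, `Z_0 = 1` and `∂_i Z_{n+1} = -¼ (V_{i+1} - Λ V_i) Z_n`.
This system is solvable because its right-hand sides form a closed one-form, and closedness is
exactly the relation `[V_m, V_n] = 4 (m - n) V_{m+n-1}` (`vir_commutator`, `pderiv_recOp_symm`); a
Poincaré lemma for polynomials then gives `Z_{n+1}`.

Taking the logarithm turns the linear system into a quadratic recursion
(`corr_cons_freeCoeff_succ`). The residue at `w = 0` is the same recursion: on polynomials in `w⁻²`
the kernel acts as `-¼ (1 - Λ/z²)` followed by `w² ↦ z²`, the cross terms with `B(w, ·) + B(-w, ·)`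
give the first order parts of the Virasoro operators, and the terms with `B` alone give their zeroth
order parts. Induction on `2g + n` identifies `ω_n^{(g)}` with the order `2g + n - 2` of `log Z`
(`omega_gkzCurve`).

Integration from `∞` replaces the direction with components `z^{-2k-2}` by the time vector `tau z`
with components `-z^{-2k-1}/(2k+1)`. Hence the stable part of the wave function is `Z (tau z)`,
while `F_2^{(0)}` contributes a factor with the logarithmic derivative of `z^{-1/2}`
(`coeff_amp_waveFunction`, `hasDerivAt_diag`). At `t = tau z` the derivative along `∑ u^{a+1} ∂_a`
is `d/dz`, and the first order parts of the Virasoro operators are the terms coming from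
differentiating `u`. The constraints thus become an ordinary differential equation relating
`Z_{n+1}'` to `Z_n` (`hasDerivAt_specialTheta`). This is the GKZ equation at order `ħ^{n+2}`; the
two lowest orders are the equation of the curve and the transport equation (`gkz_waveFunction`). -/

/-- Polynomials in the times `t₀, t₁, …`. -/
abbrev Poly := MvPolynomial ℕ ℂ

/-! ### Derivations of the polynomial ring in the times -/

theorem C_ofNat (n : ℕ) [n.AtLeastTwo] : (C (OfNat.ofNat n) : Poly) = OfNat.ofNat n :=
  map_ofNat C n

theorem derivation_const_mul (D : Derivation ℂ Poly Poly) (c : ℂ) (φ : Poly) :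
    D (C c * φ) = C c * D φ := by
  rw [← MvPolynomial.smul_eq_C_mul, Derivation.map_smul, MvPolynomial.smul_eq_C_mul]

theorem pderiv_var (i j : ℕ) : pderiv i (X j : Poly) = if i = j then 1 else 0 := by
  rw [pderiv_X, Pi.single_apply]; simp [eq_comm]

/-- The commutator of two derivations is again a derivation, so it vanishes as soon as it kills the
variables. -/
theorem derivation_comm_of_X {D₁ D₂ : Derivation ℂ Poly Poly}
    (h : ∀ a, D₁ (D₂ (X a)) = D₂ (D₁ (X a))) (φ : Poly) : D₁ (D₂ φ) = D₂ (D₁ φ) := by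
  have : ⁅D₁, D₂⁆ = 0 := MvPolynomial.derivation_ext fun a => by
    rw [Derivation.commutator_apply, h, sub_self]; rfl
  have h2 := congrArg (fun D => D φ) this
  simp only [Derivation.commutator_apply, Derivation.coe_zero, Pi.zero_apply] at h2
  exact sub_eq_zero.mp h2

theorem pderiv_comm (i j : ℕ) (φ : Poly) :
    pderiv i (pderiv j φ) = pderiv j (pderiv i φ) :=
  derivation_comm_of_X (fun a => by
    rw [pderiv_var, pderiv_var]
    split_ifs <;> simp) φ

/-! ### Virasoro operators and their commutation relations -/

/-- The second order part `∑_{a + b = m - 2} ∂_a ∂_b` of a Virasoro operator. -/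
noncomputable def lap (m : ℕ) : Poly →ₗ[ℂ] Poly :=
  ∑ i ∈ Finset.range (m - 1),
    (pderiv i : Derivation ℂ Poly Poly).toLinearMap ∘ₗ
      (pderiv (m - 2 - i) : Derivation ℂ Poly Poly).toLinearMap

theorem lap_apply (m : ℕ) (φ : Poly) :
    lap m φ = ∑ i ∈ Finset.range (m - 1), pderiv i (pderiv (m - 2 - i) φ) := by
  simp [lap, LinearMap.sum_apply]

/-- The first order part `∑_k 2 (2k + 1) t_k ∂_{k + m - 1}` of a Virasoro operator. -/
noncomputable def shiftDer (m : ℕ) : Derivation ℂ Poly Poly :=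
  mkDerivation ℂ fun a => if m ≤ a + 1 then
    C (2 * (2 * ((a + 1 - m : ℕ) : ℂ) + 1)) * X (a + 1 - m) else 0

theorem shiftDer_X_of_le {m a : ℕ} (k : ℕ) (h : a + 1 = m + k) :
    shiftDer m (X a) = C (2 * (2 * (k : ℂ) + 1)) * X k := by
  rw [shiftDer, mkDerivation_X, if_pos (by omega), show a + 1 - m = k by omega]

theorem shiftDer_X_of_lt {m a : ℕ} (h : a + 1 < m) : shiftDer m (X a) = 0 := by
  rw [shiftDer, mkDerivation_X, if_neg (by omega)]

/-- The zeroth order part of a Virasoro operator. -/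
noncomputable def virConst : ℕ → Poly
  | 0 => X 0 ^ 2
  | 1 => C (1 / 4)
  | _ => 0

/-- The Virasoro operators. -/
noncomputable def vir (m : ℕ) : Poly →ₗ[ℂ] Poly :=
  lap m + (shiftDer m).toLinearMap + LinearMap.mulLeft ℂ (virConst m)

theorem vir_apply (m : ℕ) (φ : Poly) :
    vir m φ = lap m φ + shiftDer m φ + virConst m * φ := rfl

/-- The commutator is a derivation and is compared on variables. The index `k` stands for `m + a -
1`, so only `m = a = 0` is excluded; in that case the two operators commute. -/
theorem pderiv_shiftDer_of_pos {a m : ℕ} (k : ℕ) (h : m + a = k + 1) (φ : Poly) :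
    pderiv a (shiftDer m φ) =
      shiftDer m (pderiv a φ) + C (2 * (2 * (a : ℂ) + 1)) * pderiv k φ := by
  have : ⁅(pderiv a : Derivation ℂ Poly Poly), shiftDer m⁆ =
      (2 * (2 * (a : ℂ) + 1)) • (pderiv k : Derivation ℂ Poly Poly) := by
    refine MvPolynomial.derivation_ext fun b => ?_
    rw [Derivation.commutator_apply, Derivation.smul_apply, pderiv_var, pderiv_var]
    by_cases hb : m ≤ b + 1
    · obtain ⟨l, hl⟩ := Nat.exists_eq_add_of_le hb
      rw [shiftDer_X_of_le l hl, pderiv_C_mul, pderiv_var]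
      by_cases hal : l = a
      · subst hal
        rw [if_pos rfl, if_pos (show k = b by omega)]
        split_ifs <;> simp [MvPolynomial.smul_eq_C_mul]
      · rw [if_neg (Ne.symm hal), if_neg (show k ≠ b by omega)]
        split_ifs <;> simp
    · rw [shiftDer_X_of_lt (by omega),
        if_neg (show k ≠ b by omega)]
      split_ifs <;> simp
  have h2 := congrArg (fun D => D φ) this
  simp only [Derivation.commutator_apply, Derivation.smul_apply] at h2
  rw [sub_eq_iff_eq_add, MvPolynomial.smul_eq_C_mul] at h2
  rw [h2, add_comm]

theorem pderiv_zero_shiftDer_zero (φ : Poly) :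
    pderiv 0 (shiftDer 0 φ) = shiftDer 0 (pderiv 0 φ) := by
  refine derivation_comm_of_X (fun b => ?_) φ
  rw [shiftDer_X_of_le (b + 1) (by omega), pderiv_C_mul, pderiv_var, pderiv_var,
    if_neg (show 0 ≠ b + 1 by omega), mul_zero]
  split_ifs <;> simp

theorem pderiv_lap (a m : ℕ) (φ : Poly) : pderiv a (lap m φ) = lap m (pderiv a φ) := by
  rw [lap_apply, lap_apply, map_sum]
  refine Finset.sum_congr rfl fun i _ => ?_
  rw [pderiv_comm a i, pderiv_comm a (m - 2 - i)]

theorem pderiv_vir_of_pos {a m : ℕ} (k : ℕ) (h : m + a = k + 1) (φ : Poly) :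
    pderiv a (vir m φ) = vir m (pderiv a φ) + C (2 * (2 * (a : ℂ) + 1)) * pderiv k φ +
      pderiv a (virConst m) * φ := by
  rw [vir_apply, vir_apply, map_add, map_add, pderiv_lap, pderiv_shiftDer_of_pos k h, pderiv_mul]
  ring

theorem shiftDer_commutator_of_pos {m n : ℕ} (k : ℕ) (hm : 1 ≤ m) (hn : 1 ≤ n)
    (h : m + n = k + 1) (φ : Poly) :
    shiftDer m (shiftDer n φ) =
      shiftDer n (shiftDer m φ) + C (4 * ((m : ℂ) - n)) * shiftDer k φ := by
  have : ⁅shiftDer m, shiftDer n⁆ = (4 * ((m : ℂ) - n)) • shiftDer k := by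
    refine MvPolynomial.derivation_ext fun b => ?_
    rw [Derivation.commutator_apply, Derivation.smul_apply]
    by_cases hb : k ≤ b + 1
    · obtain ⟨l, hl⟩ := Nat.exists_eq_add_of_le hb
      rw [shiftDer_X_of_le (m := n) (m - 1 + l) (by omega),
        shiftDer_X_of_le (m := m) (n - 1 + l) (by omega), shiftDer_X_of_le l hl, derivation_const_mul,
        derivation_const_mul, shiftDer_X_of_le (m := m) l (by omega),
        shiftDer_X_of_le (m := n) l (by omega)]
      simp only [MvPolynomial.smul_eq_C_mul, ← mul_assoc, ← C_mul]
      rw [← sub_mul, ← C_sub]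
      congr 2
      push_cast [Nat.cast_sub hm, Nat.cast_sub hn]
      ring
    · rw [shiftDer_X_of_lt (m := k) (by omega), smul_zero]
      have aux : ∀ p q : ℕ, 1 ≤ p → p + q = k + 1 → shiftDer p (shiftDer q (X b)) = 0 := by
        intro p q hp hpq
        by_cases hq : q ≤ b + 1
        · obtain ⟨l, hl⟩ := Nat.exists_eq_add_of_le hq
          rw [shiftDer_X_of_le l hl, derivation_const_mul, shiftDer_X_of_lt (by omega), mul_zero]
        · rw [shiftDer_X_of_lt (by omega), map_zero]
      rw [aux m n hm h, aux n m hn (by omega), sub_zero]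
  have h2 := congrArg (fun D => D φ) this
  simp only [Derivation.commutator_apply, Derivation.smul_apply] at h2
  rw [sub_eq_iff_eq_add, MvPolynomial.smul_eq_C_mul] at h2
  rw [h2, add_comm]

theorem shiftDer_one_zero (φ : Poly) :
    shiftDer 1 (shiftDer 0 φ) = shiftDer 0 (shiftDer 1 φ) + C 4 * shiftDer 0 φ := by
  have : ⁅shiftDer 1, shiftDer 0⁆ = (4 : ℂ) • shiftDer 0 := by
    refine MvPolynomial.derivation_ext fun b => ?_
    rw [Derivation.commutator_apply, Derivation.smul_apply,
      shiftDer_X_of_le (m := 0) (b + 1) (by omega), shiftDer_X_of_le (m := 1) b (by omega),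
      derivation_const_mul, derivation_const_mul, shiftDer_X_of_le (m := 1) (b + 1) (by omega),
      shiftDer_X_of_le (m := 0) (b + 1) (by omega)]
    simp only [MvPolynomial.smul_eq_C_mul, ← mul_assoc, ← C_mul]
    rw [← sub_mul, ← C_sub]
    congr 2
    push_cast
    ring
  have h2 := congrArg (fun D => D φ) this
  simp only [Derivation.commutator_apply, Derivation.smul_apply] at h2
  rw [sub_eq_iff_eq_add, MvPolynomial.smul_eq_C_mul] at h2
  rw [h2, add_comm]

/-- The operator `shiftDer 0` raises every index and never produces `t₀`, so the expected relation
fails on the single variable `t_m`, which `shiftDer (m + 2)` kills although it sends `t_{m+1}` to a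
multiple of `t₀`. The defect `-4 t₀ ∂_m` is later compensated by the term `t₀²` of `V₀`. -/
theorem shiftDer_add_two_zero (m : ℕ) (φ : Poly) :
    shiftDer (m + 2) (shiftDer 0 φ) = shiftDer 0 (shiftDer (m + 2) φ) +
      C (4 * ((m : ℂ) + 2)) * shiftDer (m + 1) φ - C 4 * X 0 * pderiv m φ := by
  have : ⁅shiftDer (m + 2), shiftDer 0⁆ =
      (4 * ((m : ℂ) + 2)) • shiftDer (m + 1) -
        (C 4 * X 0 : Poly) • (pderiv m : Derivation ℂ Poly Poly) := by
    refine MvPolynomial.derivation_ext fun b => ?_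
    rw [Derivation.commutator_apply, Derivation.sub_apply, Derivation.smul_apply,
      Derivation.smul_apply, shiftDer_X_of_le (m := 0) (b + 1) (by omega), derivation_const_mul,
      pderiv_var]
    rcases lt_trichotomy b m with hb | hb | hb
    · rw [shiftDer_X_of_lt (m := m + 2) (by omega), shiftDer_X_of_lt (m := m + 2) (by omega),
        shiftDer_X_of_lt (m := m + 1) (by omega), if_neg (by omega)]
      simp
    · subst hb
      rw [shiftDer_X_of_le (m := b + 2) 0 (by omega), shiftDer_X_of_lt (m := b + 2) (by omega),
        shiftDer_X_of_le (m := b + 1) 0 (by omega), if_pos rfl]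
      simp only [MvPolynomial.smul_eq_C_mul, smul_eq_mul, ← mul_assoc, ← C_mul, mul_one, map_zero,
        sub_zero]
      rw [← sub_mul, ← C_sub]
      congr 2
      push_cast
      ring
    · obtain ⟨l, rfl⟩ := Nat.exists_eq_add_of_lt hb
      rw [shiftDer_X_of_le (m := m + 2) (l + 1) (by omega),
        shiftDer_X_of_le (m := m + 2) l (by omega),
        shiftDer_X_of_le (m := m + 1) (l + 1) (by omega), derivation_const_mul,
        shiftDer_X_of_le (m := 0) (l + 1) (by omega), if_neg (by omega)]
      simp only [MvPolynomial.smul_eq_C_mul, smul_eq_mul, ← mul_assoc, ← C_mul, mul_zero, sub_zero]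
      rw [← sub_mul, ← C_sub]
      congr 2
      push_cast
      ring
  have h2 := congrArg (fun D => D φ) this
  simp only [Derivation.commutator_apply, Derivation.smul_apply, Derivation.sub_apply] at h2
  rw [sub_eq_iff_eq_add, MvPolynomial.smul_eq_C_mul, smul_eq_mul] at h2
  rw [h2]
  ring

/-- `[p_a p_b, D_n]` for `n ≥ 1`. -/
theorem pderiv_pderiv_shiftDer_succ (a b n : ℕ) (φ : Poly) :
    pderiv a (pderiv b (shiftDer (n + 1) φ)) = shiftDer (n + 1) (pderiv a (pderiv b φ)) +
      C (2 * (2 * (a : ℂ) + 1)) * pderiv (a + n) (pderiv b φ) +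
      C (2 * (2 * (b : ℂ) + 1)) * pderiv a (pderiv (b + n) φ) := by
  rw [pderiv_shiftDer_of_pos (b + n) (by omega), map_add, pderiv_C_mul,
    pderiv_shiftDer_of_pos (a + n) (by omega)]

theorem lap_shiftDer_succ (m n : ℕ) (φ : Poly) :
    lap (m + 1) (shiftDer (n + 1) φ) = shiftDer (n + 1) (lap (m + 1) φ) +
      ∑ i ∈ Finset.range m,
        C (4 * (2 * (i : ℂ) + 1)) * pderiv (i + n) (pderiv (m - 1 - i) φ) := by
  have hrefl : ∑ i ∈ Finset.range m,
        C (2 * (2 * ((m - 1 - i : ℕ) : ℂ) + 1)) * pderiv i (pderiv (m - 1 - i + n) φ) =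
      ∑ i ∈ Finset.range m,
        C (2 * (2 * (i : ℂ) + 1)) * pderiv (i + n) (pderiv (m - 1 - i) φ) := by
    rw [← Finset.sum_range_reflect]
    refine Finset.sum_congr rfl fun i hi => ?_
    rw [Finset.mem_range] at hi
    rw [show m - 1 - (m - 1 - i) = i by omega, pderiv_comm]
  rw [lap_apply, lap_apply, map_sum, show m + 1 - 1 = m by omega, show m + 1 - 2 = m - 1 by omega]
  simp only [pderiv_pderiv_shiftDer_succ, Finset.sum_add_distrib]
  rw [hrefl, add_assoc, ← Finset.sum_add_distrib]
  congr 1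
  refine Finset.sum_congr rfl fun i _ => ?_
  rw [← add_mul, ← C_add]
  congr 2
  ring

theorem lap_shiftDer_commutator (m n : ℕ) (φ : Poly) :
    lap (m + 1) (shiftDer (n + 1) φ) + shiftDer (m + 1) (lap (n + 1) φ) =
      lap (n + 1) (shiftDer (m + 1) φ) + shiftDer (n + 1) (lap (m + 1) φ) +
        C (4 * ((m : ℂ) - n)) * lap (m + n + 1) φ := by
  have key : ∑ i ∈ Finset.range m,
        C (4 * (2 * (i : ℂ) + 1)) * pderiv (i + n) (pderiv (m - 1 - i) φ) =
      ∑ i ∈ Finset.range n,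
        C (4 * (2 * (i : ℂ) + 1)) * pderiv (i + m) (pderiv (n - 1 - i) φ) +
      C (4 * ((m : ℂ) - n)) * lap (m + n + 1) φ := by
    -- The two sums are, up to sign, the two ends of one sum of `g` over `range (n + m)`. As `f` is
    -- symmetric under reflection, the weight `4 (2i - 2n + 1)` may be replaced by its mean `4 (m -
    -- n)`.
    let f : ℕ → Poly := fun i => pderiv i (pderiv (m + n - 1 - i) φ)
    let g : ℕ → Poly := fun i => C (4 * (2 * (i : ℂ) - 2 * n + 1)) * f i
    have h1 : ∑ i ∈ Finset.range m,
        C (4 * (2 * (i : ℂ) + 1)) * pderiv (i + n) (pderiv (m - 1 - i) φ) =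
        ∑ i ∈ Finset.range m, g (n + i) := by
      refine Finset.sum_congr rfl fun i hi => ?_
      rw [Finset.mem_range] at hi
      simp only [g, f]
      rw [show m + n - 1 - (n + i) = m - 1 - i by omega, add_comm n i]
      congr 2
      push_cast; ring
    have h2 : ∑ i ∈ Finset.range n,
        C (4 * (2 * (i : ℂ) + 1)) * pderiv (i + m) (pderiv (n - 1 - i) φ) =
        - ∑ i ∈ Finset.range n, g i := by
      rw [← Finset.sum_range_reflect, ← Finset.sum_neg_distrib]
      refine Finset.sum_congr rfl fun i hi => ?_
      rw [Finset.mem_range] at hi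
      simp only [g, f]
      rw [show n - 1 - (n - 1 - i) = i by omega, show n - 1 - i + m = m + n - 1 - i by omega,
        pderiv_comm, ← neg_mul, ← C_neg, show n - 1 - i = n - (1 + i) by omega,
        Nat.cast_sub (by omega)]
      congr 2
      push_cast; ring
    have h3 : ∑ i ∈ Finset.range (n + m), g i =
        ∑ i ∈ Finset.range (n + m), C (4 * ((m : ℂ) - n)) * f i := by
      have h4 : ∑ i ∈ Finset.range (n + m), g i =
          ∑ i ∈ Finset.range (n + m), C (4 * (2 * (m : ℂ) - 2 * (i : ℂ) - 1)) * f i := by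
        rw [← Finset.sum_range_reflect]
        refine Finset.sum_congr rfl fun i hi => ?_
        rw [Finset.mem_range] at hi
        simp only [g, f]
        rw [show m + n - 1 - (n + m - 1 - i) = i by omega,
          show n + m - 1 - i = m + n - 1 - i by omega, pderiv_comm,
          show m + n - 1 - i = m + n - (1 + i) by omega, Nat.cast_sub (by omega)]
        congr 2
        push_cast; ring
      have h5 : (2 : Poly) * ∑ i ∈ Finset.range (n + m), g i =
          2 * ∑ i ∈ Finset.range (n + m), C (4 * ((m : ℂ) - n)) * f i := by
        rw [two_mul]
        nth_rw 2 [h4]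
        rw [← Finset.sum_add_distrib, Finset.mul_sum]
        refine Finset.sum_congr rfl fun i _ => ?_
        simp only [g]
        rw [← add_mul, ← C_add, ← mul_assoc]
        congr 1
        rw [← C_ofNat, ← C_mul]
        congr 1
        ring
      exact mul_left_cancel₀ two_ne_zero h5
    rw [h1, h2, lap_apply, show m + n + 1 - 1 = n + m by omega, Finset.mul_sum,
      show m + n + 1 - 2 = m + n - 1 by omega, ← h3, Finset.sum_range_add]
    ring
  rw [lap_shiftDer_succ, lap_shiftDer_succ, key]
  ring

theorem virConst_add_two (m : ℕ) : virConst (m + 2) = 0 := rfl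

theorem lap_comm (m n : ℕ) (φ : Poly) : lap m (lap n φ) = lap n (lap m φ) := by
  rw [lap_apply m, lap_apply m, map_sum]
  refine Finset.sum_congr rfl fun i _ => ?_
  rw [pderiv_lap, pderiv_lap]

theorem exists_virConst_succ (m : ℕ) : ∃ c : ℂ, virConst (m + 1) = C c := by
  cases m with
  | zero => exact ⟨1 / 4, rfl⟩
  | succ m => exact ⟨0, by rw [virConst_add_two, C_0]⟩

theorem lap_C_mul (m : ℕ) (c : ℂ) (φ : Poly) : lap m (C c * φ) = C c * lap m φ := by
  rw [← MvPolynomial.smul_eq_C_mul, map_smul, MvPolynomial.smul_eq_C_mul]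

theorem shiftDer_C_mul (m : ℕ) (c : ℂ) (φ : Poly) :
    shiftDer m (C c * φ) = C c * shiftDer m φ :=
  derivation_const_mul _ c φ

theorem vir_C_mul (m : ℕ) (c : ℂ) (φ : Poly) : vir m (C c * φ) = C c * vir m φ := by
  rw [← MvPolynomial.smul_eq_C_mul, map_smul, MvPolynomial.smul_eq_C_mul]

theorem sub_mul_virConst (m n : ℕ) :
    C (4 * ((m : ℂ) - n)) * virConst (m + n + 1) = 0 := by
  rcases m with _ | m
  · rcases n with _ | n
    · simp
    · rw [show 0 + (n + 1) + 1 = n + 2 by omega, virConst_add_two, mul_zero]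
  · rw [show m + 1 + n + 1 = m + n + 2 by omega, virConst_add_two, mul_zero]

theorem vir_commutator_succ (m n : ℕ) (φ : Poly) :
    vir (m + 1) (vir (n + 1) φ) = vir (n + 1) (vir (m + 1) φ) +
      C (4 * ((m : ℂ) - n)) * vir (m + n + 1) φ := by
  have h0 : C (4 * ((m : ℂ) - n)) * (virConst (m + n + 1) * φ) = 0 := by
    rw [← mul_assoc, sub_mul_virConst, zero_mul]
  obtain ⟨c, hc⟩ := exists_virConst_succ m
  obtain ⟨d, hd⟩ := exists_virConst_succ n
  have h1 := lap_shiftDer_commutator m n φ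
  have h2 := shiftDer_commutator_of_pos (m := m + 1) (n := n + 1) (m + n + 1) (by omega) (by omega)
    (by omega) φ
  have h3 := lap_comm (m + 1) (n + 1) φ
  rw [show (4 * (((m + 1 : ℕ) : ℂ) - ((n + 1 : ℕ) : ℂ))) = 4 * ((m : ℂ) - n) by push_cast; ring]
    at h2
  simp only [vir_apply, map_add, mul_add, hc, hd, lap_C_mul, shiftDer_C_mul] at h0 ⊢
  rw [h0]
  linear_combination h1 + h2 + h3

theorem lap_add_two_shiftDer_zero (m : ℕ) (φ : Poly) :
    lap (m + 2) (shiftDer 0 φ) = shiftDer 0 (lap (m + 2) φ) +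
      C (4 * ((m : ℂ) + 2)) * lap (m + 1) φ := by
  -- `f i` collects the commutator of `∂_i` with `shiftDer 0`; it is zero for `i = 0` because `∂₀`
  -- commutes with `shiftDer 0`.
  let f : ℕ → Poly := fun i => if i = 0 then 0 else
    C (2 * (2 * (i : ℂ) + 1)) * pderiv (i - 1) (pderiv (m - i) φ)
  have h1 : ∀ i ∈ Finset.range (m + 1), pderiv i (pderiv (m - i) (shiftDer 0 φ)) =
      shiftDer 0 (pderiv i (pderiv (m - i) φ)) + (f i + f (m - i)) := by
    intro i hi
    rw [Finset.mem_range] at hi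
    have h2 : ∀ (j : ℕ) (ψ : Poly), pderiv j (shiftDer 0 ψ) = shiftDer 0 (pderiv j ψ) +
        (if j = 0 then 0 else C (2 * (2 * (j : ℂ) + 1)) * pderiv (j - 1) ψ) := by
      intro j ψ
      rcases j with _ | j
      · rw [pderiv_zero_shiftDer_zero, if_pos rfl, add_zero]
      · rw [pderiv_shiftDer_of_pos j (by omega), if_neg (by omega)]; rfl
    rw [h2, map_add, h2, add_assoc]
    congr 2
    simp only [f]
    split_ifs with h3
    · simp
    · rw [pderiv_C_mul, pderiv_comm, show m - (m - i) = i by omega]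
  have h4 : ∑ i ∈ Finset.range (m + 1), f (m - i) = ∑ i ∈ Finset.range (m + 1), f i := by
    rw [← Finset.sum_range_reflect]
    refine Finset.sum_congr rfl fun i hi => ?_
    rw [Finset.mem_range] at hi
    congr 1; omega
  have h5 : ∑ i ∈ Finset.range (m + 1), f i =
      ∑ i ∈ Finset.range m, C (2 * (2 * (i : ℂ) + 3)) * pderiv i (pderiv (m - 1 - i) φ) := by
    rw [Finset.sum_range_succ', show f 0 = 0 from if_pos rfl, add_zero]
    refine Finset.sum_congr rfl fun i hi => ?_
    simp only [f]
    rw [if_neg (by omega), show m - (i + 1) = m - 1 - i by omega]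
    congr 2
    push_cast; ring
  -- Reflection again: the weights `2 (2i + 3)` and `2 (2m - 2i + 1)` add up to the constant `4 (m +
  -- 2)`.
  have h6 : ∑ i ∈ Finset.range m, C (2 * (2 * (i : ℂ) + 3)) * pderiv i (pderiv (m - 1 - i) φ) =
      ∑ i ∈ Finset.range m,
        C (2 * (2 * (m : ℂ) - 2 * i + 1)) * pderiv i (pderiv (m - 1 - i) φ) := by
    rw [← Finset.sum_range_reflect]
    refine Finset.sum_congr rfl fun i hi => ?_
    rw [Finset.mem_range] at hi
    rw [show m - 1 - (m - 1 - i) = i by omega, pderiv_comm, show m - 1 - i = m - (1 + i) by omega,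
      Nat.cast_sub (by omega)]
    congr 2
    push_cast; ring
  rw [lap_apply, lap_apply, lap_apply, show m + 2 - 1 = m + 1 by omega,
    show m + 2 - 2 = m by omega, show m + 1 - 1 = m by omega, show m + 1 - 2 = m - 1 by omega,
    Finset.sum_congr rfl h1, Finset.sum_add_distrib, Finset.sum_add_distrib, map_sum, h4, h5]
  nth_rw 2 [h6]
  rw [← Finset.sum_add_distrib, Finset.mul_sum]
  congr 1
  refine Finset.sum_congr rfl fun i _ => ?_
  rw [← add_mul, ← C_add]
  congr 2
  ring

theorem pderiv_pderiv_sq_mul (a b : ℕ) (φ : Poly) :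
    pderiv a (pderiv b (X 0 ^ 2 * φ)) = X 0 ^ 2 * pderiv a (pderiv b φ) +
      (if a = 0 then 2 * X 0 * pderiv b φ else 0) + (if b = 0 then 2 * X 0 * pderiv a φ else 0) +
      (if a = 0 ∧ b = 0 then 2 * φ else 0) := by
  have h : ∀ j : ℕ, pderiv j (X 0 : Poly) = if j = 0 then 1 else 0 := fun j => pderiv_var j 0
  have h2 : pderiv a (2 : Poly) = 0 := by
    rw [← C_ofNat, pderiv_C]
  simp only [pderiv_mul, pderiv_pow, h, map_add]
  by_cases ha : a = 0 <;> by_cases hb : b = 0 <;> simp [ha, hb, h2] <;>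
    first | done | (subst ha; rw [show pderiv 0 (2 : Poly) = 0 from h2]; ring) | ring

theorem lap_one (φ : Poly) : lap 1 φ = 0 := by simp [lap_apply]

theorem lap_zero (φ : Poly) : lap 0 φ = 0 := by simp [lap_apply]

theorem lap_two_sq_mul (φ : Poly) :
    lap 2 (X 0 ^ 2 * φ) = X 0 ^ 2 * lap 2 φ + 4 * X 0 * pderiv 0 φ + 2 * φ := by
  simp only [lap_apply, Nat.add_one_sub_one, Finset.sum_range_one, Nat.sub_self]
  rw [pderiv_pderiv_sq_mul, if_pos rfl, if_pos ⟨rfl, rfl⟩]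
  ring

theorem lap_add_three_sq_mul (m : ℕ) (φ : Poly) :
    lap (m + 3) (X 0 ^ 2 * φ) = X 0 ^ 2 * lap (m + 3) φ + 4 * X 0 * pderiv (m + 1) φ := by
  simp only [lap_apply, pderiv_pderiv_sq_mul, Finset.sum_add_distrib]
  rw [show m + 3 - 1 = m + 1 + 1 by omega, show m + 3 - 2 = m + 1 by omega, Finset.mul_sum]
  have h1 : ∑ i ∈ Finset.range (m + 1 + 1),
      (if i = 0 then 2 * X 0 * pderiv (m + 1 - i) φ else 0) = 2 * X 0 * pderiv (m + 1) φ := by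
    rw [Finset.sum_eq_single 0]
    · simp
    · intro b _ hb; rw [if_neg hb]
    · intro h; simp at h
  have h2 : ∑ i ∈ Finset.range (m + 1 + 1),
      (if m + 1 - i = 0 then 2 * X 0 * pderiv i φ else 0) = 2 * X 0 * pderiv (m + 1) φ := by
    rw [Finset.sum_eq_single (m + 1)]
    · simp
    · intro b hb hb'; rw [Finset.mem_range] at hb; rw [if_neg (by omega)]
    · intro h; simp at h
  have h3 : ∑ i ∈ Finset.range (m + 1 + 1),
      (if i = 0 ∧ m + 1 - i = 0 then 2 * φ else 0) = 0 :=
    Finset.sum_eq_zero fun i _ => if_neg (by omega)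
  rw [h1, h2, h3]
  ring

theorem shiftDer_sq_mul (m : ℕ) (φ : Poly) :
    shiftDer m (X 0 ^ 2 * φ) =
      X 0 ^ 2 * shiftDer m φ + 2 * X 0 * shiftDer m (X 0) * φ := by
  rw [Derivation.leibniz, Derivation.leibniz_pow]
  simp only [smul_eq_mul, nsmul_eq_mul, pow_one, Nat.add_one_sub_one]
  push_cast
  ring

/-- This relation explains the zeroth order terms of the operators. The second derivatives in
`V_{m+1}` acting on `t₀²` give `4 t₀ ∂_{m-1}`, which cancels the defect of `shiftDer_add_two_zero`.
For `m = 1` they also give the constant `2 = 8 · ¼`, which forces the constant `¼` in `V₁`. -/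
theorem vir_commutator_zero (m : ℕ) (φ : Poly) :
    vir (m + 1) (vir 0 φ) = vir 0 (vir (m + 1) φ) + C (4 * ((m : ℂ) + 1)) * vir m φ := by
  rcases m with _ | m
  · simp only [vir_apply, zero_add, lap_one, lap_zero, virConst, map_add, shiftDer_sq_mul,
      shiftDer_C_mul, shiftDer_one_zero, shiftDer_X_of_le (m := 1) (a := 0) 0 rfl]
    simp only [Nat.cast_zero, mul_zero, zero_add, mul_one]
    rw [show (C 4 : Poly) = C 2 * 2 by rw [← C_ofNat 2, ← C_mul]; norm_num]
    ring
  · have hC : (C 4 : Poly) = 4 := C_ofNat 4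
    rcases m with _ | m
    · have h1 := lap_add_two_shiftDer_zero 0 φ
      have h2 := shiftDer_add_two_zero 0 φ
      have h3 := lap_two_sq_mul φ
      have hx : C (4 * ((0 : ℂ) + 2)) * C (1 / 4) = (2 : Poly) := by
        rw [← C_mul, ← C_ofNat 2]; norm_num
      simp only [vir_apply, zero_add, lap_zero, virConst, map_add, shiftDer_sq_mul,
        shiftDer_X_of_lt (show 0 + 1 < 2 by omega)] at h1 h2 h3 ⊢
      rw [lap_one] at *
      push_cast at *
      rw [h1, h2, h3, hC]
      rw [show (4 * ((1 : ℂ) + 1)) = 4 * (0 + 2) by ring, zero_mul φ, map_zero]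
      linear_combination - φ * hx
    · have h1 := lap_add_two_shiftDer_zero (m + 1) φ
      have h2 := shiftDer_add_two_zero (m + 1) φ
      have h3 := lap_add_three_sq_mul m φ
      simp only [vir_apply, lap_zero, virConst, map_add, shiftDer_sq_mul, zero_mul, add_zero,
        zero_add, shiftDer_X_of_lt (show 0 + 1 < m + 1 + 2 by omega)] at h1 h2 h3 ⊢
      rw [show m + 1 + 1 + 1 = m + 1 + 2 by omega, h1, h2, show m + 1 + 2 = m + 3 by omega, h3, hC,
        show (4 * (((m + 1 + 1 : ℕ) : ℂ) + 1)) = 4 * (((m + 1 : ℕ) : ℂ) + 2) by push_cast; ring]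
      ring

theorem vir_commutator {m n k : ℕ} (h : m + n = k + 1) (φ : Poly) :
    vir m (vir n φ) = vir n (vir m φ) + C (4 * ((m : ℂ) - n)) * vir k φ := by
  rcases m with _ | m
  · rcases n with _ | n
    · omega
    · obtain rfl : k = n := by omega
      rw [vir_commutator_zero, add_assoc, ← add_mul, ← C_add]
      push_cast
      ring_nf
      simp
  · rcases n with _ | n
    · obtain rfl : k = m := by omega
      rw [vir_commutator_zero]
      push_cast
      ring_nf
    · obtain rfl : k = m + n + 1 := by omega
      rw [vir_commutator_succ]
      push_cast
      ring_nf

/-! ### Finiteness: a polynomial involves only finitely many times -/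

theorem derivation_sum_apply {ι : Type*} (s : Finset ι) (D : ι → Derivation ℂ Poly Poly)
    (φ : Poly) : (∑ i ∈ s, D i) φ = ∑ i ∈ s, D i φ := by
  classical
  induction s using Finset.induction_on with
  | empty => simp
  | insert a s ha ih => rw [Finset.sum_insert ha, Finset.sum_insert ha, Derivation.add_apply, ih]

/-- The chain rule. With infinitely many variables the sum has to be cut off at a finite set outside
of which the partial derivatives vanish. -/
theorem derivation_eq_sum (D : Derivation ℂ Poly Poly) {φ : Poly} {s : Finset ℕ}
    (h : ∀ i ∉ s, pderiv i φ = 0) : D φ = ∑ i ∈ s, pderiv i φ * D (X i) := by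
  have h1 : D φ = ∑ i ∈ φ.vars, pderiv i φ * D (X i) := by
    have h2 : D φ = (∑ i ∈ φ.vars, D (X i) • (pderiv i : Derivation ℂ Poly Poly)) φ := by
      refine MvPolynomial.derivation_eq_of_forall_mem_vars fun j hj => ?_
      simp [derivation_sum_apply, Pi.single_apply, hj]
    rw [h2]
    simp [derivation_sum_apply, mul_comm]
  rw [h1, Finset.sum_subset (Finset.subset_union_left (s₂ := s)),
    ← Finset.sum_subset (Finset.subset_union_right (s₁ := φ.vars))]
  · intro i _ hi; rw [h i hi, zero_mul]
  · intro i _ hi; rw [pderiv_eq_zero_of_notMem_vars hi, zero_mul]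

theorem exists_pderiv_eq_zero (φ : Poly) :
    ∃ N, ∀ i, N ≤ i → pderiv i φ = 0 := by
  refine ⟨φ.vars.sup id + 1, fun i hi => pderiv_eq_zero_of_notMem_vars fun h => ?_⟩
  have := Finset.le_sup (f := id) h
  simp only [id] at this
  omega

theorem derivation_eq_sum_range (D : Derivation ℂ Poly Poly) {φ : Poly} {N : ℕ}
    (h : ∀ i, N ≤ i → pderiv i φ = 0) :
    D φ = ∑ i ∈ Finset.range N, pderiv i φ * D (X i) :=
  derivation_eq_sum D fun i hi => h i (by simpa using hi)

theorem lap_eq_zero {φ : Poly} {N m : ℕ} (h : ∀ i, N ≤ i → pderiv i φ = 0) (hm : 2 * N + 2 ≤ m) :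
    lap m φ = 0 := by
  rw [lap_apply]
  refine Finset.sum_eq_zero fun i _ => ?_
  by_cases hi : N ≤ i
  · rw [pderiv_comm, h i hi, map_zero]
  · rw [h (m - 2 - i) (by omega), map_zero]

theorem shiftDer_eq_zero {φ : Poly} {N m : ℕ} (h : ∀ i, N ≤ i → pderiv i φ = 0) (hm : N + 1 ≤ m) :
    shiftDer m φ = 0 := by
  rw [derivation_eq_sum_range _ h]
  refine Finset.sum_eq_zero fun i hi => ?_
  rw [Finset.mem_range] at hi
  rw [shiftDer_X_of_lt (by omega), mul_zero]

theorem vir_eq_zero {φ : Poly} {N m : ℕ} (h : ∀ i, N ≤ i → pderiv i φ = 0) (hm : 2 * N + 2 ≤ m) :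
    vir m φ = 0 := by
  obtain ⟨k, rfl⟩ := Nat.exists_eq_add_of_le' (show 2 ≤ m by omega)
  rw [vir_apply, lap_eq_zero h hm, shiftDer_eq_zero h (by omega), virConst_add_two]
  ring

/-! ### Integrability of the recursion -/

/-- The operators `-¼ (V_{i+1} - Λ V_i)` which generate the topological recursion. -/
noncomputable def recOp (Λ : ℂ) (i : ℕ) (φ : Poly) : Poly :=
  C (-1 / 4) * (vir (i + 1) φ - C Λ * vir i φ)

theorem recOp_eq_zero (Λ : ℂ) (φ : Poly) : ∃ N, ∀ i, N ≤ i → recOp Λ i φ = 0 := by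
  obtain ⟨N, hN⟩ := exists_pderiv_eq_zero φ
  refine ⟨2 * N + 2, fun i hi => ?_⟩
  rw [recOp, vir_eq_zero hN (by omega), vir_eq_zero hN hi]
  ring

theorem pderiv_virConst_succ (a m : ℕ) : pderiv a (virConst (m + 1)) = 0 := by
  obtain ⟨c, hc⟩ := exists_virConst_succ m
  rw [hc, pderiv_C]

theorem pderiv_virConst {a m : ℕ} (h : 1 ≤ a + m) : pderiv a (virConst m) = 0 := by
  rcases m with _ | m
  · rw [virConst, pderiv_pow, pderiv_var, if_neg (by omega), mul_zero]
  · exact pderiv_virConst_succ a m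

/-- Closedness of the one-form that defines the next coefficient. Moving `∂_j` past `recOp Λ i`
gives `recOp Λ i (recOp Λ j φ')` and terms with coefficient `2 (2j + 1)`. After antisymmetrization
in `i`, `j` the latter carry `4 (j - i)` and cancel the Virasoro commutators, whose coefficient is
`4 (i - j)`. -/
theorem pderiv_recOp_symm {Λ : ℂ} {φ φ' : Poly} (h : ∀ i, pderiv i φ = recOp Λ i φ') (i j : ℕ) :
    pderiv j (recOp Λ i φ) = pderiv i (recOp Λ j φ) := by
  -- The diagonal case is trivial. Off the diagonal `i + j ≥ 1`, so `i + j - 1` is a genuine index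
  -- and no derivative of the term `t₀²` of `V₀` appears.
  rcases eq_or_ne i j with rfl | hij
  · rfl
  obtain ⟨k, hk⟩ : ∃ k, i + j = k + 1 := ⟨i + j - 1, by omega⟩
  have aux : ∀ i j, i + j = k + 1 → pderiv j (recOp Λ i φ) =
      C (-1 / 4) * (vir (i + 1) (recOp Λ j φ') + C (2 * (2 * (j : ℂ) + 1)) * recOp Λ (k + 1) φ' -
        C Λ * (vir i (recOp Λ j φ') + C (2 * (2 * (j : ℂ) + 1)) * recOp Λ k φ')) := by
    intro i j hij
    rw [recOp, pderiv_C_mul, map_sub, pderiv_C_mul, pderiv_vir_of_pos (k + 1) (by omega),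
      pderiv_vir_of_pos k (by omega), pderiv_virConst (by omega), pderiv_virConst (by omega),
      h j, h k, h (k + 1)]
    ring
  rw [aux i j hk, aux j i (by omega)]
  have h1 := vir_commutator (m := i + 1) (n := j + 1) (k := k + 2) (by omega) φ'
  have h2 := vir_commutator (m := i + 1) (n := j) (k := k + 1) (by omega) φ'
  have h3 := vir_commutator (m := i) (n := j + 1) (k := k + 1) (by omega) φ'
  have h4 := vir_commutator (m := i) (n := j) (k := k) (by omega) φ'
  have e3 : (C 2 : Poly) = 2 := C_ofNat 2
  have e4 : (C 4 : Poly) = 4 := C_ofNat 4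
  have e1 : (C (2 * (2 * (j : ℂ) + 1)) : Poly) = 4 * C (j : ℂ) + 2 := by
    simp only [C_mul, C_add, e3, C_1]; ring
  have e2 : (C (2 * (2 * (i : ℂ) + 1)) : Poly) = 4 * C (i : ℂ) + 2 := by
    simp only [C_mul, C_add, e3, C_1]; ring
  simp only [recOp, vir_C_mul, map_sub, e1, e2]
  push_cast at h1 h2 h3 h4
  simp only [C_mul, C_sub, C_add, e4, C_1] at h1 h2 h3 h4
  linear_combination C (-1 / 4) ^ 2 * (h1 - C Λ * h2 - C Λ * h3 + C Λ ^ 2 * h4)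

/-! ### Potentials of closed one-forms with polynomial coefficients -/

/-- The operator dividing the monomials of degree `d` by `d + c`. -/
noncomputable def degDiv (c : ℕ) : Poly →ₗ[ℂ] Poly :=
  (MvPolynomial.basisMonomials ℕ ℂ).constr ℂ fun m => monomial m (1 / ((m.degree : ℂ) + c))

theorem degDiv_monomial (c : ℕ) (m : ℕ →₀ ℕ) :
    degDiv c (monomial m 1) = monomial m (1 / ((m.degree : ℂ) + c)) := by
  have := (MvPolynomial.basisMonomials ℕ ℂ).constr_basis ℂ
    (fun m => (monomial m (1 / ((m.degree : ℂ) + c)) : Poly)) m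
  simpa [degDiv] using this

theorem degDiv_monomial' (c : ℕ) (m : ℕ →₀ ℕ) (a : ℂ) :
    degDiv c (monomial m a) = monomial m (a / ((m.degree : ℂ) + c)) := by
  have : (monomial m a : Poly) = a • monomial m 1 := by simp [MvPolynomial.smul_monomial]
  rw [this, map_smul, degDiv_monomial, MvPolynomial.smul_monomial, smul_eq_mul, mul_one_div]

theorem pderiv_degDiv (j : ℕ) (φ : Poly) :
    pderiv j (degDiv 1 φ) = degDiv 2 (pderiv j φ) := by
  induction φ using MvPolynomial.induction_on' with
  | monomial m a =>
    rw [degDiv_monomial', pderiv_monomial, pderiv_monomial, degDiv_monomial']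
    by_cases h : m j = 0
    · simp [h]
    · have h1 : m.degree = (m - Finsupp.single j 1).degree + 1 := by
        have : m = (m - Finsupp.single j 1) + Finsupp.single j 1 := by
          ext i
          by_cases hi : j = i
          · subst hi; simp; omega
          · simp [hi]
        conv_lhs => rw [this]
        rw [map_add, Finsupp.degree_single]
      rw [h1]
      congr 1
      push_cast
      ring
  | add p q hp hq => simp only [map_add, hp, hq]

theorem X_mul_degDiv (i : ℕ) (φ : Poly) : X i * degDiv 2 φ = degDiv 1 (X i * φ) := by
  induction φ using MvPolynomial.induction_on' with
  | monomial m a =>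
    rw [degDiv_monomial', X, monomial_mul, monomial_mul, degDiv_monomial', map_add,
      Finsupp.degree_single]
    congr 1
    push_cast
    ring
  | add p q hp hq => simp only [map_add, mul_add, hp, hq]

/-- Euler's identity: on monomials of degree `d` the vector field `∑ t_i ∂_i` is multiplication by
`d`, so the left side multiplies them by `(1 + d)/(d + 1)`. -/
theorem degDiv_add_euler (φ : Poly) :
    degDiv 1 φ + degDiv 1 (mkDerivation ℂ (X : ℕ → Poly) φ) = φ := by
  induction φ using MvPolynomial.induction_on' with
  | monomial m a =>
    have h : mkDerivation ℂ (X : ℕ → Poly) (monomial m a) = monomial m (a * m.degree) := by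
      rw [mkDerivation_monomial, Finsupp.sum]
      have : ∀ i ∈ m.support, (monomial (m - Finsupp.single i 1) ((m i : ℕ) : ℂ) : Poly) • (X i) =
          monomial m ((m i : ℕ) : ℂ) := by
        intro i hi
        rw [smul_eq_mul, X, monomial_mul, mul_one]
        have h0 : (m i : ℕ) ≠ 0 := Finsupp.mem_support_iff.mp hi
        have h1 : m - Finsupp.single i 1 + Finsupp.single i 1 = m := by
          refine Finsupp.ext fun j => ?_
          by_cases hj : i = j
          · subst hj; simp; omega
          · simp [hj]
        rw [h1]
      rw [Finset.sum_congr rfl this, ← map_sum, MvPolynomial.smul_monomial, smul_eq_mul,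
        Finsupp.degree_apply]
      push_cast
      rfl
    rw [h, degDiv_monomial', degDiv_monomial', ← map_add]
    congr 1
    have : ((m.degree : ℂ) + 1) ≠ 0 := Nat.cast_add_one_ne_zero _
    push_cast
    field_simp
    ring
  | add p q hp hq =>
    simp only [map_add]
    linear_combination hp + hq

/-- The Poincaré lemma. Since `degDiv 1 R` is `∫₀¹ R(st) ds`, the sum is the usual radial homotopy
applied to `∑ R_i dt_i`; closedness turns its `j`-th derivative into the left side of Euler's
identity for `R_j`. -/
theorem pderiv_sum_X_mul_degDiv {R : ℕ → Poly} {N : ℕ} (hN : ∀ i, N ≤ i → R i = 0)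
    (hR : ∀ i j, pderiv j (R i) = pderiv i (R j)) (j : ℕ) :
    pderiv j (∑ i ∈ Finset.range N, X i * degDiv 1 (R i)) = R j := by
  have h1 : mkDerivation ℂ (X : ℕ → Poly) (R j) =
      ∑ i ∈ Finset.range N, pderiv i (R j) * X i := by
    rw [derivation_eq_sum_range (N := N)]
    · exact Finset.sum_congr rfl fun i _ => by rw [mkDerivation_X]
    · intro i hi; rw [← hR i j, hN i hi, map_zero]
  have h2 : ∑ i ∈ Finset.range N, (if j = i then 1 else 0) * degDiv 1 (R i) = degDiv 1 (R j) := by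
    by_cases hj : j < N
    · rw [Finset.sum_eq_single j]
      · rw [if_pos rfl, one_mul]
      · intro b _ hb; rw [if_neg hb.symm, zero_mul]
      · intro h; exact absurd (Finset.mem_range.mpr hj) h
    · rw [hN j (by omega), map_zero]
      exact Finset.sum_eq_zero fun i hi => by
        rw [Finset.mem_range] at hi; rw [if_neg (by omega), zero_mul]
  have h3 : ∀ i ∈ Finset.range N, pderiv j (X i * degDiv 1 (R i)) =
      (if j = i then 1 else 0) * degDiv 1 (R i) + degDiv 1 (X i * pderiv j (R i)) := by
    intro i _
    rw [pderiv_mul, pderiv_var, pderiv_degDiv, X_mul_degDiv]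
  have h4 := degDiv_add_euler (R j)
  rw [h1, map_sum] at h4
  rw [map_sum, Finset.sum_congr rfl h3, Finset.sum_add_distrib, h2]
  have h5 : ∑ i ∈ Finset.range N, degDiv 1 (X i * pderiv j (R i)) =
      ∑ i ∈ Finset.range N, degDiv 1 (pderiv i (R j) * X i) :=
    Finset.sum_congr rfl fun i _ => by rw [hR, mul_comm]
  rw [h5, h4]

theorem exists_potential {R : ℕ → Poly} {N : ℕ} (hN : ∀ i, N ≤ i → R i = 0)
    (hR : ∀ i j, pderiv j (R i) = pderiv i (R j)) :
    ∃ φ : Poly, constantCoeff φ = 0 ∧ ∀ i, pderiv i φ = R i :=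
  ⟨∑ i ∈ Finset.range N, X i * degDiv 1 (R i), by
    rw [map_sum]
    exact Finset.sum_eq_zero fun i _ => by rw [map_mul, constantCoeff_X, zero_mul],
    pderiv_sum_X_mul_degDiv hN hR⟩

/-- A polynomial without constant term and with the given partial derivatives, if there is one. -/
noncomputable def potential (R : ℕ → Poly) : Poly :=
  open Classical in
  if h : ∃ φ : Poly, constantCoeff φ = 0 ∧ ∀ i, pderiv i φ = R i then h.choose else 0

theorem constantCoeff_potential (R : ℕ → Poly) : constantCoeff (potential R) = 0 := by
  rw [potential]
  split_ifs with h
  · exact h.choose_spec.1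
  · exact map_zero _

/-! ### The partition function and generating functions of the constraints -/

/-- The expansion coefficients of the partition function. -/
noncomputable def partitionCoeff (Λ : ℂ) : ℕ → Poly
  | 0 => 1
  | n + 1 => potential fun i => recOp Λ i (partitionCoeff Λ n)

theorem constantCoeff_partitionCoeff_succ (Λ : ℂ) (n : ℕ) :
    constantCoeff (partitionCoeff Λ (n + 1)) = 0 :=
  constantCoeff_potential _

theorem pderiv_potential_recOp {Λ : ℂ} {φ φ' : Poly} (h : ∀ i, pderiv i φ = recOp Λ i φ') (i : ℕ) :
    pderiv i (potential fun i => recOp Λ i φ) = recOp Λ i φ := by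
  obtain ⟨N, hN⟩ := recOp_eq_zero Λ φ
  have h2 := exists_potential hN (pderiv_recOp_symm h)
  rw [potential, dif_pos h2]
  exact h2.choose_spec.2 i

theorem pderiv_partitionCoeff_succ (Λ : ℂ) (n i : ℕ) :
    pderiv i (partitionCoeff Λ (n + 1)) = recOp Λ i (partitionCoeff Λ n) := by
  induction n generalizing i with
  | zero =>
    -- Closedness at one order uses the recursion at the previous one. For `Z_0 = 1` the predecessor
    -- `0` serves, because all derivatives of `1` vanish.
    refine pderiv_potential_recOp (φ' := 0) (fun i => ?_) i
    simp [partitionCoeff, recOp]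
  | succ n ih => exact pderiv_potential_recOp ih i

/-- The directional derivative with constant coefficients `c`. -/
noncomputable def dir (c : ℕ → ℂ) : Derivation ℂ Poly Poly := mkDerivation ℂ fun a => C (c a)

/-- The coefficients of the differential operator `∑_a u^{a+1} ∂_a` with `u = z⁻²`. -/
def pw (u : ℂ) : ℕ → ℂ := fun a => u ^ (a + 1)

theorem dir_X (c : ℕ → ℂ) (a : ℕ) : dir c (X a) = C (c a) := mkDerivation_X _ _ _

/-- The generating function `∑_m u^m shiftDer m`. -/
noncomputable def modeDer (u : ℂ) : Derivation ℂ Poly Poly :=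
  mkDerivation ℂ fun a =>
    ∑ k ∈ Finset.range (a + 2), C (2 * (2 * (k : ℂ) + 1) * u ^ (a + 1 - k)) * X k

theorem modeDer_X (u : ℂ) (a : ℕ) : modeDer u (X a) =
    ∑ k ∈ Finset.range (a + 2), C (2 * (2 * (k : ℂ) + 1) * u ^ (a + 1 - k)) * X k :=
  mkDerivation_X _ _ _

theorem sum_range_two_mul_diag {M : Type*} [AddCommMonoid M] {f : ℕ → ℕ → M} {N : ℕ}
    (hl : ∀ i j, N ≤ i → f i j = 0) (hr : ∀ i j, N ≤ j → f i j = 0) :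
    ∑ m ∈ Finset.range (2 * N), ∑ i ∈ Finset.range (m + 1), f i (m - i) =
      ∑ i ∈ Finset.range N, ∑ j ∈ Finset.range N, f i j := by
  rw [Finset.sum_range_diag_flip (2 * N) f, ← Finset.sum_subset
    (Finset.range_subset_range.mpr (show N ≤ 2 * N by omega))]
  · refine Finset.sum_congr rfl fun i hi => ?_
    rw [Finset.mem_range] at hi
    rw [← Finset.sum_subset (Finset.range_subset_range.mpr (show N ≤ 2 * N - i by omega))]
    intro j _ hj
    exact hr i j (by simpa using hj)
  · intro i _ hi
    exact Finset.sum_eq_zero fun j _ => hl i j (by simpa using hi)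

/-- The square of `∑ u^{a+1} ∂_a` has the terms `u^{a+b+2} ∂_a ∂_b`, here grouped by `m = a + b +
2`. All nonzero terms lie below the bound `2N + 2`. -/
theorem sum_lap {φ : Poly} {N : ℕ} (h : ∀ i, N ≤ i → pderiv i φ = 0) (u : ℂ) :
    ∑ m ∈ Finset.range (2 * N + 2), C (u ^ m) * lap m φ = dir (pw u) (dir (pw u) φ) := by
  have h2 : ∀ i, N ≤ i → pderiv i (dir (pw u) φ) = 0 := by
    intro i hi
    rw [derivation_comm_of_X (D₁ := pderiv i) (D₂ := dir (pw u)), h i hi, map_zero]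
    intro a
    rw [dir_X, pderiv_C, pderiv_var]
    split_ifs <;> simp
  rw [Finset.sum_range_succ', Finset.sum_range_succ', lap_zero, lap_one, mul_zero, add_zero,
    mul_zero, add_zero, derivation_eq_sum_range (dir (pw u)) h2]
  have h3 : ∀ m ∈ Finset.range (2 * N), C (u ^ (m + 1 + 1)) * lap (m + 1 + 1) φ =
      ∑ i ∈ Finset.range (m + 1),
        (fun i j => C (u ^ (i + 1) * u ^ (j + 1)) * pderiv i (pderiv j φ)) i (m - i) := by
    intro m _
    rw [lap_apply, Finset.mul_sum]
    refine Finset.sum_congr rfl fun i hi => ?_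
    have hi' : i < m + 1 := Finset.mem_range.mp hi
    simp only
    rw [← pow_add, show m + 1 + 1 - 2 - i = m - i by omega,
      show i + 1 + (m - i + 1) = m + 1 + 1 by omega]
  rw [Finset.sum_congr rfl h3, sum_range_two_mul_diag
    (f := fun i j => C (u ^ (i + 1) * u ^ (j + 1)) * pderiv i (pderiv j φ))]
  · refine Finset.sum_congr rfl fun i _ => ?_
    rw [derivation_eq_sum_range (dir (pw u)) h, map_sum, Finset.sum_mul]
    refine Finset.sum_congr rfl fun j _ => ?_
    rw [dir_X, dir_X, pderiv_mul, pderiv_C, mul_zero, add_zero, C_mul]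
    simp only [pw]
    ring
  · intro i j hi
    rw [pderiv_comm, h i hi, map_zero, mul_zero]
  · intro i j hj
    rw [h j hj, map_zero, mul_zero]

theorem sum_shiftDer {φ : Poly} {N M : ℕ} (h : ∀ i, N ≤ i → pderiv i φ = 0) (hM : N + 1 ≤ M)
    (u : ℂ) : ∑ m ∈ Finset.range M, C (u ^ m) * shiftDer m φ = modeDer u φ := by
  have h1 : ∀ m, C (u ^ m) * shiftDer m φ =
      ∑ i ∈ Finset.range N, pderiv i φ * (C (u ^ m) * shiftDer m (X i)) := by
    intro m
    rw [derivation_eq_sum_range (shiftDer m) h, Finset.mul_sum]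
    exact Finset.sum_congr rfl fun i _ => by ring
  rw [Finset.sum_congr rfl fun m _ => h1 m, Finset.sum_comm,
    derivation_eq_sum_range (modeDer u) h]
  refine Finset.sum_congr rfl fun i hi => ?_
  rw [Finset.mem_range] at hi
  rw [← Finset.mul_sum, modeDer_X]
  congr 1
  rw [← Finset.sum_subset (Finset.range_subset_range.mpr (show i + 2 ≤ M by omega)),
    ← Finset.sum_range_reflect]
  · refine Finset.sum_congr rfl fun k hk => ?_
    rw [Finset.mem_range] at hk
    rw [shiftDer_X_of_le k (by omega), ← mul_assoc, ← C_mul,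
      show i + 2 - 1 - k = i + 1 - k by omega]
    ring_nf
  · intro m _ hm
    rw [Finset.mem_range] at hm
    rw [shiftDer_X_of_lt (by omega), mul_zero]

theorem sum_virConst {M : ℕ} (hM : 2 ≤ M) (u : ℂ) :
    ∑ m ∈ Finset.range M, C (u ^ m) * virConst m = C (u / 4) + X 0 ^ 2 := by
  obtain ⟨k, rfl⟩ := Nat.exists_eq_add_of_le' hM
  rw [Finset.sum_range_succ', Finset.sum_range_succ', Finset.sum_eq_zero]
  · simp only [virConst, zero_add, pow_one, pow_zero, C_1, one_mul, ← C_mul]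
    congr 2
    ring
  · intro i _
    rw [show i + 1 + 1 = i + 2 from rfl, virConst_add_two, mul_zero]

/-- Write `V(u) = ∑ u^m V_m`. Then `∑ u^{i+1} (V_{i+1} - Λ V_i) = (1 - Λu) V(u) - V₀`: the shift of
the index loses exactly the term `V₀`. -/
theorem dir_pw_eq_of_recOp {Λ : ℂ} {φ φ' : Poly} (h : ∀ i, pderiv i φ = recOp Λ i φ') (u : ℂ) :
    dir (pw u) φ = C (-1 / 4) * (C (1 - Λ * u) *
      (dir (pw u) (dir (pw u) φ') + modeDer u φ' + (C (u / 4) + X 0 ^ 2) * φ') -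
        shiftDer 0 φ' - X 0 ^ 2 * φ') := by
  obtain ⟨N, hN⟩ := exists_pderiv_eq_zero φ'
  have hv : ∀ m, 2 * N + 2 ≤ m → vir m φ' = 0 := fun m hm => vir_eq_zero hN hm
  have hφ : ∀ i, 2 * N + 2 ≤ i → pderiv i φ = 0 := fun i hi => by
    rw [h, recOp, hv i hi, hv (i + 1) (by omega)]; ring
  have hS : ∑ m ∈ Finset.range (2 * N + 2), C (u ^ m) * vir m φ' =
      dir (pw u) (dir (pw u) φ') + modeDer u φ' + (C (u / 4) + X 0 ^ 2) * φ' := by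
    rw [← sum_lap hN, ← sum_shiftDer (M := 2 * N + 2) hN (by omega),
      ← sum_virConst (M := 2 * N + 2) (by omega), Finset.sum_mul, ← Finset.sum_add_distrib,
      ← Finset.sum_add_distrib]
    exact Finset.sum_congr rfl fun m _ => by rw [vir_apply]; ring
  have hS' : ∑ i ∈ Finset.range (2 * N + 2), C (u ^ (i + 1)) * vir (i + 1) φ' =
      (∑ m ∈ Finset.range (2 * N + 2), C (u ^ m) * vir m φ') - vir 0 φ' := by
    have := Finset.sum_range_succ' (fun m => C (u ^ m) * vir m φ') (2 * N + 2)
    rw [Finset.sum_range_succ, hv _ le_rfl, mul_zero, add_zero] at this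
    rw [this]
    simp
  have h0 : vir 0 φ' = shiftDer 0 φ' + X 0 ^ 2 * φ' := by
    rw [vir_apply, lap_zero, virConst, zero_add]
  rw [← hS, derivation_eq_sum_range _ hφ]
  have h1 : ∀ i ∈ Finset.range (2 * N + 2), pderiv i φ * dir (pw u) (X i) =
      C (-1 / 4) * (C (u ^ (i + 1)) * vir (i + 1) φ') -
        C (-1 / 4) * C (Λ * u) * (C (u ^ i) * vir i φ') := by
    intro i _
    rw [h, dir_X, recOp, pw, pow_succ, C_mul, C_mul]
    ring
  rw [Finset.sum_congr rfl h1, Finset.sum_sub_distrib, ← Finset.mul_sum, ← Finset.mul_sum, hS', h0,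
    C_sub, C_1]
  ring

/-! ### The logarithm of the partition function -/

/-- Uniqueness for a linear differential equation in `ħ`: each coefficient of `U` is determined by
the earlier ones. It replaces manipulations of logarithms and exponentials of power series. -/
theorem powerSeries_eq_zero_of_derivative_eq_mul {R : Type*} [CommRing R] [IsDomain R] [CharZero R]
    {A U : PowerSeries R} (h : PowerSeries.derivative R U = A * U)
    (h0 : PowerSeries.coeff 0 U = 0) : U = 0 := by
  ext n
  rw [map_zero]
  induction n using Nat.strong_induction_on with
  | _ n ih =>
    rcases n with _ | n
    · exact h0
    · have h1 := congrArg (PowerSeries.coeff n) h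
      rw [PowerSeries.coeff_derivative, PowerSeries.coeff_mul, Finset.sum_eq_zero] at h1
      · exact (mul_eq_zero.mp h1).resolve_right (Nat.cast_add_one_ne_zero n)
      · intro p hp
        have := Finset.HasAntidiagonal.mem_antidiagonal.mp hp
        rw [ih p.2 (by omega), mul_zero]

/-- A derivation of the coefficients, applied to power series. -/
noncomputable def coeffDer (D : Derivation ℂ Poly Poly) (f : PowerSeries Poly) : PowerSeries Poly :=
  PowerSeries.mk fun n => D (PowerSeries.coeff n f)

theorem coeff_coeffDer (D : Derivation ℂ Poly Poly) (f : PowerSeries Poly) (n : ℕ) :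
    PowerSeries.coeff n (coeffDer D f) = D (PowerSeries.coeff n f) :=
  PowerSeries.coeff_mk _ _

theorem coeff_series_sub (f g : PowerSeries Poly) (n : ℕ) : PowerSeries.coeff n (f - g) =
    PowerSeries.coeff n f - PowerSeries.coeff n g :=
  map_sub _ _ _

theorem coeff_series_add (f g : PowerSeries Poly) (n : ℕ) : PowerSeries.coeff n (f + g) =
    PowerSeries.coeff n f + PowerSeries.coeff n g :=
  map_add _ _ _

theorem coeffDer_mul (D : Derivation ℂ Poly Poly) (f g : PowerSeries Poly) :
    coeffDer D (f * g) = coeffDer D f * g + f * coeffDer D g := by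
  ext1 n
  rw [map_add, coeff_coeffDer, PowerSeries.coeff_mul, PowerSeries.coeff_mul, PowerSeries.coeff_mul,
    map_sum, ← Finset.sum_add_distrib]
  refine Finset.sum_congr rfl fun p _ => ?_
  rw [Derivation.leibniz, coeff_coeffDer, coeff_coeffDer, smul_eq_mul, smul_eq_mul]
  ring

theorem derivative_coeffDer (D : Derivation ℂ Poly Poly) (f : PowerSeries Poly) :
    PowerSeries.derivative Poly (coeffDer D f) = coeffDer D (PowerSeries.derivative Poly f) := by
  ext1 n
  rw [coeff_coeffDer, PowerSeries.coeff_derivative, PowerSeries.coeff_derivative, coeff_coeffDer,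
    mul_comm, mul_comm (PowerSeries.coeff _ _)]
  have : ((n : Poly) + 1) = C ((n : ℂ) + 1) := by simp
  rw [this, derivation_const_mul]

/-- The partition function, a power series in `ħ`. -/
noncomputable def partitionSeries (Λ : ℂ) : PowerSeries Poly := PowerSeries.mk (partitionCoeff Λ)

/-- The logarithm of the partition function. -/
noncomputable def freeSeries (Λ : ℂ) : PowerSeries Poly :=
  PowerSeries.mk fun n => C (1 / (n : ℂ)) * PowerSeries.coeff (n - 1)
    (PowerSeries.derivative Poly (partitionSeries Λ) *
      PowerSeries.invOfUnit (partitionSeries Λ) 1)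

/-- The coefficients of the logarithm of the partition function. -/
noncomputable def freeCoeff (Λ : ℂ) (n : ℕ) : Poly := PowerSeries.coeff n (freeSeries Λ)

theorem freeCoeff_zero (Λ : ℂ) : freeCoeff Λ 0 = 0 := by
  -- The factor `1 / n` is zero at `n = 0` by the convention for division. This removes the constant
  -- term of the logarithm and makes the truncated `n - 1` harmless there.
  rw [freeCoeff, freeSeries, PowerSeries.coeff_mk]
  simp

theorem partitionSeries_ne_zero (Λ : ℂ) : partitionSeries Λ ≠ 0 := fun h => by
  have := congrArg (PowerSeries.coeff 0) h
  rw [partitionSeries, PowerSeries.coeff_mk, partitionCoeff, map_zero] at this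
  exact one_ne_zero this

theorem derivative_freeSeries_mul (Λ : ℂ) :
    PowerSeries.derivative Poly (freeSeries Λ) * partitionSeries Λ =
      PowerSeries.derivative Poly (partitionSeries Λ) := by
  have h1 : PowerSeries.derivative Poly (freeSeries Λ) =
      PowerSeries.derivative Poly (partitionSeries Λ) *
        PowerSeries.invOfUnit (partitionSeries Λ) 1 := by
    ext1 n
    rw [PowerSeries.coeff_derivative, freeSeries, PowerSeries.coeff_mk, Nat.add_sub_cancel,
      mul_comm, ← mul_assoc]
    have : ((n : Poly) + 1) * C (1 / ((n + 1 : ℕ) : ℂ)) = 1 := by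
      have h2 : ((n : Poly) + 1) = C ((n : ℂ) + 1) := by simp
      rw [h2, ← C_mul, Nat.cast_add_one, mul_one_div_cancel (Nat.cast_add_one_ne_zero n), C_1]
    rw [this, one_mul]
  rw [h1, mul_assoc, mul_comm _ (partitionSeries Λ), PowerSeries.mul_invOfUnit, mul_one]
  rw [← PowerSeries.coeff_zero_eq_constantCoeff_apply, partitionSeries, PowerSeries.coeff_mk,
    partitionCoeff, Units.val_one]

/-- The difference `U = DZ - (D log Z) Z` satisfies `U' = (log Z)' U`, with derivatives in `ħ`, and
has no term of order `ħ^0`. -/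
theorem coeffDer_partitionSeries (Λ : ℂ) (D : Derivation ℂ Poly Poly) :
    coeffDer D (partitionSeries Λ) = coeffDer D (freeSeries Λ) * partitionSeries Λ := by
  rw [← sub_eq_zero]
  refine powerSeries_eq_zero_of_derivative_eq_mul
    (A := PowerSeries.derivative Poly (freeSeries Λ)) ?_ ?_
  · rw [map_sub, Derivation.leibniz, derivative_coeffDer, derivative_coeffDer,
      ← derivative_freeSeries_mul, coeffDer_mul, smul_eq_mul, smul_eq_mul]
    ring
  · rw [map_sub, coeff_coeffDer, PowerSeries.coeff_mul, Finset.Nat.antidiagonal_zero,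
      Finset.sum_singleton, coeff_coeffDer]
    have h := freeCoeff_zero Λ
    rw [freeCoeff] at h
    simp only [h]
    rw [partitionSeries, PowerSeries.coeff_mk, partitionCoeff, Derivation.map_one_eq_zero]
    simp

/-- Substituting `Z = e^F` in the linear constraints and dividing by `Z`: the second derivative
becomes `D²F + (DF)²`, first order operators act on `F`, and multiplication operators become
inhomogeneous terms. The square is the origin of the products in the topological recursion. -/
theorem coeffDer_dir_freeSeries (Λ u : ℂ) :
    coeffDer (dir (pw u)) (freeSeries Λ) = PowerSeries.X * PowerSeries.C (C (-1 / 4)) *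
      (PowerSeries.C (C (1 - Λ * u)) * (coeffDer (dir (pw u)) (coeffDer (dir (pw u)) (freeSeries Λ)) +
          coeffDer (dir (pw u)) (freeSeries Λ) * coeffDer (dir (pw u)) (freeSeries Λ) +
          coeffDer (modeDer u) (freeSeries Λ) + PowerSeries.C (C (u / 4) + X 0 ^ 2)) -
        coeffDer (shiftDer 0) (freeSeries Λ) - PowerSeries.C (X 0 ^ 2)) := by
  refine mul_right_cancel₀ (partitionSeries_ne_zero Λ) ?_
  have h1 : coeffDer (dir (pw u)) (coeffDer (dir (pw u)) (partitionSeries Λ)) =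
      (coeffDer (dir (pw u)) (coeffDer (dir (pw u)) (freeSeries Λ)) +
        coeffDer (dir (pw u)) (freeSeries Λ) * coeffDer (dir (pw u)) (freeSeries Λ)) *
          partitionSeries Λ := by
    rw [coeffDer_partitionSeries, coeffDer_mul, coeffDer_partitionSeries]
    ring
  have h2 : coeffDer (dir (pw u)) (partitionSeries Λ) =
      PowerSeries.X * (PowerSeries.C (C (-1 / 4)) *
      (PowerSeries.C (C (1 - Λ * u)) *
        (coeffDer (dir (pw u)) (coeffDer (dir (pw u)) (partitionSeries Λ)) +
          coeffDer (modeDer u) (partitionSeries Λ) +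
          PowerSeries.C (C (u / 4) + X 0 ^ 2) * partitionSeries Λ) -
        coeffDer (shiftDer 0) (partitionSeries Λ) -
          PowerSeries.C (X 0 ^ 2) * partitionSeries Λ)) := by
    ext1 n
    rcases n with _ | n
    · rw [coeff_coeffDer, PowerSeries.coeff_zero_X_mul, partitionSeries, PowerSeries.coeff_mk,
        partitionCoeff, Derivation.map_one_eq_zero]
    · rw [PowerSeries.coeff_succ_X_mul, coeff_coeffDer, PowerSeries.coeff_C_mul]
      simp only [coeff_series_sub, coeff_series_add,
        PowerSeries.coeff_C_mul, coeff_coeffDer]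
      rw [partitionSeries, PowerSeries.coeff_mk, PowerSeries.coeff_mk]
      exact dir_pw_eq_of_recOp (pderiv_partitionCoeff_succ Λ n) u
  rw [h1, coeffDer_partitionSeries, coeffDer_partitionSeries, coeffDer_partitionSeries] at h2
  rw [h2]
  ring

theorem dir_pw_freeCoeff_succ (Λ u : ℂ) (n : ℕ) :
    dir (pw u) (freeCoeff Λ (n + 1)) = C (-1 / 4) * (C (1 - Λ * u) *
      (dir (pw u) (dir (pw u) (freeCoeff Λ n)) +
        ∑ p ∈ Finset.HasAntidiagonal.antidiagonal n,
          dir (pw u) (freeCoeff Λ p.1) * dir (pw u) (freeCoeff Λ p.2) +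
        modeDer u (freeCoeff Λ n) + if n = 0 then C (u / 4) + X 0 ^ 2 else 0) -
      shiftDer 0 (freeCoeff Λ n) - if n = 0 then X 0 ^ 2 else 0) := by
  have h := congrArg (PowerSeries.coeff (n + 1)) (coeffDer_dir_freeSeries Λ u)
  rw [mul_assoc, PowerSeries.coeff_succ_X_mul, coeff_coeffDer, PowerSeries.coeff_C_mul] at h
  simp only [coeff_series_sub, coeff_series_add,
    PowerSeries.coeff_C_mul, coeff_coeffDer] at h
  simp only [PowerSeries.coeff_mul (n := n), coeff_coeffDer, PowerSeries.coeff_C n] at h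
  exact h

theorem constantCoeff_freeCoeff (Λ : ℂ) (n : ℕ) : constantCoeff (freeCoeff Λ n) = 0 := by
  have h1 : PowerSeries.map constantCoeff (partitionSeries Λ) = 1 := by
    ext1 n
    rw [PowerSeries.coeff_map, partitionSeries, PowerSeries.coeff_mk, PowerSeries.coeff_one]
    rcases n with _ | n
    · rw [partitionCoeff, map_one, if_pos rfl]
    · rw [constantCoeff_partitionCoeff_succ, if_neg (by omega)]
  have h2 := congrArg (PowerSeries.map (constantCoeff (σ := ℕ) (R := ℂ)))
    (derivative_freeSeries_mul Λ)
  rw [map_mul, h1, mul_one] at h2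
  rcases n with _ | n
  · rw [freeCoeff_zero, map_zero]
  · have h3 := congrArg (PowerSeries.coeff n) h2
    rw [PowerSeries.coeff_map, PowerSeries.coeff_map, PowerSeries.coeff_derivative,
      PowerSeries.coeff_derivative, map_mul, map_mul, partitionSeries, PowerSeries.coeff_mk,
      constantCoeff_partitionCoeff_succ, zero_mul] at h3
    refine (mul_eq_zero.mp h3).resolve_right ?_
    rw [map_add, map_natCast, map_one]
    exact Nat.cast_add_one_ne_zero n

/-- For every ring homomorphism `f` to `ℂ`, the partition function is the exponential of
its logarithm, after application of `f` to the coefficients. -/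
theorem subst_exp_freeSeries (Λ : ℂ) (f : Poly →+* ℂ) :
    (PowerSeries.exp ℂ).subst (PowerSeries.map f (freeSeries Λ)) =
      PowerSeries.map f (partitionSeries Λ) := by
  have hz : PowerSeries.constantCoeff (PowerSeries.map f (freeSeries Λ)) = 0 := by
    rw [← PowerSeries.coeff_zero_eq_constantCoeff_apply, PowerSeries.coeff_map]
    have := freeCoeff_zero Λ
    rw [freeCoeff] at this
    rw [this, map_zero]
  have hs : PowerSeries.HasSubst (PowerSeries.map f (freeSeries Λ)) :=
    PowerSeries.HasSubst.of_constantCoeff_zero' hz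
  have hd : ∀ g : PowerSeries Poly, PowerSeries.derivative ℂ (PowerSeries.map f g) =
      PowerSeries.map f (PowerSeries.derivative Poly g) := by
    intro g
    ext1 n
    simp [PowerSeries.coeff_derivative]
  rw [← sub_eq_zero]
  refine powerSeries_eq_zero_of_derivative_eq_mul
    (A := PowerSeries.derivative ℂ (PowerSeries.map f (freeSeries Λ))) ?_ ?_
  · rw [map_sub, PowerSeries.derivative_subst hs, PowerSeries.derivative_exp, hd, hd,
      ← derivative_freeSeries_mul, map_mul]
    ring
  · rw [map_sub, PowerSeries.coeff_zero_eq_constantCoeff_apply,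
      PowerSeries.coeff_map, partitionSeries, PowerSeries.coeff_mk, partitionCoeff, map_one]
    have h1 := PowerSeries.constantCoeff_subst_eq_zero hz (PowerSeries.exp ℂ - 1)
      (by rw [map_sub, PowerSeries.constantCoeff_exp, map_one, sub_self])
    rw [← PowerSeries.coe_substAlgHom hs, map_sub, map_one, map_sub, map_one] at h1
    rw [← PowerSeries.coe_substAlgHom hs]
    exact h1

/-! ### Iterated directional derivatives at the origin -/

theorem dir_comm (c d : ℕ → ℂ) (φ : Poly) : dir c (dir d φ) = dir d (dir c φ) :=
  derivation_comm_of_X (fun a => by rw [dir_X, dir_X, derivation_C, derivation_C]) φ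

instance : LeftCommutative (fun (c : ℕ → ℂ) (φ : Poly) => dir c φ) := ⟨dir_comm⟩

/-- The iterated directional derivative. -/
noncomputable def dirs (M : Multiset (ℕ → ℂ)) (φ : Poly) : Poly :=
  M.foldr (fun c ψ => dir c ψ) φ

theorem dirs_zero (φ : Poly) : dirs 0 φ = φ := Multiset.foldr_zero _ _

theorem dirs_cons (c : ℕ → ℂ) (M : Multiset (ℕ → ℂ)) (φ : Poly) :
    dirs (c ::ₘ M) φ = dir c (dirs M φ) := Multiset.foldr_cons _ _ _ _

theorem dirs_dir (c : ℕ → ℂ) (M : Multiset (ℕ → ℂ)) (φ : Poly) :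
    dirs M (dir c φ) = dir c (dirs M φ) := by
  induction M using Multiset.induction_on with
  | empty => rw [dirs_zero, dirs_zero]
  | cons d M ih => rw [dirs_cons, dirs_cons, ih, dir_comm]

theorem dirs_add (M : Multiset (ℕ → ℂ)) (φ ψ : Poly) :
    dirs M (φ + ψ) = dirs M φ + dirs M ψ := by
  induction M using Multiset.induction_on with
  | empty => simp only [dirs_zero]
  | cons d M ih => rw [dirs_cons, dirs_cons, dirs_cons, ih, map_add]

theorem dirs_C_mul (M : Multiset (ℕ → ℂ)) (a : ℂ) (φ : Poly) :
    dirs M (C a * φ) = C a * dirs M φ := by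
  induction M using Multiset.induction_on with
  | empty => simp only [dirs_zero]
  | cons d M ih => rw [dirs_cons, dirs_cons, ih, derivation_const_mul]

/-- The iterated directional derivative at the origin. -/
noncomputable def corr (M : Multiset (ℕ → ℂ)) : Poly →ₗ[ℂ] ℂ where
  toFun φ := constantCoeff (dirs M φ)
  map_add' φ ψ := by rw [dirs_add, map_add]
  map_smul' a φ := by
    rw [MvPolynomial.smul_eq_C_mul, dirs_C_mul, map_mul, constantCoeff_C]; rfl

theorem corr_apply (M : Multiset (ℕ → ℂ)) (φ : Poly) : corr M φ = constantCoeff (dirs M φ) := rfl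

theorem corr_C_mul (M : Multiset (ℕ → ℂ)) (a : ℂ) (φ : Poly) : corr M (C a * φ) = a * corr M φ := by
  rw [corr_apply, corr_apply, dirs_C_mul, map_mul, constantCoeff_C]

theorem corr_zero (φ : Poly) : corr 0 φ = constantCoeff φ := by rw [corr_apply, dirs_zero]

theorem corr_dir (c : ℕ → ℂ) (M : Multiset (ℕ → ℂ)) (φ : Poly) :
    corr M (dir c φ) = corr (c ::ₘ M) φ := by
  rw [corr_apply, corr_apply, dirs_cons, dirs_dir]

theorem corr_cons (c : ℕ → ℂ) (M : Multiset (ℕ → ℂ)) (φ : Poly) :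
    corr (c ::ₘ M) φ = constantCoeff (dir c (dirs M φ)) := by
  rw [corr_apply, dirs_cons]

theorem dirs_mul {ι : Type*} [DecidableEq ι] (S : Finset ι) (d : ι → ℕ → ℂ) (φ ψ : Poly) :
    dirs (S.val.map d) (φ * ψ) =
      ∑ J ∈ S.powerset, dirs (J.val.map d) φ * dirs ((S \ J).val.map d) ψ := by
  induction S using Finset.induction_on with
  | empty => simp [dirs_zero]
  | insert a S ha ih =>
    rw [Finset.insert_val_of_notMem ha, Multiset.map_cons, dirs_cons, ih, map_sum,
      Finset.sum_powerset_insert ha, ← Finset.sum_add_distrib]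
    refine Finset.sum_congr rfl fun J hJ => ?_
    rw [Finset.mem_powerset] at hJ
    have haJ : a ∉ J := fun h => ha (hJ h)
    have h1 : insert a S \ J = insert a (S \ J) := Finset.insert_sdiff_of_notMem S haJ
    have h2 : insert a S \ insert a J = S \ J := by
      ext x
      simp only [Finset.mem_sdiff, Finset.mem_insert, not_or]
      constructor
      · rintro ⟨h | h, h3, h4⟩
        · exact absurd h h3
        · exact ⟨h, h4⟩
      · rintro ⟨h, h4⟩
        exact ⟨Or.inr h, fun h5 => ha (h5 ▸ h), h4⟩
    rw [h1, h2, Finset.insert_val_of_notMem haJ,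
      Finset.insert_val_of_notMem (fun h => ha (Finset.mem_sdiff.mp h).1), Multiset.map_cons,
      Multiset.map_cons, dirs_cons, dirs_cons, Derivation.leibniz, smul_eq_mul, smul_eq_mul]
    ring

/-- This Leibniz rule produces the sum over subsets `J` in the topological recursion. -/
theorem corr_mul {ι : Type*} [DecidableEq ι] (S : Finset ι) (d : ι → ℕ → ℂ) (φ ψ : Poly) :
    corr (S.val.map d) (φ * ψ) =
      ∑ J ∈ S.powerset, corr (J.val.map d) φ * corr ((S \ J).val.map d) ψ := by
  rw [corr_apply, dirs_mul, map_sum]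
  exact Finset.sum_congr rfl fun J _ => by rw [map_mul]; rfl

/-- The iterated derivatives of `D φ` for a linear vector field `D`. -/
theorem dirs_derivation {ι : Type*} [DecidableEq ι] {D : Derivation ℂ Poly Poly}
    {κ : (ℕ → ℂ) → ℕ → ℂ} (h : ∀ c a, dir c (D (X a)) = C (κ c a)) (S : Finset ι)
    (d : ι → ℕ → ℂ) (φ : Poly) :
    dirs (S.val.map d) (D φ) = D (dirs (S.val.map d) φ) +
      ∑ j ∈ S, dirs (κ (d j) ::ₘ (S.erase j).val.map d) φ := by
  have hb : ∀ c φ, dir c (D φ) = D (dir c φ) + dir (κ c) φ := by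
    intro c φ
    have h1 : ⁅dir c, D⁆ = dir (κ c) := MvPolynomial.derivation_ext fun a => by
      rw [Derivation.commutator_apply, h, dir_X, dir_X, derivation_C, sub_zero]
    rw [← h1, Derivation.commutator_apply]
    ring
  induction S using Finset.induction_on with
  | empty => simp [dirs_zero]
  | insert a S ha ih =>
    rw [Finset.insert_val_of_notMem ha, Multiset.map_cons, dirs_cons, ih, map_add, hb, map_sum,
      Finset.sum_insert ha, Finset.erase_insert ha, dirs_cons, dirs_cons, add_assoc]
    refine congrArg₂ (· + ·) rfl (congrArg₂ (· + ·) rfl (Finset.sum_congr rfl fun j hj => ?_))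
    have hja : a ≠ j := fun h => ha (h ▸ hj)
    rw [Finset.erase_insert_of_ne hja,
      Finset.insert_val_of_notMem (fun h => ha (Finset.mem_erase.mp h).2), Multiset.map_cons,
      dirs_cons, dirs_cons, dirs_cons, dir_comm]

/-- By `h0` the vector field vanishes at the origin, so only its commutators with the directions
survive there; each of them replaces one direction by another. -/
theorem corr_derivation {ι : Type*} [DecidableEq ι] {D : Derivation ℂ Poly Poly}
    {κ : (ℕ → ℂ) → ℕ → ℂ} (h : ∀ c a, dir c (D (X a)) = C (κ c a))
    (h0 : ∀ a, constantCoeff (D (X a)) = 0) (S : Finset ι) (d : ι → ℕ → ℂ) (φ : Poly) :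
    corr (S.val.map d) (D φ) = ∑ j ∈ S, corr (κ (d j) ::ₘ (S.erase j).val.map d) φ := by
  rw [corr_apply, dirs_derivation h, map_add, map_sum]
  obtain ⟨N, hN⟩ := exists_pderiv_eq_zero (dirs (S.val.map d) φ)
  rw [derivation_eq_sum_range D hN, map_sum, Finset.sum_eq_zero, zero_add]
  · rfl
  · intro i _
    rw [map_mul, h0, mul_zero]

/-! ### The quadratic recursion for the free energies -/

/-- The linear vector field in the recursion for the free energies. -/
noncomputable def recDer (Λ u : ℂ) : Derivation ℂ Poly Poly :=
  (1 - Λ * u) • modeDer u - shiftDer 0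

/-- The coefficients of the commutator of `dir c` with `recDer Λ u`. -/
noncomputable def recDir (Λ u : ℂ) (c : ℕ → ℂ) : ℕ → ℂ := fun a =>
  (1 - Λ * u) * ∑ k ∈ Finset.range (a + 2), 2 * (2 * (k : ℂ) + 1) * u ^ (a + 1 - k) * c k -
    2 * (2 * (a : ℂ) + 3) * c (a + 1)

theorem recDer_apply (Λ u : ℂ) (φ : Poly) :
    recDer Λ u φ = C (1 - Λ * u) * modeDer u φ - shiftDer 0 φ := by
  rw [recDer, Derivation.sub_apply, Derivation.smul_apply, MvPolynomial.smul_eq_C_mul]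

theorem dir_recDer_X (Λ u : ℂ) (c : ℕ → ℂ) (a : ℕ) :
    dir c (recDer Λ u (X a)) = C (recDir Λ u c a) := by
  rw [recDer_apply, map_sub, derivation_const_mul, modeDer_X,
    shiftDer_X_of_le (m := 0) (a + 1) (by omega), derivation_const_mul, dir_X, map_sum]
  simp only [derivation_const_mul, dir_X, ← C_mul]
  rw [← map_sum, ← C_mul, ← C_sub, recDir]
  push_cast
  ring_nf

theorem constantCoeff_recDer_X (Λ u : ℂ) (a : ℕ) : constantCoeff (recDer Λ u (X a)) = 0 := by
  rw [recDer_apply, modeDer_X, shiftDer_X_of_le (m := 0) (a + 1) (by omega)]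
  simp

/-- The inhomogeneous term in the recursion for the free energies. -/
noncomputable def recConst (Λ u : ℂ) : Poly :=
  C (1 - Λ * u) * (C (u / 4) + X 0 ^ 2) - X 0 ^ 2

/-- This is the topological recursion with all residues already evaluated, sorted by the order in
`ħ` instead of the genus. The sum over `j` will match the terms with one factor `B`, and `recConst`
those built from `B` alone. -/
theorem corr_cons_freeCoeff_succ {ι : Type*} [DecidableEq ι] (Λ u : ℂ) (n : ℕ) (S : Finset ι)
    (d : ι → ℕ → ℂ) :
    corr (pw u ::ₘ S.val.map d) (freeCoeff Λ (n + 1)) = -1 / 4 * ((1 - Λ * u) *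
      (corr (pw u ::ₘ pw u ::ₘ S.val.map d) (freeCoeff Λ n) +
        ∑ p ∈ Finset.HasAntidiagonal.antidiagonal n, ∑ J ∈ S.powerset,
          corr (pw u ::ₘ J.val.map d) (freeCoeff Λ p.1) *
            corr (pw u ::ₘ (S \ J).val.map d) (freeCoeff Λ p.2)) +
      ∑ j ∈ S, corr (recDir Λ u (d j) ::ₘ (S.erase j).val.map d) (freeCoeff Λ n) +
      if n = 0 then corr (S.val.map d) (recConst Λ u) else 0) := by
  have h : dir (pw u) (freeCoeff Λ (n + 1)) = C (-1 / 4) * (C (1 - Λ * u) *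
      (dir (pw u) (dir (pw u) (freeCoeff Λ n)) +
        ∑ p ∈ Finset.HasAntidiagonal.antidiagonal n,
          dir (pw u) (freeCoeff Λ p.1) * dir (pw u) (freeCoeff Λ p.2)) +
      recDer Λ u (freeCoeff Λ n) + if n = 0 then recConst Λ u else 0) := by
    rw [dir_pw_freeCoeff_succ, recDer_apply, recConst]
    split_ifs <;> ring
  rw [← corr_dir, h, corr_C_mul, map_add, map_add, corr_C_mul, map_add, map_sum, corr_dir, corr_dir,
    corr_derivation (dir_recDer_X Λ u) (constantCoeff_recDer_X Λ u)]
  simp only [corr_mul, corr_dir]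
  split_ifs
  · rfl
  · rw [map_zero]

theorem constantCoeff_dir {ψ : Poly} {N : ℕ} (hN : ∀ i, N ≤ i → pderiv i ψ = 0) (c : ℕ → ℂ) :
    constantCoeff (dir c ψ) = ∑ i ∈ Finset.range N, c i * constantCoeff (pderiv i ψ) := by
  rw [derivation_eq_sum_range _ hN, map_sum]
  exact Finset.sum_congr rfl fun i _ => by rw [map_mul, dir_X, constantCoeff_C, mul_comm]

/-- Along `pw u` the derivative is a polynomial in `u` whose coefficients are the partial
derivatives at the origin; if it vanishes for all `u`, then so do these. -/
theorem constantCoeff_dir_eq_zero {ψ : Poly} (h : ∀ u, constantCoeff (dir (pw u) ψ) = 0)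
    (c : ℕ → ℂ) : constantCoeff (dir c ψ) = 0 := by
  obtain ⟨N, hN⟩ := exists_pderiv_eq_zero ψ
  have h1 : (∑ i ∈ Finset.range N,
      Polynomial.monomial (i + 1) (constantCoeff (pderiv i ψ)) : Polynomial ℂ) = 0 := by
    refine Polynomial.funext fun u => ?_
    rw [Polynomial.eval_finsetSum, Polynomial.eval_zero, ← h u, constantCoeff_dir hN]
    refine Finset.sum_congr rfl fun i _ => ?_
    rw [Polynomial.eval_monomial, pw, mul_comm]
  rw [constantCoeff_dir hN]
  refine Finset.sum_eq_zero fun i hi => ?_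
  have h2 := congrArg (fun p => Polynomial.coeff p (i + 1)) h1
  simp only [Polynomial.finsetSum_coeff, Polynomial.coeff_monomial, Polynomial.coeff_zero,
    add_left_inj] at h2
  rw [Finset.sum_ite_eq' (Finset.range N) i, if_pos hi] at h2
  rw [h2, mul_zero]

theorem corr_C {M : Multiset (ℕ → ℂ)} (hM : M ≠ 0) (a : ℂ) : corr M (C a) = 0 := by
  obtain ⟨c, hc⟩ := Multiset.exists_mem_of_ne_zero hM
  obtain ⟨M, rfl⟩ := Multiset.exists_cons_of_mem hc
  rw [← corr_dir, derivation_C, map_zero]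

theorem corr_X_zero {M : Multiset (ℕ → ℂ)} (hM : M.card ≠ 1) : corr M (X 0) = 0 := by
  induction M using Multiset.induction_on with
  | empty => rw [corr_zero, constantCoeff_X]
  | cons c M _ =>
    rw [← corr_dir, dir_X, corr_C]
    rintro rfl
    simp at hM

theorem dir_X_sq (c : ℕ → ℂ) : dir c (X 0 ^ 2) = C (2 * c 0) * X 0 := by
  rw [Derivation.leibniz_pow, dir_X]
  simp only [smul_eq_mul, nsmul_eq_mul, pow_one, Nat.add_one_sub_one, C_mul, show (C 2 : Poly) = 2 from C_ofNat 2]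
  push_cast
  ring

theorem corr_X_sq_of_ne {M : Multiset (ℕ → ℂ)} (hM : M.card ≠ 2) : corr M (X 0 ^ 2) = 0 := by
  induction M using Multiset.induction_on with
  | empty => rw [corr_zero]; simp
  | cons c M _ =>
    rw [← corr_dir, dir_X_sq, corr_C_mul, corr_X_zero, mul_zero]
    intro h
    rw [Multiset.card_cons] at hM
    omega

theorem corr_X_sq_pair (c d : ℕ → ℂ) : corr {c, d} (X 0 ^ 2) = 2 * c 0 * d 0 := by
  rw [Multiset.insert_eq_cons, ← corr_dir, dir_X_sq, corr_C_mul, ← Multiset.cons_zero, ← corr_dir,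
    dir_X, corr_zero, constantCoeff_C]

theorem corr_recConst_zero (Λ u : ℂ) : corr 0 (recConst Λ u) = (1 - Λ * u) * (u / 4) := by
  rw [corr_zero, recConst]; simp

theorem corr_recConst_pair (Λ u : ℂ) (c d : ℕ → ℂ) :
    corr {c, d} (recConst Λ u) = -(Λ * u) * (2 * c 0 * d 0) := by
  rw [recConst, map_sub, corr_C_mul, map_add, corr_X_sq_pair, corr_C (by simp)]
  ring

theorem corr_recConst_of_ne {M : Multiset (ℕ → ℂ)} (h0 : M.card ≠ 0) (h2 : M.card ≠ 2) (Λ u : ℂ) :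
    corr M (recConst Λ u) = 0 := by
  rw [recConst, map_sub, corr_C_mul, map_add, corr_X_sq_of_ne h2, corr_C]
  · ring
  · rintro rfl; exact h0 rfl

theorem exists_eq_map_univ {α : Type*} (M : Multiset α) :
    ∃ (n : ℕ) (d : Fin n → α), M = (Finset.univ : Finset (Fin n)).val.map d := by
  obtain ⟨l, rfl⟩ := Quot.exists_rep M
  refine ⟨l.length, l.get, ?_⟩
  rw [Fin.univ_val_map, List.ofFn_get]
  rfl

/-- The coefficient `freeCoeff Λ n` only has terms of degree `n + 2 - 2g`. -/
theorem corr_freeCoeff_eq_zero (Λ : ℂ) (n : ℕ) (M : Multiset (ℕ → ℂ))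
    (h : ∀ g, 2 * g + M.card ≠ n + 2) : corr M (freeCoeff Λ n) = 0 := by
  induction n using Nat.strong_induction_on generalizing M with
  | _ n ih =>
  rcases n with _ | n
  · rw [freeCoeff_zero, map_zero]
  induction M using Multiset.induction_on with
  | empty => rw [corr_zero, constantCoeff_freeCoeff]
  | cons c M _ =>
    rw [corr_cons]
    -- The recursion is available only for a first direction of the form `pw u`, and such directions
    -- suffice.
    refine constantCoeff_dir_eq_zero (fun u => ?_) c
    rw [← corr_cons]
    obtain ⟨k, d, rfl⟩ := exists_eq_map_univ M
    have h' : ∀ g, 2 * g + (k + 1) ≠ n + 3 := fun g => by simpa using h g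
    -- All terms respect the count `2g + (number of directions) = order + 2`: the second derivative
    -- comes with a drop of the genus by one, in products the genera add, and the vector field keeps
    -- the number of directions. The inhomogeneous term occurs only at `n = 0` in degrees `0` and
    -- `2`, that is for genus `1` with one direction and genus `0` with three.
    rw [corr_cons_freeCoeff_succ, ih n (by omega), Finset.sum_eq_zero, Finset.sum_eq_zero]
    · split_ifs with hn
      · rw [corr_recConst_of_ne]
        · ring
        · have := h' 1; simp; omega
        · have := h' 0; simp; omega
      · ring
    · intro j _
      refine ih n (by omega) _ fun g hg => h' g ?_
      have := j.isLt
      simp at hg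
      omega
    · intro p hp
      have hpn := Finset.HasAntidiagonal.mem_antidiagonal.mp hp
      refine Finset.sum_eq_zero fun J _ => ?_
      by_cases h1 : ∃ g, 2 * g + (J.card + 1) = p.1 + 2
      · by_cases h2 : ∃ g, 2 * g + ((Finset.univ \ J).card + 1) = p.2 + 2
        · obtain ⟨g1, h1⟩ := h1
          obtain ⟨g2, h2⟩ := h2
          exfalso
          have h3 := Finset.card_sdiff_add_card_eq_card (Finset.subset_univ J)
          rw [Finset.card_univ, Fintype.card_fin] at h3
          exact h' (g1 + g2) (by omega)
        · rw [ih p.2 (by omega) (pw u ::ₘ (Finset.univ \ J).val.map d), mul_zero]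
          intro g hg
          rw [Multiset.card_cons, Multiset.card_map, Finset.card_val] at hg
          exact h2 ⟨g, hg⟩
      · rw [ih p.1 (by omega) (pw u ::ₘ J.val.map d), zero_mul]
        intro g hg
        exact h1 ⟨g, by simpa using hg⟩
    · intro g hg
      refine h' (g + 1) ?_
      simp at hg
      omega

theorem map_univ_succ {α : Type*} {n : ℕ} (d : Fin (n + 1) → α) :
    (Finset.univ : Finset (Fin (n + 1))).val.map d =
      d 0 ::ₘ (Finset.univ : Finset (Fin n)).val.map (fun i => d i.succ) := by
  rw [Fin.univ_val_map, Fin.univ_val_map, List.ofFn_succ]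
  rfl

/-- The iterated derivative is multilinear in the directions and sees only finitely many of their
components. The coefficients `a` do not depend on the directions, which allows integration in each
variable separately. -/
theorem exists_corr_eq_sum (n : ℕ) {φ : Poly} {N : ℕ} (hN : ∀ i, N ≤ i → pderiv i φ = 0) :
    ∃ a : (Fin n → Fin N) → ℂ, ∀ d : Fin n → ℕ → ℂ,
      corr ((Finset.univ : Finset (Fin n)).val.map d) φ = ∑ k, (∏ i, d i (k i)) * a k := by
  induction n generalizing φ with
  | zero => exact ⟨fun _ => constantCoeff φ, fun d => by simp [corr_zero]⟩
  | succ n ih =>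
    have h1 : ∀ j : Fin N, ∀ i, N ≤ i → pderiv i (pderiv (j : ℕ) φ) = 0 := fun j i hi => by
      rw [pderiv_comm, hN i hi, map_zero]
    choose a ha using fun j => ih (h1 j)
    refine ⟨fun k => a (k 0) (fun i => k i.succ), fun d => ?_⟩
    rw [map_univ_succ, ← corr_dir, derivation_eq_sum_range _ hN, map_sum, ← Fin.sum_univ_eq_sum_range
      (fun i => corr ((Finset.univ : Finset (Fin n)).val.map fun i => d i.succ)
        (pderiv i φ * dir (d 0) (X i))) N,
      ← (Fin.consEquiv fun _ : Fin (n + 1) => Fin N).sum_comp, Fintype.sum_prod_type]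
    refine Finset.sum_congr rfl fun j _ => ?_
    rw [dir_X, mul_comm, corr_C_mul, ha, Finset.mul_sum]
    refine Finset.sum_congr rfl fun k _ => ?_
    rw [Fin.prod_univ_succ]
    simp only [Fin.consEquiv_apply, Fin.cons_zero, Fin.cons_succ]
    ring

/-! ### Taylor coefficients along a line -/

/-- The restriction of a polynomial to the line spanned by `τ`. -/
noncomputable def lineRestrict (τ : ℕ → ℂ) : Poly →ₐ[ℂ] Polynomial ℂ :=
  aeval fun a => Polynomial.C (τ a) * Polynomial.X

theorem derivative_lineRestrict (τ : ℕ → ℂ) (φ : Poly) :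
    Polynomial.derivative (lineRestrict τ φ) = lineRestrict τ (dir τ φ) := by
  induction φ using MvPolynomial.induction_on with
  | C a =>
    rw [derivation_C, map_zero, lineRestrict, aeval_C, Polynomial.algebraMap_eq,
      Polynomial.derivative_C]
  | add p q hp hq => simp only [map_add, hp, hq]
  | mul_X p a hp =>
    rw [map_mul, Polynomial.derivative_mul, hp, Derivation.leibniz, dir_X, map_add, smul_eq_mul,
      smul_eq_mul, map_mul, map_mul]
    have h1 : lineRestrict τ (X a) = Polynomial.C (τ a) * Polynomial.X := aeval_X _ _
    have h2 : lineRestrict τ (C (τ a)) = Polynomial.C (τ a) := by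
      rw [lineRestrict, aeval_C, Polynomial.algebraMap_eq]
    rw [h1, h2, Polynomial.derivative_C_mul, Polynomial.derivative_X]
    ring

theorem coeff_zero_lineRestrict (τ : ℕ → ℂ) (φ : Poly) :
    (lineRestrict τ φ).coeff 0 = constantCoeff φ := by
  induction φ using MvPolynomial.induction_on with
  | C a => rw [lineRestrict, aeval_C, Polynomial.algebraMap_eq, Polynomial.coeff_C_zero,
      constantCoeff_C]
  | add p q hp hq => simp only [map_add, Polynomial.coeff_add, hp, hq]
  | mul_X p a hp =>
    rw [map_mul, Polynomial.mul_coeff_zero, hp, map_mul, constantCoeff_X, lineRestrict, aeval_X]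
    simp

theorem eval_one_lineRestrict (τ : ℕ → ℂ) (φ : Poly) :
    (lineRestrict τ φ).eval 1 = eval τ φ := by
  induction φ using MvPolynomial.induction_on with
  | C a => rw [lineRestrict, aeval_C, Polynomial.algebraMap_eq, Polynomial.eval_C, eval_C]
  | add p q hp hq => simp only [map_add, Polynomial.eval_add, hp, hq]
  | mul_X p a hp =>
    rw [map_mul, Polynomial.eval_mul, hp, map_mul, eval_X, lineRestrict, aeval_X]
    simp

/-- Equal directions give Taylor's formula on the line spanned by `τ`; this accounts for the factors
`1 / n!` in the WKB exponent. -/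
theorem corr_replicate (n : ℕ) (τ : ℕ → ℂ) (φ : Poly) :
    corr (Multiset.replicate n τ) φ = n.factorial * (lineRestrict τ φ).coeff n := by
  have h : ∀ n φ, corr (Multiset.replicate n τ) φ =
      (Polynomial.derivative^[n] (lineRestrict τ φ)).coeff 0 := by
    intro n
    induction n with
    | zero =>
      intro φ
      rw [Multiset.replicate_zero, corr_zero, Function.iterate_zero, id, coeff_zero_lineRestrict]
    | succ n ih =>
      intro φ
      rw [Multiset.replicate_succ, ← corr_dir, ih, Function.iterate_succ_apply,
        derivative_lineRestrict]
  rw [h, Polynomial.coeff_iterate_derivative, zero_add, Nat.descFactorial_self, nsmul_eq_mul]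

/-- The value of a free energy is the sum of its homogeneous components. -/
theorem eval_freeCoeff_eq_sum (Λ : ℂ) (n : ℕ) (τ : ℕ → ℂ) :
    eval τ (freeCoeff Λ n) =
      ∑ k ∈ Finset.range (n + 3), (lineRestrict τ (freeCoeff Λ n)).coeff k := by
  rw [← eval_one_lineRestrict, Polynomial.eval_eq_sum_range' (n := n + 3)]
  · simp
  · rw [Nat.lt_succ_iff, Polynomial.natDegree_le_iff_coeff_eq_zero]
    intro k hk
    have h := corr_replicate k τ (freeCoeff Λ n)
    rw [corr_freeCoeff_eq_zero] at h
    · exact (mul_eq_zero.mp h.symm).resolve_left (Nat.cast_ne_zero.mpr k.factorial_ne_zero)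
    · intro g
      rw [Multiset.card_replicate]
      omega

theorem coeff_lineRestrict_freeCoeff_eq_zero (Λ : ℂ) (n k : ℕ) (τ : ℕ → ℂ)
    (hk : ∀ g, 2 * g + k ≠ n + 2) : (lineRestrict τ (freeCoeff Λ n)).coeff k = 0 := by
  have h := corr_replicate k τ (freeCoeff Λ n)
  rw [corr_freeCoeff_eq_zero _ _ _ (by simpa using hk)] at h
  exact (mul_eq_zero.mp h.symm).resolve_left (Nat.cast_ne_zero.mpr k.factorial_ne_zero)

/-! ### Calculus of residues at the ramification point -/

/-- For all small radii, `f` is integrable over the circle about `0`, with integral `2πi c`. -/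
def HasResidue (f : ℂ → ℂ) (c : ℂ) : Prop :=
  ∀ᶠ r in 𝓝[>] (0 : ℝ), CircleIntegrable f 0 r ∧
    (2 * Real.pi * Complex.I)⁻¹ * ∮ w in C(0, r), f w = c

namespace HasResidue

variable {f g : ℂ → ℂ} {a b : ℂ}

theorem residue_eq (h : HasResidue f a) : residue f 0 = a :=
  (tendsto_const_nhds.congr' (h.mono fun _ hr => hr.2.symm)).limUnder_eq

theorem add (hf : HasResidue f a) (hg : HasResidue g b) :
    HasResidue (fun w => f w + g w) (a + b) := by
  filter_upwards [hf, hg] with r h1 h2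
  refine ⟨h1.1.add h2.1, ?_⟩
  rw [circleIntegral.integral_add h1.1 h2.1, mul_add, h1.2, h2.2]

theorem const_mul (c : ℂ) (hf : HasResidue f a) : HasResidue (fun w => c * f w) (c * a) := by
  filter_upwards [hf] with r h1
  refine ⟨IntervalIntegrable.const_mul h1.1 c, ?_⟩
  rw [circleIntegral.integral_const_mul, ← h1.2]
  ring

theorem sum {ι : Type*} (s : Finset ι) {f : ι → ℂ → ℂ} {a : ι → ℂ}
    (h : ∀ i ∈ s, HasResidue (f i) (a i)) :
    HasResidue (fun w => ∑ i ∈ s, f i w) (∑ i ∈ s, a i) := by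
  classical
  induction s using Finset.induction_on with
  | empty =>
    refine Eventually.of_forall fun r => ⟨by simp, ?_⟩
    simp [circleIntegral]
  | insert i s hi ih =>
    simp only [Finset.sum_insert hi]
    exact (h i (Finset.mem_insert_self _ _)).add
      (ih fun j hj => h j (Finset.mem_insert_of_mem hj))

theorem congr (hf : HasResidue f a) (h : ∀ᶠ w in 𝓝[≠] (0 : ℂ), f w = g w) : HasResidue g a := by
  obtain ⟨ε, hε, hball⟩ := Metric.mem_nhdsWithin_iff.mp h
  have hr : ∀ᶠ r in 𝓝[>] (0 : ℝ), r < ε := mem_nhdsWithin_of_mem_nhds (Iio_mem_nhds hε)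
  filter_upwards [hf, hr, self_mem_nhdsWithin] with r h1 h2 h3
  have h3 : 0 < r := h3
  have heq : EqOn f g (Metric.sphere 0 r) := fun w hw => by
    have hw' : ‖w‖ = r := by simpa using hw
    refine hball ⟨by simpa [hw'] using h2, fun h0 => ?_⟩
    have h0 : w = 0 := h0
    rw [h0, norm_zero] at hw'
    exact h3.ne hw'
  refine ⟨(circleIntegrable_congr ?_).mp h1.1, ?_⟩
  · rwa [abs_of_pos h3]
  · rw [← h1.2, circleIntegral.integral_congr h3.le heq]

end HasResidue

theorem AnalyticAt.eventually_diffContOnCl {f : ℂ → ℂ} (hf : AnalyticAt ℂ f 0) :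
    ∀ᶠ r in 𝓝[>] (0 : ℝ), 0 < r ∧ ContinuousOn f (Metric.closedBall 0 r) ∧
      DifferentiableOn ℂ f (Metric.closedBall 0 r) := by
  obtain ⟨ε, hε, hball⟩ := Metric.eventually_nhds_iff_ball.mp hf.eventually_analyticAt
  have hr : ∀ᶠ r in 𝓝[>] (0 : ℝ), r < ε := mem_nhdsWithin_of_mem_nhds (Iio_mem_nhds hε)
  filter_upwards [hr, self_mem_nhdsWithin] with r h2 h3
  have hd : DifferentiableOn ℂ f (Metric.closedBall 0 r) := fun w hw =>
    (hball w (Metric.closedBall_subset_ball h2 hw)).differentiableAt.differentiableWithinAt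
  exact ⟨h3, hd.continuousOn, hd⟩

theorem AnalyticAt.hasResidue {f : ℂ → ℂ} (hf : AnalyticAt ℂ f 0) : HasResidue f 0 := by
  filter_upwards [AnalyticAt.eventually_diffContOnCl hf] with r ⟨h0, h1, h2⟩
  refine ⟨(h1.mono Metric.sphere_subset_closedBall).circleIntegrable h0.le, ?_⟩
  rw [Complex.circleIntegral_eq_zero_of_differentiable_on_off_countable h0.le countable_empty h1,
    mul_zero]
  intro z hz
  exact (h2 z (Metric.ball_subset_closedBall hz.1)).differentiableAt
    (mem_of_superset (Metric.isOpen_ball.mem_nhds hz.1) Metric.ball_subset_closedBall)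

theorem AnalyticAt.hasResidue_inv_mul {f : ℂ → ℂ} (hf : AnalyticAt ℂ f 0) :
    HasResidue (fun w => w⁻¹ * f w) (f 0) := by
  filter_upwards [AnalyticAt.eventually_diffContOnCl hf] with r ⟨h0, h1, h2⟩
  constructor
  · refine ContinuousOn.circleIntegrable h0.le ?_
    refine ContinuousOn.mul (ContinuousOn.inv₀ continuousOn_id fun w hw h => ?_)
      (h1.mono Metric.sphere_subset_closedBall)
    have hw' : ‖w‖ = r := by simpa using hw
    have h : w = 0 := h
    rw [h, norm_zero] at hw'
    exact h0.ne hw'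
  · have := DifferentiableOn.circleIntegral_sub_inv_smul h2 (w := 0) (Metric.mem_ball_self h0)
    simp only [sub_zero, smul_eq_mul] at this
    rw [this]
    have hpi : (2 * (Real.pi : ℂ) * Complex.I) ≠ 0 := Complex.two_pi_I_ne_zero
    field_simp

theorem hasResidue_inv_pow {n : ℕ} (hn : n ≠ 1) : HasResidue (fun w => w⁻¹ ^ n) 0 := by
  filter_upwards [self_mem_nhdsWithin] with r hr
  have hr : 0 < r := hr
  have h1 : ∀ w : ℂ, w⁻¹ ^ n = (w - 0) ^ (-(n : ℤ)) := fun w => by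
    rw [sub_zero, zpow_neg, zpow_natCast, inv_pow]
  simp only [h1]
  constructor
  · rw [circleIntegrable_sub_zpow_iff]
    right; right
    rw [abs_of_pos hr]
    simpa using hr.ne
  · rw [circleIntegral.integral_sub_zpow_of_ne (by omega), mul_zero]

/-! ### Residues against the recursion kernel -/

/-- The recursion kernel of the curve `x = z² - Λ`, `y = z + const` for `s = z²`, up to sign. -/
noncomputable def kern (Λ s w : ℂ) : ℂ := -(w ^ 2 - Λ) / (4 * w * (s - w ^ 2))

theorem eventually_ne_sq {s : ℂ} (hs : s ≠ 0) : ∀ᶠ w in 𝓝[≠] (0 : ℂ), w ≠ 0 ∧ s - w ^ 2 ≠ 0 := by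
  have h1 : ∀ᶠ w in 𝓝 (0 : ℂ), s - w ^ 2 ≠ 0 := by
    have hc : ContinuousAt (fun w : ℂ => s - w ^ 2) 0 := by fun_prop
    exact hc.eventually_ne (by simpa using hs)
  filter_upwards [mem_nhdsWithin_of_mem_nhds h1, self_mem_nhdsWithin] with w h2 h3
  exact ⟨h3, h2⟩

theorem analyticAt_inv_sub_sq {s : ℂ} (hs : s ≠ 0) :
    AnalyticAt ℂ (fun w : ℂ => (s - w ^ 2)⁻¹) 0 := by
  refine AnalyticAt.inv (by fun_prop) (by simpa using hs)

/-- The induction rests on `1 / (w² (s - w²)) = s⁻¹ (1 / w² + 1 / (s - w²))`, where the first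
summand only contributes a pole of order `2p + 3`, without residue. -/
theorem hasResidue_inv_pow_div {s : ℂ} (hs : s ≠ 0) (p : ℕ) :
    HasResidue (fun w => w⁻¹ * (w ^ 2)⁻¹ ^ p * (s - w ^ 2)⁻¹) (s⁻¹ ^ (p + 1)) := by
  induction p with
  | zero =>
    have h := AnalyticAt.hasResidue_inv_mul (analyticAt_inv_sub_sq hs)
    simp only [ne_eq, OfNat.ofNat_ne_zero, not_false_eq_true, zero_pow, sub_zero] at h
    simpa using h
  | succ p ih =>
    have h := ((hasResidue_inv_pow (n := 2 * p + 3) (by omega)).const_mul s⁻¹).add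
      (ih.const_mul s⁻¹)
    rw [mul_zero, zero_add, ← pow_succ'] at h
    refine h.congr ?_
    filter_upwards [eventually_ne_sq hs] with w ⟨h1, h2⟩
    simp only [inv_pow]
    field_simp
    ring

/-- The residues of the kernel times a power of `w⁻²`. -/
theorem hasResidue_kern_mul_pow {Λ s : ℂ} (hs : s ≠ 0) (p : ℕ) :
    HasResidue (fun w => kern Λ s w * (w ^ 2)⁻¹ ^ p)
      (-1 / 4 * ((1 - Λ * s⁻¹) * s⁻¹ ^ p - if p = 0 then 1 else 0)) := by
  have h1 := hasResidue_inv_pow_div hs p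
  rcases p with _ | p
  -- For `p = 0` the factor `w²` of the kernel cancels the pole, so this half contributes nothing.
  -- The missing contribution is the exceptional `1`, which later becomes the subtracted `V₀`.
  · have h2 : HasResidue (fun w => w * (s - w ^ 2)⁻¹) 0 :=
      AnalyticAt.hasResidue (analyticAt_id.mul (analyticAt_inv_sub_sq hs))
    have h := (h2.const_mul (-1 / 4)).add (h1.const_mul (Λ / 4))
    rw [show -1 / 4 * 0 + Λ / 4 * s⁻¹ ^ (0 + 1) =
      -1 / 4 * ((1 - Λ * s⁻¹) * s⁻¹ ^ 0 - if 0 = 0 then 1 else 0) by simp; ring] at h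
    refine h.congr ?_
    filter_upwards [eventually_ne_sq hs] with w ⟨h1, h2⟩
    rw [kern]
    field_simp
    ring
  · have h2 := hasResidue_inv_pow_div hs p
    have h := (h2.const_mul (-1 / 4)).add (h1.const_mul (Λ / 4))
    rw [show -1 / 4 * s⁻¹ ^ (p + 1) + Λ / 4 * s⁻¹ ^ (p + 1 + 1) =
      -1 / 4 * ((1 - Λ * s⁻¹) * s⁻¹ ^ (p + 1) - if p + 1 = 0 then 1 else 0) by
        rw [if_neg (by omega)]; ring] at h
    refine h.congr ?_
    filter_upwards [eventually_ne_sq hs] with w ⟨h1, h2⟩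
    rw [kern]
    simp only [inv_pow]
    field_simp
    ring

/-- Polynomial functions without constant term. -/
def IsPolyFun (f : ℂ → ℂ) : Prop :=
  ∃ Q : Polynomial ℂ, Q.coeff 0 = 0 ∧ ∀ u, f u = Q.eval u

theorem IsPolyFun.add {f g : ℂ → ℂ} (hf : IsPolyFun f) (hg : IsPolyFun g) :
    IsPolyFun fun u => f u + g u := by
  obtain ⟨P, hP, hf⟩ := hf
  obtain ⟨Q, hQ, hg⟩ := hg
  exact ⟨P + Q, by simp [hP, hQ], fun u => by simp [hf, hg]⟩

theorem IsPolyFun.mul {f g : ℂ → ℂ} (hf : IsPolyFun f) (hg : IsPolyFun g) :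
    IsPolyFun fun u => f u * g u := by
  obtain ⟨P, hP, hf⟩ := hf
  obtain ⟨Q, hQ, hg⟩ := hg
  exact ⟨P * Q, by simp [Polynomial.mul_coeff_zero, hP], fun u => by simp [hf, hg]⟩

theorem IsPolyFun.sum {ι : Type*} (s : Finset ι) {f : ι → ℂ → ℂ} (h : ∀ i ∈ s, IsPolyFun (f i)) :
    IsPolyFun fun u => ∑ i ∈ s, f i u := by
  classical
  induction s using Finset.induction_on with
  | empty => exact ⟨0, by simp, by simp⟩
  | insert i s hi ih =>
    simp only [Finset.sum_insert hi]
    exact (h i (Finset.mem_insert_self _ _)).add (ih fun j hj => h j (Finset.mem_insert_of_mem hj))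

theorem isPolyFun_const_mul_pow (c : ℂ) (p : ℕ) : IsPolyFun fun u => c * u ^ (p + 1) :=
  ⟨Polynomial.monomial (p + 1) c, by simp [Polynomial.coeff_monomial], fun u => by
    rw [Polynomial.eval_monomial]⟩

/-- Without constant term the exceptional case `p = 0` does not enter, and the residue just
multiplies by `-¼ (1 - Λ/s)` and replaces `w²` by `s`. -/
theorem IsPolyFun.hasResidue {f : ℂ → ℂ} (hf : IsPolyFun f) {Λ s : ℂ} (hs : s ≠ 0) :
    HasResidue (fun w => kern Λ s w * f (w ^ 2)⁻¹) (-1 / 4 * ((1 - Λ * s⁻¹) * f s⁻¹)) := by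
  obtain ⟨Q, hQ, hf⟩ := hf
  have h := HasResidue.sum (Finset.range (Q.natDegree + 1)) fun i _ =>
    (hasResidue_kern_mul_pow (Λ := Λ) hs i).const_mul (Q.coeff i)
  have h1 : ∑ i ∈ Finset.range (Q.natDegree + 1), Q.coeff i *
      (-1 / 4 * ((1 - Λ * s⁻¹) * s⁻¹ ^ i - if i = 0 then 1 else 0)) =
        -1 / 4 * ((1 - Λ * s⁻¹) * f s⁻¹) := by
    rw [hf, Polynomial.eval_eq_sum_range, Finset.mul_sum, Finset.mul_sum]
    refine Finset.sum_congr rfl fun i _ => ?_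
    split_ifs with hi
    · rw [hi, hQ]; ring
    · ring
  rw [h1] at h
  refine h.congr (Eventually.of_forall fun w => ?_)
  rw [hf, Polynomial.eval_eq_sum_range, Finset.mul_sum]
  exact Finset.sum_congr rfl fun i _ => by ring

theorem isPolyFun_dir (ψ : Poly) : IsPolyFun fun u => constantCoeff (dir (pw u) ψ) := by
  obtain ⟨N, hN⟩ := exists_pderiv_eq_zero ψ
  simp only [constantCoeff_dir hN]
  refine IsPolyFun.sum _ fun i _ => ?_
  have h := isPolyFun_const_mul_pow (constantCoeff (pderiv i ψ)) i
  simp only [mul_comm] at h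
  exact h

theorem isPolyFun_dir_dir (ψ : Poly) :
    IsPolyFun fun u => constantCoeff (dir (pw u) (dir (pw u) ψ)) := by
  obtain ⟨N, hN⟩ := exists_pderiv_eq_zero ψ
  have h : ∀ u, constantCoeff (dir (pw u) (dir (pw u) ψ)) =
      ∑ i ∈ Finset.range N, constantCoeff (dir (pw u) (pderiv i ψ)) * (1 * u ^ (i + 1)) := by
    intro u
    rw [derivation_eq_sum_range (dir (pw u)) hN, map_sum, map_sum]
    refine Finset.sum_congr rfl fun i _ => ?_
    rw [dir_X, Derivation.leibniz, derivation_C, smul_zero, zero_add, smul_eq_mul, map_mul,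
      constantCoeff_C, one_mul, mul_comm, pw]
  simp only [h]
  exact IsPolyFun.sum _ fun i _ => (isPolyFun_dir _).mul (isPolyFun_const_mul_pow _ _)

theorem analyticAt_bergman {v : ℂ} (hv : v ≠ 0) : AnalyticAt ℂ (fun w => bergman w v) 0 := by
  unfold bergman
  exact AnalyticAt.div (by fun_prop) (by fun_prop) (by simpa using hv)

theorem analyticAt_bergman_neg {v : ℂ} (hv : v ≠ 0) : AnalyticAt ℂ (fun w => bergman (-w) v) 0 := by
  unfold bergman
  exact AnalyticAt.div (by fun_prop) (by fun_prop) (by simpa using hv)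

/-- The Taylor expansion with remainder of the even part of the Bergman kernel. -/
theorem bergman_add_bergman_neg {v : ℂ} (hv : v ≠ 0) (M : ℕ) {w : ℂ} (hw : v ^ 2 - w ^ 2 ≠ 0) :
    bergman w v + bergman (-w) v =
      ∑ k ∈ Finset.range M, 2 * (2 * (k : ℂ) + 1) * (w ^ 2) ^ k * (v ^ 2)⁻¹ ^ (k + 1) +
        (w ^ 2) ^ M * (2 * ((2 * (M : ℂ) + 1) * v ^ 2 - (2 * M - 1) * w ^ 2) *
          (v ^ 2)⁻¹ ^ M * (v ^ 2 - w ^ 2)⁻¹ ^ 2) := by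
  induction M with
  | zero =>
    have h1 : w - v ≠ 0 := fun h => hw (by rw [sub_eq_zero.mp h]; ring)
    have h2 : -w - v ≠ 0 := fun h => hw (by rw [← sub_eq_zero.mp h]; ring)
    have h3 : w + v ≠ 0 := fun h => h2 (by linear_combination -h)
    have h4 : v ^ 2 - w ^ 2 = -(w - v) * (w + v) := by ring
    have h5 : -w - v = -(w + v) := by ring
    simp only [bergman, Finset.range_zero, Finset.sum_empty, h4, h5]
    field_simp
    push_cast
    ring
  | succ M ih =>
    rw [ih, Finset.sum_range_succ, add_assoc]
    congr 1
    push_cast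
    simp only [inv_pow]
    field_simp
    ring

theorem hasResidue_bergman_pow (Λ : ℂ) {s v : ℂ} (hs : s ≠ 0) (hv : v ≠ 0) (a : ℕ) :
    HasResidue (fun w => kern Λ s w * ((bergman w v + bergman (-w) v) * (w ^ 2)⁻¹ ^ (a + 1)))
      (-1 / 4 * recDir Λ s⁻¹ (pw (v ^ 2)⁻¹) a) := by
  have hv2 : v ^ 2 ≠ 0 := pow_ne_zero 2 hv
  have h1 := HasResidue.sum (Finset.range (a + 2)) fun k _ =>
    (hasResidue_kern_mul_pow (Λ := Λ) hs (a + 1 - k)).const_mul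
      (2 * (2 * (k : ℂ) + 1) * (v ^ 2)⁻¹ ^ (k + 1))
  -- The Taylor remainder after `a + 2` terms has a factor `w^{2(a+2)}`. Multiplied by `w^{-2(a+1)}`
  -- it leaves `w²`, which cancels the simple pole of `kern`.
  have h2 : HasResidue (fun w => -(w ^ 2 - Λ) / 4 * w * (s - w ^ 2)⁻¹ *
      (2 * ((2 * ((a + 2 : ℕ) : ℂ) + 1) * v ^ 2 - (2 * ((a + 2 : ℕ) : ℂ) - 1) * w ^ 2) *
          (v ^ 2)⁻¹ ^ (a + 2) * (v ^ 2 - w ^ 2)⁻¹ ^ 2)) 0 := by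
    have h3 := analyticAt_inv_sub_sq hs
    have h4 := analyticAt_inv_sub_sq hv2
    refine AnalyticAt.hasResidue ?_
    refine AnalyticAt.mul (AnalyticAt.mul (by fun_prop) h3) (AnalyticAt.mul (by fun_prop) ?_)
    exact h4.pow 2
  have h := h1.add h2
  have hval : ∑ k ∈ Finset.range (a + 2), 2 * (2 * (k : ℂ) + 1) * (v ^ 2)⁻¹ ^ (k + 1) *
      (-1 / 4 * ((1 - Λ * s⁻¹) * s⁻¹ ^ (a + 1 - k) - if a + 1 - k = 0 then 1 else 0)) + 0 =
      -1 / 4 * recDir Λ s⁻¹ (pw (v ^ 2)⁻¹) a := by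
    -- Only the last term `k = a + 1` meets the exceptional residue at `p = 0`; it yields the
    -- subtracted shift in `recDir`.
    have h5 : ∑ k ∈ Finset.range (a + 2), 2 * (2 * (k : ℂ) + 1) * (v ^ 2)⁻¹ ^ (k + 1) *
        (if a + 1 - k = 0 then 1 else 0) = 2 * (2 * (a : ℂ) + 3) * (v ^ 2)⁻¹ ^ (a + 2) := by
      rw [Finset.sum_eq_single (a + 1)]
      · rw [Nat.sub_self, if_pos rfl]; push_cast; ring
      · intro k hk hk'
        rw [Finset.mem_range] at hk
        rw [if_neg (by omega), mul_zero]
      · intro h; simp at h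
    rw [recDir, pw, ← h5, Finset.mul_sum, ← Finset.sum_sub_distrib, Finset.mul_sum, add_zero]
    exact Finset.sum_congr rfl fun k _ => by simp only [pw]; ring
  rw [hval] at h
  refine h.congr ?_
  filter_upwards [eventually_ne_sq hs, eventually_ne_sq hv2] with w ⟨h3, h4⟩ ⟨_, h5⟩
  rw [bergman_add_bergman_neg hv (a + 2) h5,
    show ∀ K A B P : ℂ, K * ((A + B) * P) = K * (A * P) + K * (B * P) from
      fun K A B P => by ring, Finset.sum_mul, Finset.mul_sum]
  congr 1
  · refine Finset.sum_congr rfl fun k hk => ?_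
    rw [Finset.mem_range] at hk
    have h6 : (w ^ 2)⁻¹ ^ (a + 1) = (w ^ 2)⁻¹ ^ (a + 1 - k) * (w ^ 2)⁻¹ ^ k := by
      rw [← pow_add]; congr 1; omega
    have h7 : (w ^ 2) ^ k * (w ^ 2)⁻¹ ^ k = 1 := by
      rw [← mul_pow, mul_inv_cancel₀ (pow_ne_zero 2 h3), one_pow]
    rw [h6]
    linear_combination (-2 * (2 * (k : ℂ) + 1) * (v ^ 2)⁻¹ ^ (k + 1) * kern Λ s w *
      (w ^ 2)⁻¹ ^ (a + 1 - k)) * h7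
  · have h7 : (w ^ 2) ^ (a + 2) * (w ^ 2)⁻¹ ^ (a + 1) = w ^ 2 := by
      rw [pow_succ, mul_right_comm, ← mul_pow, mul_inv_cancel₀ (pow_ne_zero 2 h3), one_pow, one_mul]
    have h8 : kern Λ s w * w ^ 2 = -(w ^ 2 - Λ) / 4 * w * (s - w ^ 2)⁻¹ := by
      rw [kern]; field_simp
    rw [← h8]
    nth_rw 1 [← h7]
    ring

theorem hasResidue_bergman_dir (Λ : ℂ) {s v : ℂ} (hs : s ≠ 0) (hv : v ≠ 0) (ψ : Poly) :
    HasResidue (fun w => kern Λ s w * ((bergman w v + bergman (-w) v) *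
        constantCoeff (dir (pw (w ^ 2)⁻¹) ψ)))
      (-1 / 4 * constantCoeff (dir (recDir Λ s⁻¹ (pw (v ^ 2)⁻¹)) ψ)) := by
  obtain ⟨N, hN⟩ := exists_pderiv_eq_zero ψ
  have h := HasResidue.sum (Finset.range N) fun i _ =>
    (hasResidue_bergman_pow Λ hs hv i).const_mul (constantCoeff (pderiv i ψ))
  have h1 : ∑ i ∈ Finset.range N, constantCoeff (pderiv i ψ) *
      (-1 / 4 * recDir Λ s⁻¹ (pw (v ^ 2)⁻¹) i) =
      -1 / 4 * constantCoeff (dir (recDir Λ s⁻¹ (pw (v ^ 2)⁻¹)) ψ) := by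
    rw [constantCoeff_dir hN, Finset.mul_sum]
    exact Finset.sum_congr rfl fun i _ => by ring
  rw [h1] at h
  refine h.congr (Eventually.of_forall fun w => ?_)
  rw [constantCoeff_dir hN, Finset.mul_sum, Finset.mul_sum]
  exact Finset.sum_congr rfl fun i _ => by rw [pw]; ring

/-- The residue of the kernel times an analytic function. -/
theorem hasResidue_kern_mul_analytic (Λ : ℂ) {s : ℂ} (hs : s ≠ 0) {f : ℂ → ℂ}
    (hf : AnalyticAt ℂ f 0) :
    HasResidue (fun w => kern Λ s w * f w) (Λ * s⁻¹ / 4 * f 0) := by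
  have h1 : AnalyticAt ℂ (fun w => -(w ^ 2 - Λ) / 4 * (s - w ^ 2)⁻¹ * f w) 0 :=
    ((by fun_prop : AnalyticAt ℂ (fun w : ℂ => -(w ^ 2 - Λ) / 4) 0).mul
      (analyticAt_inv_sub_sq hs)).mul hf
  have h := AnalyticAt.hasResidue_inv_mul h1
  rw [show -((0 : ℂ) ^ 2 - Λ) / 4 * (s - 0 ^ 2)⁻¹ * f 0 = Λ * s⁻¹ / 4 * f 0 by
    rw [zero_pow two_ne_zero, sub_zero]; ring] at h
  refine h.congr ?_
  filter_upwards [eventually_ne_sq hs] with w ⟨h1, h2⟩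
  rw [kern]
  field_simp

/-- The bound on `‖w‖` keeps the pole `z` off the segment from `-w` to `w`, where `(z - t)⁻¹` is a
primitive. -/
theorem segmentIntegral_bergman {w z : ℂ} (h : ‖w‖ < ‖z‖) :
    segmentIntegral (-w) w (fun t => bergman t z) = 2 * w / (z ^ 2 - w ^ 2) := by
  have hne : ∀ t ∈ uIcc (0 : ℝ) 1, z - (-w + t * (w - -w)) ≠ 0 := by
    intro t ht h0
    rw [uIcc_of_le zero_le_one] at ht
    have h1 : z = ((2 * t - 1 : ℝ) : ℂ) * w := by
      push_cast
      linear_combination h0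
    have h2 : ‖z‖ ≤ ‖w‖ := by
      rw [h1, norm_mul, Complex.norm_real, Real.norm_eq_abs]
      have : |2 * t - 1| ≤ 1 := abs_le.mpr ⟨by linarith [ht.1], by linarith [ht.2]⟩
      nlinarith [norm_nonneg w]
    linarith
  have hd : ∀ t ∈ uIcc (0 : ℝ) 1, HasDerivAt
      (fun t : ℝ => (z - (-w + (t : ℂ) * (w - -w)))⁻¹)
      (bergman (-w + t * (w - -w)) z * (w - -w)) t := by
    intro t ht
    have h1 : HasDerivAt (fun t : ℝ => z - (-w + (t : ℂ) * (w - -w))) (-(1 * (w - -w))) t := by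
      have h2 : HasDerivAt (fun t : ℝ => (t : ℂ)) 1 t := Complex.ofRealCLM.hasDerivAt
      exact ((h2.mul_const (w - -w)).const_add (-w)).const_sub z
    refine (h1.inv (hne t ht)).congr_deriv ?_
    simp only [bergman]
    rw [show (-w + (t : ℂ) * (w - -w) - z) = -(z - (-w + (t : ℂ) * (w - -w))) by ring,
      neg_sq]
    ring
  have hint : IntervalIntegrable (fun t : ℝ => bergman (-w + t * (w - -w)) z * (w - -w))
      volume 0 1 := by
    refine ContinuousOn.intervalIntegrable fun t ht => ContinuousAt.continuousWithinAt ?_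
    unfold bergman
    have h2 : (-w + (t : ℂ) * (w - -w) - z) ^ 2 ≠ 0 := by
      refine pow_ne_zero 2 fun h0 => hne t ht ?_
      linear_combination -h0
    exact ContinuousAt.mul (ContinuousAt.div (by fun_prop) (by fun_prop) h2) (by fun_prop)
  rw [segmentIntegral, intervalIntegral.integral_eq_sub_of_hasDerivAt hd hint]
  have h1 := hne 1 (by simp)
  have h0 := hne 0 (by simp)
  have h1' : z - w ≠ 0 := by
    intro h; apply h1; push_cast; linear_combination h
  have h0' : z + w ≠ 0 := by
    intro h; apply h0; push_cast; linear_combination h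
  have h2 : z ^ 2 - w ^ 2 = (z - w) * (z + w) := by ring
  rw [h2, show z - (-w + ((1 : ℝ) : ℂ) * (w - -w)) = z - w by push_cast; ring,
    show z - (-w + ((0 : ℝ) : ℂ) * (w - -w)) = z + w by push_cast; ring]
  field_simp
  ring

theorem oneForm_gkzCurve (w₀ w₁ z : ℂ) : (gkzCurve w₀ w₁).oneForm z =
    (z + (w₀ + w₁) / 2) * (2 * z) / (z ^ 2 - (w₀ - w₁) ^ 2 / 4) := by
  have : deriv (fun z : ℂ => z ^ 2 - (w₀ - w₁) ^ 2 / 4) z = 2 * z := by simp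
  simp only [SpectralCurve.oneForm, gkzCurve, this]

theorem kernel_gkzCurve (w₀ w₁ : ℂ) {z : ℂ} (hz : z ≠ 0) : ∀ᶠ w in 𝓝[≠] (0 : ℂ),
    (gkzCurve w₀ w₁).kernel 0 w z * deriv ((gkzCurve w₀ w₁).conj 0) w =
      kern ((w₀ - w₁) ^ 2 / 4) (z ^ 2) w := by
  have hn : ∀ᶠ w in 𝓝[≠] (0 : ℂ), ‖w‖ < ‖z‖ := by
    refine mem_nhdsWithin_of_mem_nhds (ContinuousAt.eventually_lt (by fun_prop) (by fun_prop) ?_)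
    simpa using hz
  have hx : ∀ᶠ w in 𝓝[≠] (0 : ℂ), w ^ 2 - (w₀ - w₁) ^ 2 / 4 ≠ 0 := by
    by_cases hΛ : (w₀ - w₁) ^ 2 / 4 = 0
    · filter_upwards [self_mem_nhdsWithin] with w hw
      rw [hΛ, sub_zero]
      exact pow_ne_zero 2 hw
    · refine mem_nhdsWithin_of_mem_nhds ?_
      have hc : ContinuousAt (fun w : ℂ => w ^ 2 - (w₀ - w₁) ^ 2 / 4) 0 := by fun_prop
      exact hc.eventually_ne (by simpa using hΛ)
  filter_upwards [hn, hx, eventually_ne_sq (pow_ne_zero 2 hz)] with w h1 h2 ⟨h3, h4⟩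
  have hconj : (gkzCurve w₀ w₁).conj 0 = fun w => -w := rfl
  have hderiv : deriv (fun w : ℂ => -w) w = -1 := by simp
  rw [SpectralCurve.kernel, hconj, hderiv, segmentIntegral_bergman h1, oneForm_gkzCurve,
    oneForm_gkzCurve, kern, neg_sq]
  generalize (w₀ - w₁) ^ 2 / 4 = Λ at *
  generalize (w₀ + w₁) / 2 = c
  have h5 : (w + c) * (2 * w) / (w ^ 2 - Λ) - (-w + c) * (2 * -w) / (w ^ 2 - Λ) * -1 =
      4 * w ^ 2 / (w ^ 2 - Λ) := by
    field_simp
    ring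
  rw [h5]
  field_simp

/-! ### Identification of the correlators with the free energies -/

/-- The unstable correlator `ω_2^{(0)} = B`; all others are set to zero. -/
noncomputable def omegaBase : (g n : ℕ) → (Fin n → ℂ) → ℂ
  | 0, 2, z => bergman (z 0) (z 1)
  | _, _, _ => 0

theorem omegaBase_of_ne {g n : ℕ} (h : g ≠ 0 ∨ n ≠ 2) (z : Fin n → ℂ) : omegaBase g n z = 0 := by
  unfold omegaBase
  split
  · simp at h
  · rfl

/-- Written as a sum over `j`, the factor `B` makes the double sum over genera and subsets collapse
to a sum over the variables. -/
theorem omegaBase_cons {n : ℕ} (g : ℕ) (J : Finset (Fin n)) (x : ℂ) (y : Fin n → ℂ) :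
    omegaBase g (J.card + 1) (Fin.cons x fun i => y (J.orderEmbOfFin rfl i)) =
      ∑ j, if g = 0 ∧ J = {j} then bergman x (y j) else 0 := by
  by_cases h : g = 0 ∧ J.card = 1
  · obtain ⟨rfl, hJ⟩ := h
    have aux : ∀ (k : ℕ) (hk : k = 1) (f : Fin k → ℂ), omegaBase 0 (k + 1) (Fin.cons x f) =
        bergman x (f ⟨0, by omega⟩) := by
      rintro k rfl f
      rfl
    rw [aux _ hJ]
    obtain ⟨j, rfl⟩ := Finset.card_eq_one.mp hJ
    have hj := Finset.orderEmbOfFin_mem ({j} : Finset (Fin n)) rfl ⟨0, by omega⟩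
    rw [Finset.mem_singleton] at hj
    rw [hj, Finset.sum_eq_single j]
    · simp
    · intro b _ hb
      rw [if_neg]
      rintro ⟨_, h⟩
      exact hb (Finset.singleton_inj.mp h).symm
    · intro h; exact absurd (Finset.mem_univ j) h
  · rw [omegaBase_of_ne (by omega), Finset.sum_eq_zero]
    intro j _
    rw [if_neg]
    rintro ⟨rfl, rfl⟩
    exact h ⟨rfl, Finset.card_singleton j⟩

theorem map_univ_orderEmbOfFin {α : Type*} {n : ℕ} (J : Finset (Fin n)) (d : Fin n → α) :
    (Finset.univ : Finset (Fin J.card)).val.map (fun i => d (J.orderEmbOfFin rfl i)) =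
      J.val.map d := by
  have h := Finset.map_orderEmbOfFin_univ J rfl
  conv_rhs => rw [← h]
  rw [Finset.map_val, Multiset.map_map]
  rfl

theorem map_univ_cons_orderEmbOfFin {n : ℕ} (J : Finset (Fin n)) (x : ℂ) (y : Fin n → ℂ) :
    (Finset.univ : Finset (Fin (J.card + 1))).val.map
        (fun i => pw (((Fin.cons x fun i => y (J.orderEmbOfFin rfl i) :
          Fin (J.card + 1) → ℂ) i) ^ 2)⁻¹) =
      pw (x ^ 2)⁻¹ ::ₘ J.val.map fun j => pw (y j ^ 2)⁻¹ := by
  rw [map_univ_succ, ← map_univ_orderEmbOfFin J]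
  simp only [Fin.cons_zero, Fin.cons_succ]

theorem exists_of_corr_freeCoeff_ne_zero {Λ : ℂ} {m : ℕ} {M : Multiset (ℕ → ℂ)}
    (h : corr M (freeCoeff Λ m) ≠ 0) : m ≠ 0 ∧ ∃ g, 2 * g + M.card = m + 2 := by
  constructor
  · rintro rfl
    exact h (by rw [freeCoeff_zero, map_zero])
  · by_contra h2
    exact h (corr_freeCoeff_eq_zero Λ m M fun g hg => h2 ⟨g, hg⟩)

/-- The degree condition lets a nonzero factor determine its genus from its order and conversely.
Terms spoiled by truncated subtraction involve `freeCoeff Λ 0 = 0`, so comparing the nonzero terms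
is enough. -/
theorem sum_genus_eq_sum_antidiagonal (Λ : ℂ) {g m : ℕ} {M N : Multiset (ℕ → ℂ)} {a b : ℕ}
    (ha : M.card = a) (hb : N.card = b) (hm : 2 * g + (a + b) = m + 4) :
    ∑ l : Fin (g + 1), corr M (freeCoeff Λ (2 * (g - l) + a - 2)) *
        corr N (freeCoeff Λ (2 * l + b - 2)) =
      ∑ p ∈ Finset.HasAntidiagonal.antidiagonal m,
        corr M (freeCoeff Λ p.1) * corr N (freeCoeff Λ p.2) := by
  refine Finset.sum_bij_ne_zero
    (fun l _ _ => (2 * (g - (l : ℕ)) + a - 2, 2 * (l : ℕ) + b - 2)) ?_ ?_ ?_ ?_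
  · intro l _ hne
    obtain ⟨h1, _⟩ := exists_of_corr_freeCoeff_ne_zero (left_ne_zero_of_mul hne)
    obtain ⟨h2, _⟩ := exists_of_corr_freeCoeff_ne_zero (right_ne_zero_of_mul hne)
    have := l.isLt
    rw [Finset.HasAntidiagonal.mem_antidiagonal]
    simp only
    omega
  · intro l _ hl l' _ hl' heq
    obtain ⟨h2, _⟩ := exists_of_corr_freeCoeff_ne_zero (right_ne_zero_of_mul hl)
    obtain ⟨h2', _⟩ := exists_of_corr_freeCoeff_ne_zero (right_ne_zero_of_mul hl')
    simp only [Prod.mk.injEq] at heq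
    exact Fin.ext (by omega)
  · intro p hp hne
    obtain ⟨h1, g1, hg1⟩ := exists_of_corr_freeCoeff_ne_zero (left_ne_zero_of_mul hne)
    obtain ⟨h2, g2, hg2⟩ := exists_of_corr_freeCoeff_ne_zero (right_ne_zero_of_mul hne)
    have hp' := Finset.HasAntidiagonal.mem_antidiagonal.mp hp
    have e1 : 2 * (g - g2) + a - 2 = p.1 := by omega
    have e2 : 2 * g2 + b - 2 = p.2 := by omega
    refine ⟨⟨g2, by omega⟩, Finset.mem_univ _, ?_, ?_⟩
    · simpa only [e1, e2] using hne
    · exact Prod.ext e1 e2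
  · intro l _ _
    rfl

theorem sum_singleton_left {g n : ℕ} (F : Fin (g + 1) → Finset (Fin n) → ℂ) (b : Fin n → ℂ) :
    ∑ l : Fin (g + 1), ∑ J : Finset (Fin n),
        (∑ j, if g - (l : ℕ) = 0 ∧ J = {j} then b j else 0) * F l J =
      ∑ j, b j * F (Fin.last g) {j} := by
  rw [Finset.sum_eq_single (Fin.last g)]
  · simp only [Fin.val_last, Nat.sub_self, true_and, Finset.sum_mul]
    rw [Finset.sum_comm]
    refine Finset.sum_congr rfl fun j _ => ?_
    rw [Finset.sum_eq_single {j}]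
    · simp
    · intro J _ hJ; rw [if_neg hJ, zero_mul]
    · intro h; exact absurd (Finset.mem_univ _) h
  · intro l _ hl
    have hl' : ¬ (g - (l : ℕ) = 0) := fun h => hl (Fin.ext (by
      have := l.isLt
      simp only [Fin.val_last]
      omega))
    simp [hl']
  · intro h; exact absurd (Finset.mem_univ _) h

theorem sum_singleton_right {g n : ℕ} (F : Fin (g + 1) → Finset (Fin n) → ℂ) (b : Fin n → ℂ) :
    ∑ l : Fin (g + 1), ∑ J : Finset (Fin n),
        F l J * (∑ j, if (l : ℕ) = 0 ∧ Jᶜ = {j} then b j else 0) =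
      ∑ j, F 0 {j}ᶜ * b j := by
  rw [Finset.sum_eq_single 0]
  · simp only [Fin.val_zero, true_and, Finset.mul_sum]
    rw [Finset.sum_comm]
    refine Finset.sum_congr rfl fun j _ => ?_
    rw [Finset.sum_eq_single {j}ᶜ]
    · simp
    · intro J _ hJ
      rw [if_neg, mul_zero]
      intro h
      exact hJ (by rw [← h, compl_compl])
    · intro h; exact absurd (Finset.mem_univ _) h
  · intro l _ hl
    have hl' : ¬ ((l : ℕ) = 0) := fun h => hl (Fin.ext h)
    simp [hl']
  · intro h; exact absurd (Finset.mem_univ _) h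

theorem sum_add_mul_add {ι κ : Type*} [Fintype ι] [Fintype κ] (A a B b : ι → κ → ℂ) :
    ∑ l, ∑ J, (A l J + a l J) * (B l J + b l J) =
      (((∑ l, ∑ J, A l J * B l J) + ∑ l, ∑ J, a l J * B l J) + ∑ l, ∑ J, A l J * b l J) +
        ∑ l, ∑ J, a l J * b l J := by
  simp only [← Finset.sum_add_distrib]
  refine Finset.sum_congr rfl fun l _ => Finset.sum_congr rfl fun J _ => ?_
  ring

theorem isPolyFun_corr (M : Multiset (ℕ → ℂ)) (φ : Poly) :
    IsPolyFun fun u => corr (pw u ::ₘ M) φ := by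
  simp only [corr_cons]
  exact isPolyFun_dir _

theorem isPolyFun_corr_corr (M : Multiset (ℕ → ℂ)) (φ : Poly) :
    IsPolyFun fun u => corr (pw u ::ₘ pw u ::ₘ M) φ := by
  simp only [corr_cons, dirs_cons]
  exact isPolyFun_dir_dir _

theorem analyticAt_sum_bergman {n : ℕ} {y : Fin n → ℂ} (hy : ∀ j, y j ≠ 0) (g : ℕ) :
    AnalyticAt ℂ (fun w => ∑ j, bergman w (y j) *
      ∑ i, if g = 0 ∧ ({j} : Finset (Fin n))ᶜ = {i} then bergman (-w) (y i) else 0) 0 := by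
  refine Finset.analyticAt_fun_sum _ fun j _ => (analyticAt_bergman (hy j)).mul ?_
  refine Finset.analyticAt_fun_sum _ fun i _ => ?_
  split_ifs
  · exact analyticAt_bergman_neg (hy i)
  · exact analyticAt_const

/-- Terms consisting of `B` alone occur only for `ω_3^{(0)}` and `ω_1^{(1)}`, the two cases with `m
= 0`. Their residues are the contributions of `t₀²` and of `u / 4` to `recConst`. -/
theorem hasResidue_base (Λ : ℂ) {s : ℂ} (hs : s ≠ 0) {g n m : ℕ} (hm : 2 * g + n = m + 2)
    {y : Fin n → ℂ} (hy : ∀ j, y j ≠ 0) :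
    HasResidue (fun w => kern Λ s w * ((if g = 0 then 0 else
        omegaBase (g - 1) (n + 2) (Fin.cons w (Fin.cons (-w) y))) +
      ∑ j, bergman w (y j) *
        ∑ i, if g = 0 ∧ ({j} : Finset (Fin n))ᶜ = {i} then bergman (-w) (y i) else 0))
      (-1 / 4 * if m = 0 then
        corr ((Finset.univ : Finset (Fin n)).val.map fun j => pw (y j ^ 2)⁻¹) (recConst Λ s⁻¹)
          else 0) := by
  by_cases h0 : m = 0
  · subst h0
    rw [if_pos rfl]
    rcases g with _ | g
    · obtain rfl : n = 2 := by omega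
      have h := hasResidue_kern_mul_analytic Λ hs (analyticAt_sum_bergman hy 0)
      have h2 : (Finset.univ : Finset (Fin 2)).val.map (fun j => pw (y j ^ 2)⁻¹) =
          {pw (y 0 ^ 2)⁻¹, pw (y 1 ^ 2)⁻¹} := by
        rw [map_univ_succ, map_univ_succ]
        simp
      have h3 : ({0} : Finset (Fin 2))ᶜ = {1} := by decide
      have h4 : ({1} : Finset (Fin 2))ᶜ = {0} := by decide
      have h5 : (1 : Fin 2) ≠ 0 := by decide
      rw [h2, corr_recConst_pair]
      simp only [if_true, zero_add]
      simp only [Fin.sum_univ_two, h3, h4, true_and, Finset.singleton_inj, h5, h5.symm, if_true,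
        if_false, add_zero, zero_add] at h ⊢
      rw [show -1 / 4 * (-(Λ * s⁻¹) * (2 * pw (y 0 ^ 2)⁻¹ 0 * pw (y 1 ^ 2)⁻¹ 0)) =
        Λ * s⁻¹ / 4 * (bergman 0 (y 0) * bergman (-0) (y 1) +
          bergman 0 (y 1) * bergman (-0) (y 0)) by simp [bergman, pw]; ring]
      exact h
    · obtain rfl : g = 0 := by omega
      obtain rfl : n = 0 := by omega
      have h := (isPolyFun_const_mul_pow (1 / 4) 0).hasResidue (Λ := Λ) hs
      rw [show (Finset.univ : Finset (Fin 0)).val.map (fun j => pw (y j ^ 2)⁻¹) = 0 from rfl,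
        corr_recConst_zero, show -1 / 4 * ((1 - Λ * s⁻¹) * (s⁻¹ / 4)) =
          -1 / 4 * ((1 - Λ * s⁻¹) * (1 / 4 * s⁻¹ ^ (0 + 1))) by ring]
      refine h.congr ?_
      filter_upwards [self_mem_nhdsWithin] with w hw
      have hw : w ≠ 0 := hw
      have : omegaBase 0 2 (Fin.cons w (Fin.cons (-w) y)) = bergman w (-w) := rfl
      simp only [Finset.univ_eq_empty, Finset.sum_empty, add_zero, zero_add, Nat.sub_self,
        one_ne_zero, if_false, this, bergman]
      congr 1
      field_simp
      ring
  · rw [if_neg h0, mul_zero]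
    refine HasResidue.congr (f := fun _ => 0) (AnalyticAt.hasResidue analyticAt_const)
      (Eventually.of_forall fun w => ?_)
    rw [Finset.sum_eq_zero, add_zero]
    · split_ifs with hg
      · rw [mul_zero]
      · rw [omegaBase_of_ne (by omega), mul_zero]
    · intro j _
      rw [Finset.sum_eq_zero, mul_zero]
      intro i _
      rw [if_neg]
      rintro ⟨rfl, hi⟩
      have h1 := Finset.card_compl ({j} : Finset (Fin n))
      rw [hi, Finset.card_singleton, Finset.card_singleton, Fintype.card_fin] at h1
      omega

/-- The residue of the recursion for the stable parts of the correlators. -/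
theorem hasResidue_recursion (Λ : ℂ) {s : ℂ} (hs : s ≠ 0) {g n m : ℕ} (hm : 2 * g + n = m + 2)
    {y : Fin n → ℂ} (hy : ∀ j, y j ≠ 0) (d : Fin n → ℕ → ℂ) (hd : d = fun j => pw (y j ^ 2)⁻¹) :
    HasResidue (fun w => kern Λ s w * ((if g = 0 then 0 else
        corr (pw (w ^ 2)⁻¹ ::ₘ pw (w ^ 2)⁻¹ ::ₘ (Finset.univ : Finset (Fin n)).val.map d)
          (freeCoeff Λ (2 * (g - 1) + (n + 2) - 2)) +
        omegaBase (g - 1) (n + 2) (Fin.cons w (Fin.cons (-w) y))) +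
      ∑ l : Fin (g + 1), ∑ J : Finset (Fin n),
        (corr (pw (w ^ 2)⁻¹ ::ₘ J.val.map d) (freeCoeff Λ (2 * (g - l) + (J.card + 1) - 2)) +
          ∑ j, if g - (l : ℕ) = 0 ∧ J = {j} then bergman w (y j) else 0) *
        (corr (pw (w ^ 2)⁻¹ ::ₘ Jᶜ.val.map d) (freeCoeff Λ (2 * l + (Jᶜ.card + 1) - 2)) +
          ∑ j, if (l : ℕ) = 0 ∧ Jᶜ = {j} then bergman (-w) (y j) else 0)))
      (corr (pw s⁻¹ ::ₘ (Finset.univ : Finset (Fin n)).val.map d) (freeCoeff Λ (m + 1))) := by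
  have hcard : ∀ j : Fin n, 2 * g + ((({j} : Finset (Fin n))ᶜ).card + 1) - 2 = m := by
    intro j
    have := j.isLt
    rw [Finset.card_compl, Finset.card_singleton, Fintype.card_fin]
    omega
  -- The integrand splits into three kinds of terms: purely stable ones, polynomial in `w⁻²`; those
  -- with one factor `B`, where evenness of the stable parts in `w` produces `B(w, ·) + B(-w, ·)`;
  -- and those containing `B` alone.
  have h1 : IsPolyFun fun u => if g = 0 then 0 else
      corr (pw u ::ₘ pw u ::ₘ (Finset.univ : Finset (Fin n)).val.map d) (freeCoeff Λ m) := by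
    split_ifs
    · exact ⟨0, by simp, by simp⟩
    · exact isPolyFun_corr_corr _ _
  have h2 : IsPolyFun fun u => ∑ l : Fin (g + 1), ∑ J : Finset (Fin n),
      corr (pw u ::ₘ J.val.map d) (freeCoeff Λ (2 * (g - l) + (J.card + 1) - 2)) *
        corr (pw u ::ₘ Jᶜ.val.map d) (freeCoeff Λ (2 * l + (Jᶜ.card + 1) - 2)) :=
    IsPolyFun.sum _ fun l _ => IsPolyFun.sum _ fun J _ =>
      (isPolyFun_corr _ _).mul (isPolyFun_corr _ _)
  have h3 := HasResidue.sum Finset.univ fun (j : Fin n) _ =>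
    hasResidue_bergman_dir Λ hs (hy j) (dirs ((({j} : Finset (Fin n))ᶜ).val.map d) (freeCoeff Λ m))
  have h := ((((h1.add h2).hasResidue (Λ := Λ) hs).add h3).add (hasResidue_base Λ hs hm hy))
  have hval : -1 / 4 * ((1 - Λ * s⁻¹) * ((if g = 0 then 0 else
        corr (pw s⁻¹ ::ₘ pw s⁻¹ ::ₘ (Finset.univ : Finset (Fin n)).val.map d) (freeCoeff Λ m)) +
      ∑ l : Fin (g + 1), ∑ J : Finset (Fin n),
        corr (pw s⁻¹ ::ₘ J.val.map d) (freeCoeff Λ (2 * (g - l) + (J.card + 1) - 2)) *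
        corr (pw s⁻¹ ::ₘ Jᶜ.val.map d) (freeCoeff Λ (2 * l + (Jᶜ.card + 1) - 2)))) +
      ∑ j, -1 / 4 * constantCoeff (dir (recDir Λ s⁻¹ (pw (y j ^ 2)⁻¹))
        (dirs ((({j} : Finset (Fin n))ᶜ).val.map d) (freeCoeff Λ m))) +
      (-1 / 4 * if m = 0 then corr ((Finset.univ : Finset (Fin n)).val.map
        fun j => pw (y j ^ 2)⁻¹) (recConst Λ s⁻¹) else 0) =
      corr (pw s⁻¹ ::ₘ (Finset.univ : Finset (Fin n)).val.map d) (freeCoeff Λ (m + 1)) := by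
    have e1 : (if g = 0 then 0 else corr (pw s⁻¹ ::ₘ pw s⁻¹ ::ₘ
        (Finset.univ : Finset (Fin n)).val.map d) (freeCoeff Λ m)) =
        corr (pw s⁻¹ ::ₘ pw s⁻¹ ::ₘ (Finset.univ : Finset (Fin n)).val.map d) (freeCoeff Λ m) := by
      split_ifs with hg
      · rw [corr_freeCoeff_eq_zero]
        intro g' hg'
        simp at hg'
        omega
      · rfl
    have e2 : ∑ l : Fin (g + 1), ∑ J : Finset (Fin n),
        corr (pw s⁻¹ ::ₘ J.val.map d) (freeCoeff Λ (2 * (g - l) + (J.card + 1) - 2)) *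
        corr (pw s⁻¹ ::ₘ Jᶜ.val.map d) (freeCoeff Λ (2 * l + (Jᶜ.card + 1) - 2)) =
        ∑ p ∈ Finset.HasAntidiagonal.antidiagonal m,
          ∑ J ∈ (Finset.univ : Finset (Fin n)).powerset,
          corr (pw s⁻¹ ::ₘ J.val.map d) (freeCoeff Λ p.1) *
            corr (pw s⁻¹ ::ₘ (Finset.univ \ J).val.map d) (freeCoeff Λ p.2) := by
      rw [Finset.sum_comm, Finset.sum_comm (s := Finset.HasAntidiagonal.antidiagonal m),
        Finset.powerset_univ]
      refine Finset.sum_congr rfl fun J _ => ?_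
      rw [← Finset.compl_eq_univ_sdiff]
      have hJ := Finset.card_add_card_compl J
      rw [Fintype.card_fin] at hJ
      exact sum_genus_eq_sum_antidiagonal Λ (by simp) (by simp) (by omega)
    have e3 : ∑ j, -1 / 4 * constantCoeff (dir (recDir Λ s⁻¹ (pw (y j ^ 2)⁻¹))
        (dirs ((({j} : Finset (Fin n))ᶜ).val.map d) (freeCoeff Λ m))) =
        -1 / 4 * ∑ j ∈ (Finset.univ : Finset (Fin n)), corr (recDir Λ s⁻¹ (d j) ::ₘ
          ((Finset.univ : Finset (Fin n)).erase j).val.map d) (freeCoeff Λ m) := by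
      rw [Finset.mul_sum]
      refine Finset.sum_congr rfl fun j _ => ?_
      rw [← corr_cons, Finset.compl_eq_univ_sdiff, Finset.sdiff_singleton_eq_erase, hd]
    rw [corr_cons_freeCoeff_succ, e1, e2, e3, ← hd]
    ring
  rw [hval] at h
  refine h.congr (Eventually.of_forall fun w => ?_)
  have t3 := sum_singleton_left (g := g) (fun l J => corr (pw (w ^ 2)⁻¹ ::ₘ Jᶜ.val.map d)
    (freeCoeff Λ (2 * l + (Jᶜ.card + 1) - 2))) (fun j => bergman w (y j))
  have t4 := sum_singleton_right (g := g) (fun l J => corr (pw (w ^ 2)⁻¹ ::ₘ J.val.map d)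
    (freeCoeff Λ (2 * (g - l) + (J.card + 1) - 2))) (fun j => bergman (-w) (y j))
  have t5 := sum_singleton_left (g := g) (fun l J => ∑ j : Fin n,
    if (l : ℕ) = 0 ∧ Jᶜ = {j} then bergman (-w) (y j) else 0) (fun j => bergman w (y j))
  simp only [Fin.val_last, Fin.val_zero, Nat.sub_zero, hcard] at t3 t4 t5
  rw [sum_add_mul_add, t3, t4, t5]
  have t6 : ∑ i, kern Λ s w * ((bergman w (y i) + bergman (-w) (y i)) * constantCoeff
      (dir (pw (w ^ 2)⁻¹) (dirs ((({i} : Finset (Fin n))ᶜ).val.map d) (freeCoeff Λ m)))) =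
      kern Λ s w * (∑ i, bergman w (y i) *
        corr (pw (w ^ 2)⁻¹ ::ₘ (({i} : Finset (Fin n))ᶜ).val.map d) (freeCoeff Λ m) +
      ∑ i, corr (pw (w ^ 2)⁻¹ ::ₘ (({i} : Finset (Fin n))ᶜ).val.map d) (freeCoeff Λ m) *
        bergman (-w) (y i)) := by
    rw [← Finset.sum_add_distrib, Finset.mul_sum]
    refine Finset.sum_congr rfl fun i _ => ?_
    rw [corr_cons]
    ring
  rw [t6]
  have hidx : g ≠ 0 → 2 * (g - 1) + (n + 2) - 2 = m := fun hg => by omega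
  by_cases hg : g = 0
  · simp only [if_pos hg, zero_add]
    ring
  · simp only [if_neg hg, hidx hg]
    ring

/-- The correlators of the curve in terms of the free energies. -/
theorem omega_gkzCurve (w₀ w₁ : ℂ) (g n : ℕ) (hn : 1 ≤ n) (z : Fin n → ℂ) (hz : ∀ i, z i ≠ 0) :
    (gkzCurve w₀ w₁).omega g n z =
      corr ((Finset.univ : Finset (Fin n)).val.map fun i => pw (z i ^ 2)⁻¹)
        (freeCoeff ((w₀ - w₁) ^ 2 / 4) (2 * g + n - 2)) + omegaBase g n z := by
  obtain ⟨N, hN⟩ : ∃ N, 2 * g + n = N := ⟨_, rfl⟩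
  induction N using Nat.strong_induction_on generalizing g n with
  | _ N ih =>
  obtain ⟨n, rfl⟩ := Nat.exists_eq_add_of_le' hn
  by_cases hst : g ≠ 0 ∨ 2 ≤ n
  swap
  · have hg : g = 0 := by omega
    subst hg
    have hn2 : n = 0 ∨ n = 1 := by omega
    rcases hn2 with rfl | rfl
    · rw [SpectralCurve.omega_zero_one, omegaBase_of_ne (by omega), freeCoeff_zero, map_zero,
        add_zero]
    · rw [SpectralCurve.omega_zero_two, freeCoeff_zero, map_zero, zero_add]
      rfl
  obtain ⟨m, hm⟩ : ∃ m, 2 * g + n = m + 2 := ⟨2 * g + n - 2, by omega⟩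
  have hy : ∀ j, Fin.tail z j ≠ 0 := fun j => hz j.succ
  have hs : z 0 ^ 2 ≠ 0 := pow_ne_zero 2 (hz 0)
  rw [SpectralCurve.omega_recursion _ _ _ hst]
  have hram : (gkzCurve w₀ w₁).ram = {0} := rfl
  have hconj : ∀ w, (gkzCurve w₀ w₁).conj 0 w = -w := fun w => rfl
  rw [hram, Finset.sum_singleton]
  have h := hasResidue_recursion ((w₀ - w₁) ^ 2 / 4) hs hm hy _ rfl
  rw [omegaBase_of_ne (by omega), add_zero, map_univ_succ,
    show 2 * g + (n + 1) - 2 = m + 1 by omega]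
  have htail : (fun i : Fin n => pw (z i.succ ^ 2)⁻¹) = fun j => pw (Fin.tail z j ^ 2)⁻¹ := rfl
  rw [htail]
  refine HasResidue.residue_eq (h.congr ?_)
  filter_upwards [kernel_gkzCurve w₀ w₁ (hz 0), self_mem_nhdsWithin] with w hw hw0
  have hw0 : w ≠ 0 := hw0
  rw [hw, hconj]
  congr 1
  have hJ : ∀ (l : ℕ) (J : Finset (Fin n)) (x : ℂ), x ≠ 0 → 2 * l + (J.card + 1) < N →
      (gkzCurve w₀ w₁).omega l (J.card + 1)
        (Fin.cons x fun i => Fin.tail z (J.orderEmbOfFin rfl i)) =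
      corr (pw (x ^ 2)⁻¹ ::ₘ J.val.map fun j => pw (Fin.tail z j ^ 2)⁻¹)
        (freeCoeff ((w₀ - w₁) ^ 2 / 4) (2 * l + (J.card + 1) - 2)) +
      ∑ j, if l = 0 ∧ J = {j} then bergman x (Fin.tail z j) else 0 := by
    intro l J x hx hlt
    rw [ih _ hlt l (J.card + 1) (by omega) _ _ rfl, map_univ_cons_orderEmbOfFin, omegaBase_cons]
    refine Fin.cases ?_ fun i => ?_
    · exact hx
    · exact hy _
  refine congrArg₂ (· + ·) ?_ ?_
  · split_ifs with hg
    · rfl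
    · rw [ih (2 * (g - 1) + (n + 2)) (by omega) (g - 1) (n + 2) (by omega) _ _ rfl, map_univ_succ,
        map_univ_succ]
      · simp only [Fin.cons_zero, Fin.cons_succ, neg_sq]
      · refine Fin.cases ?_ (Fin.cases ?_ fun i => ?_)
        · exact hw0
        · exact neg_ne_zero.mpr hw0
        · exact hy i
  · refine Finset.sum_congr rfl fun l _ => Finset.sum_congr rfl fun J _ => ?_
    have hJc := Finset.card_add_card_compl J
    rw [Fintype.card_fin] at hJc
    have hl := l.isLt
    have e01 : ∀ (l k : ℕ) (v : Fin (k + 1) → ℂ), l = 0 → k = 0 →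
        (gkzCurve w₀ w₁).omega l (k + 1) v = 0 := by
      rintro l k v rfl rfl
      exact SpectralCurve.omega_zero_one _ v
    have c01 : ∀ (l : ℕ) (K : Finset (Fin n)) (x : ℂ), l = 0 → K.card = 0 →
        corr (pw (x ^ 2)⁻¹ ::ₘ K.val.map fun j => pw (Fin.tail z j ^ 2)⁻¹)
        (freeCoeff ((w₀ - w₁) ^ 2 / 4) (2 * l + (K.card + 1) - 2)) +
      (∑ j, if l = 0 ∧ K = {j} then bergman x (Fin.tail z j) else 0) = 0 := by
      intro l K x h1 h2
      rw [h1, h2, freeCoeff_zero, map_zero, zero_add]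
      refine Finset.sum_eq_zero fun j _ => if_neg ?_
      rintro ⟨_, h⟩
      rw [h, Finset.card_singleton] at h2
      omega
    -- When one factor is `ω_1^{(0)}`, the other is the correlator being computed, to which the
    -- induction hypothesis does not apply. Both sides then have a vanishing factor.
    by_cases hA : g - (l : ℕ) = 0 ∧ J.card = 0
    · rw [e01 _ _ _ hA.1 hA.2, zero_mul, c01 _ _ _ hA.1 hA.2, zero_mul]
    by_cases hB : (l : ℕ) = 0 ∧ Jᶜ.card = 0
    · have := c01 _ _ (-w) hB.1 hB.2
      rw [neg_sq] at this
      rw [e01 _ _ _ hB.1 hB.2, mul_zero, this, mul_zero]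
    rw [hJ _ _ w hw0 (by omega), hJ _ _ (-w) (neg_ne_zero.mpr hw0) (by omega), neg_sq]

/-! ### Integration from infinity -/

/-- The integrals from `∞` to `z` of the one-forms `t ^ (-2 (k + 1)) dt`. -/
noncomputable def tau (z : ℂ) : ℕ → ℂ := fun k => -(z ^ (2 * k + 1))⁻¹ / (2 * k + 1)

theorem pw_ofReal_mul (z : ℂ) (k : ℕ) {t : ℝ} (ht : 1 < t) :
    pw (((t : ℂ) * z) ^ 2)⁻¹ k =
      ((t ^ (-(2 * k + 2) : ℝ) : ℝ) : ℂ) * (z ^ (2 * k + 2))⁻¹ := by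
  have h : (t : ℝ) ^ (-(2 * k + 2) : ℝ) = (t ^ (2 * k + 2))⁻¹ := by
    rw [Real.rpow_neg (by linarith)]
    congr 1
    exact_mod_cast Real.rpow_natCast t (2 * k + 2)
  rw [h, pw, inv_pow, ← pow_mul, mul_pow, mul_inv, show 2 * (k + 1) = 2 * k + 2 by ring]
  push_cast
  rfl

theorem neg_two_mul_add_two_lt (k : ℕ) : (-(2 * k + 2) : ℝ) < -1 := by
  have : (0 : ℝ) ≤ k := k.cast_nonneg
  linarith

theorem integrableOn_pw (z : ℂ) (k : ℕ) :
    IntegrableOn (fun t : ℝ => pw (((t : ℂ) * z) ^ 2)⁻¹ k) (Ioi 1) := by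
  refine IntegrableOn.congr_fun
    (((integrableOn_Ioi_rpow_of_lt (neg_two_mul_add_two_lt k) one_pos).ofReal (𝕜 := ℂ)).mul_const
      (z ^ (2 * k + 2))⁻¹) (fun t ht => (pw_ofReal_mul z k ht).symm) measurableSet_Ioi

theorem neg_mul_integral_pw {z : ℂ} (hz : z ≠ 0) (k : ℕ) :
    -z * ∫ t in Ioi (1 : ℝ), pw (((t : ℂ) * z) ^ 2)⁻¹ k = tau z k := by
  rw [setIntegral_congr_fun measurableSet_Ioi (fun t ht => pw_ofReal_mul z k ht),
    integral_mul_const, integral_complex_ofReal,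
    integral_Ioi_rpow_of_lt (neg_two_mul_add_two_lt k) one_pos, tau, Real.one_rpow]
  have h : (2 * (k : ℂ) + 1) ≠ 0 := by exact_mod_cast (by positivity : (2 * k + 1 : ℕ) ≠ 0)
  push_cast
  rw [show (-(2 * (k : ℂ) + 2) + 1) = -(2 * k + 1) by ring]
  field_simp
  ring

theorem setOf_one_lt_eq_pi (n : ℕ) :
    {t : Fin n → ℝ | ∀ i, 1 < t i} = univ.pi fun _ => Ioi (1 : ℝ) := by
  ext t
  simp

theorem integrableOn_prod_pw {n : ℕ} (z : Fin n → ℂ) (k : Fin n → ℕ) :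
    IntegrableOn (fun t : Fin n → ℝ => ∏ i, pw (((t i : ℂ) * z i) ^ 2)⁻¹ (k i))
      {t | ∀ i, 1 < t i} := by
  rw [setOf_one_lt_eq_pi, IntegrableOn, volume_pi, Measure.restrict_pi_pi]
  exact Integrable.fintype_prod (f := fun i (t : ℝ) => pw (((t : ℂ) * z i) ^ 2)⁻¹ (k i))
    fun i => integrableOn_pw (z i) (k i)

theorem prod_mul_integral_pw {n : ℕ} {z : Fin n → ℂ} (hz : ∀ i, z i ≠ 0) (k : Fin n → ℕ) :
    (∏ i, -z i) * ∫ t in {t : Fin n → ℝ | ∀ i, 1 < t i},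
      ∏ i, pw (((t i : ℂ) * z i) ^ 2)⁻¹ (k i) = ∏ i, tau (z i) (k i) := by
  rw [setOf_one_lt_eq_pi, volume_pi, Measure.restrict_pi_pi,
    integral_fintype_prod_eq_prod (fun i (t : ℝ) => pw (((t : ℂ) * z i) ^ 2)⁻¹ (k i)),
    ← Finset.prod_mul_distrib]
  exact Finset.prod_congr rfl fun i _ => neg_mul_integral_pw (hz i) (k i)

theorem measurableSet_setOf_one_lt (n : ℕ) : MeasurableSet {t : Fin n → ℝ | ∀ i, 1 < t i} := by
  rw [setOf_one_lt_eq_pi]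
  exact MeasurableSet.univ_pi fun _ => measurableSet_Ioi

theorem ofReal_mul_ne_zero {n : ℕ} {z : Fin n → ℂ} (hz : ∀ i, z i ≠ 0) {t : Fin n → ℝ}
    (ht : ∀ i, 1 < t i) (i : Fin n) : (t i : ℂ) * z i ≠ 0 :=
  mul_ne_zero (Complex.ofReal_ne_zero.mpr (by linarith [ht i])) (hz i)

theorem convergesFromInfinity_corr {n : ℕ} {f : (Fin n → ℂ) → ℂ} {φ : Poly}
    (hf : ∀ z, (∀ i, z i ≠ 0) →
      f z = corr ((Finset.univ : Finset (Fin n)).val.map fun i => pw (z i ^ 2)⁻¹) φ)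
    {z : Fin n → ℂ} (hz : ∀ i, z i ≠ 0) : ConvergesFromInfinity f z := by
  obtain ⟨N, hN⟩ := exists_pderiv_eq_zero φ
  obtain ⟨a, ha⟩ := exists_corr_eq_sum n hN
  refine IntegrableOn.congr_fun (f := fun t : Fin n → ℝ =>
    ∑ k : Fin n → Fin N, (∏ i, pw (((t i : ℂ) * z i) ^ 2)⁻¹ (k i)) * a k) ?_ (fun t ht => ?_)
    (measurableSet_setOf_one_lt n)
  · exact integrable_finsetSum _ fun k _ =>
      (integrableOn_prod_pw z fun i => (k i : ℕ)).mul_const _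
  · exact ((hf _ (ofReal_mul_ne_zero hz ht)).trans (ha _)).symm

/-- By multilinearity and Fubini the integral is taken in each direction separately, and there it
turns the components of `pw (z ^ 2)⁻¹` into those of `tau z`. -/
theorem multiIntegralFromInfinity_corr {n : ℕ} {f : (Fin n → ℂ) → ℂ} {φ : Poly}
    (hf : ∀ z, (∀ i, z i ≠ 0) →
      f z = corr ((Finset.univ : Finset (Fin n)).val.map fun i => pw (z i ^ 2)⁻¹) φ)
    {z : Fin n → ℂ} (hz : ∀ i, z i ≠ 0) :
    multiIntegralFromInfinity f z =
      corr ((Finset.univ : Finset (Fin n)).val.map fun i => tau (z i)) φ := by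
  obtain ⟨N, hN⟩ := exists_pderiv_eq_zero φ
  obtain ⟨a, ha⟩ := exists_corr_eq_sum n hN
  rw [multiIntegralFromInfinity, setIntegral_congr_fun (measurableSet_setOf_one_lt n)
    (fun t ht => (hf _ (ofReal_mul_ne_zero hz ht)).trans (ha _)), integral_finsetSum, ha,
    Finset.mul_sum]
  · refine Finset.sum_congr rfl fun k _ => ?_
    rw [integral_mul_const, ← mul_assoc, prod_mul_integral_pw hz fun i => (k i : ℕ)]
  · exact fun k _ => (integrableOn_prod_pw z fun i => (k i : ℕ)).mul_const _

theorem omega_gkzCurve_of_stable (w₀ w₁ : ℂ) {g n : ℕ} (hn : 1 ≤ n) (h : 2 < 2 * g + n)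
    (z : Fin n → ℂ) (hz : ∀ i, z i ≠ 0) :
    (gkzCurve w₀ w₁).omega g n z =
      corr ((Finset.univ : Finset (Fin n)).val.map fun i => pw (z i ^ 2)⁻¹)
        (freeCoeff ((w₀ - w₁) ^ 2 / 4) (2 * g + n - 2)) := by
  rw [omega_gkzCurve w₀ w₁ g n hn z hz, omegaBase_of_ne (by omega), add_zero]

theorem freeEnergy_gkzCurve (w₀ w₁ : ℂ) (F₁ : ℂ → ℂ) (F₂ : ℂ → ℂ → ℂ) {g n : ℕ} (hn : 1 ≤ n)
    (h : 2 < 2 * g + n) {z : ℂ} (hz : z ≠ 0) :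
    1 / (n.factorial : ℂ) * (gkzCurve w₀ w₁).freeEnergy F₁ F₂ g n (fun _ => z) =
      (lineRestrict (tau z) (freeCoeff ((w₀ - w₁) ^ 2 / 4) (2 * g + n - 2))).coeff n := by
  have h1 : (gkzCurve w₀ w₁).freeEnergy F₁ F₂ g n (fun _ => z) =
      multiIntegralFromInfinity ((gkzCurve w₀ w₁).omega g n) fun _ => z := by
    unfold SpectralCurve.freeEnergy
    split
    · omega
    · omega
    · rfl
  have h2 : (Finset.univ : Finset (Fin n)).val.map (fun _ => tau z) =
      Multiset.replicate n (tau z) := by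
    rw [Multiset.map_const']
    simp
  rw [h1, multiIntegralFromInfinity_corr (fun z hz => omega_gkzCurve_of_stable w₀ w₁ hn h z hz)
    (fun _ => hz), h2, corr_replicate, ← mul_assoc, one_div,
    inv_mul_cancel₀ (Nat.cast_ne_zero.mpr n.factorial_ne_zero), one_mul]

theorem wkbF_zero (C : SpectralCurve) (F₁ : ℂ → ℂ) (F₂ : ℂ → ℂ → ℂ) (z : ℂ) :
    C.wkbF F₁ F₂ 0 z = F₁ z := by
  have h : (Finset.range (0 + 1) ×ˢ Finset.Icc 1 (0 + 1)).filter
      (fun p : ℕ × ℕ => 2 * p.1 + p.2 = 0 + 1) = {(0, 1)} := by decide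
  rw [SpectralCurve.wkbF, h, Finset.sum_singleton]
  simp [SpectralCurve.freeEnergy]

theorem wkbF_one (C : SpectralCurve) (F₁ : ℂ → ℂ) (F₂ : ℂ → ℂ → ℂ) (z : ℂ) :
    C.wkbF F₁ F₂ 1 z = 1 / 2 * F₂ z z := by
  have h : (Finset.range (1 + 1) ×ˢ Finset.Icc 1 (1 + 1)).filter
      (fun p : ℕ × ℕ => 2 * p.1 + p.2 = 1 + 1) = {(0, 2)} := by decide
  rw [SpectralCurve.wkbF, h, Finset.sum_singleton]
  simp [SpectralCurve.freeEnergy]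

/-- The pairs with `2g + n = m + 3` correspond to the homogeneous components of `freeCoeff (m + 1)`
of degree `n`. All other components vanish, by parity or because there is no constant term, so the
sum is the full value at `tau z`. -/
theorem wkbF_add_two (w₀ w₁ : ℂ) (F₁ : ℂ → ℂ) (F₂ : ℂ → ℂ → ℂ) (m : ℕ) {z : ℂ} (hz : z ≠ 0) :
    (gkzCurve w₀ w₁).wkbF F₁ F₂ (m + 2) z =
      eval (tau z) (freeCoeff ((w₀ - w₁) ^ 2 / 4) (m + 1)) := by
  rw [eval_freeCoeff_eq_sum, SpectralCurve.wkbF]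
  refine Finset.sum_of_injOn (fun p => p.2) ?_ ?_ ?_ ?_
  · rintro ⟨g, n⟩ hp ⟨g', n'⟩ hp' (h : n = n')
    simp only [Finset.coe_filter, mem_ofPred_eq] at hp hp'
    ext <;> simp <;> omega
  · rintro ⟨g, n⟩ hp
    simp only [Finset.coe_filter, mem_ofPred_eq, Finset.mem_product, Finset.mem_range,
      Finset.mem_Icc] at hp
    simp only [Finset.coe_range, mem_Iio]
    omega
  · intro k hk hk'
    by_cases h0 : k = 0
    · rw [h0, coeff_zero_lineRestrict, constantCoeff_freeCoeff]
    · refine coeff_lineRestrict_freeCoeff_eq_zero _ _ _ _ fun g hg => hk' ?_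
      refine ⟨(g, k), ?_, rfl⟩
      simp only [Finset.coe_filter, mem_ofPred_eq, Finset.mem_product, Finset.mem_range,
        Finset.mem_Icc]
      omega
  · rintro ⟨g, n⟩ hp
    simp only [Finset.mem_filter, Finset.mem_product, Finset.mem_range, Finset.mem_Icc] at hp
    rw [freeEnergy_gkzCurve w₀ w₁ F₁ F₂ (by omega) (by omega) hz,
      show 2 * g + n - 2 = m + 1 by omega]

/-! ### The regularized two-point function -/

theorem hatOmega₂_gkzCurve (w₀ w₁ : ℂ) {a b : ℂ} (h : a ^ 2 ≠ b ^ 2) :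
    (gkzCurve w₀ w₁).hatOmega₂ a b = 1 / (a + b) ^ 2 := by
  have hx : ∀ z, deriv (gkzCurve w₀ w₁).x z = 2 * z := fun z => by
    have : (gkzCurve w₀ w₁).x = fun z => z ^ 2 - (w₀ - w₁) ^ 2 / 4 := rfl
    rw [this]
    simp
  have h1 : a - b ≠ 0 := fun h0 => h (by rw [sub_eq_zero.mp h0])
  have h2 : a + b ≠ 0 := fun h0 => h (by rw [eq_neg_of_add_eq_zero_left h0, neg_sq])
  have h3 : (gkzCurve w₀ w₁).x a - (gkzCurve w₀ w₁).x b = (a - b) * (a + b) := by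
    simp only [gkzCurve]
    ring
  rw [SpectralCurve.hatOmega₂, hx, hx, h3, bergman]
  field_simp
  ring

theorem hatOmega₂_comm (C : SpectralCurve) (a b : ℂ) : C.hatOmega₂ a b = C.hatOmega₂ b a := by
  rw [SpectralCurve.hatOmega₂, SpectralCurve.hatOmega₂, bergman, bergman, ← neg_sq (a - b),
    ← neg_sq (C.x a - C.x b), neg_sub, neg_sub, mul_comm (deriv C.x a)]

/-- The points `p` with `Re (p / z) > 0` form an open half-plane not containing `0` and stable under
addition and positive scaling. Near the diagonal point `(z, z)` both variables lie in it. -/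
theorem add_ofReal_mul_ne_zero {z a b : ℂ} (ha : 0 < (a / z).re) (hb : 0 < (b / z).re) {t : ℝ}
    (ht : 0 ≤ t) : a + t * b ≠ 0 := by
  intro h
  have h1 : (a / z + t * (b / z)).re = 0 := by
    rw [show a / z + t * (b / z) = (a + t * b) / z by ring, h]
    simp
  rw [Complex.add_re, Complex.re_ofReal_mul] at h1
  nlinarith [mul_nonneg ht hb.le]

theorem integrableOn_one_div_add_sq {z a b : ℂ} (hz : z ≠ 0) (ha : 0 < (a / z).re)
    (hb : 0 < (b / z).re) :
    IntegrableOn (fun t : ℝ => 1 / (a + t * b) ^ 2) (Ioi 1) := by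
  have hc : 0 < ‖z‖ * (b / z).re := mul_pos (norm_pos_iff.mpr hz) hb
  refine Integrable.mono' (g := fun t : ℝ => t ^ (-2 : ℝ) * (‖z‖ * (b / z).re) ^ (-2 : ℤ))
    ((integrableOn_Ioi_rpow_of_lt (by norm_num) one_pos).mul_const _) ?_ ?_
  · refine ContinuousOn.aestronglyMeasurable (fun t ht => ContinuousAt.continuousWithinAt ?_)
      measurableSet_Ioi
    have ht : (1 : ℝ) < t := ht
    have h0 : (a + t * b) ^ 2 ≠ 0 := pow_ne_zero 2 (add_ofReal_mul_ne_zero ha hb (by linarith))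
    fun_prop (disch := exact h0)
  · filter_upwards [ae_restrict_mem measurableSet_Ioi] with t ht
    have ht : (1 : ℝ) < t := ht
    have h1 : t * (‖z‖ * (b / z).re) ≤ ‖a + t * b‖ := by
      have h2 : (a / z + t * (b / z)).re ≤ ‖(a + t * b) / z‖ := by
        rw [show a / z + t * (b / z) = (a + t * b) / z by ring]
        exact Complex.re_le_norm _
      rw [Complex.add_re, Complex.re_ofReal_mul, norm_div,
        le_div_iff₀ (norm_pos_iff.mpr hz)] at h2
      nlinarith [mul_pos ha (norm_pos_iff.mpr hz)]
    have h3 : 0 < t * (‖z‖ * (b / z).re) := mul_pos (by linarith) hc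
    rw [norm_div, norm_one, norm_pow, Real.rpow_neg (by linarith), Real.rpow_two, zpow_neg,
      one_div, ← mul_inv]
    rw [show t ^ 2 * (‖z‖ * (b / z).re) ^ (2 : ℤ) = (t * (‖z‖ * (b / z).re)) ^ 2 by
      rw [mul_pow]; rfl]
    gcongr

/-- The simplified formula fails only where the ray meets the diagonal `t b = a`, since division by
zero then gives a spurious value. At most one `t` is affected, a null set. -/
theorem ae_hatOmega₂_eq (w₀ w₁ : ℂ) {z a b : ℂ} (ha : 0 < (a / z).re) (hb : 0 < (b / z).re) :
    (fun t : ℝ => 1 / (a + t * b) ^ 2) =ᵐ[volume.restrict (Ioi 1)]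
      fun t : ℝ => (gkzCurve w₀ w₁).hatOmega₂ a (t * b) := by
  have hb0 : b ≠ 0 := by
    rintro rfl
    simp at hb
  filter_upwards [ae_restrict_mem measurableSet_Ioi,
    ae_restrict_of_ae ((countable_singleton (a / b).re).ae_notMem volume)] with t ht ht'
  have ht : (1 : ℝ) < t := ht
  rw [hatOmega₂_gkzCurve]
  intro h
  rcases sq_eq_sq_iff_eq_or_eq_neg.mp h with h | h
  · apply ht'
    rw [h, mul_div_cancel_right₀ _ hb0]
    simp
  · exact add_ofReal_mul_ne_zero ha hb (t := t) (by linarith) (by rw [h]; ring)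

theorem integrableOn_hatOmega₂ (w₀ w₁ : ℂ) {z a b : ℂ} (hz : z ≠ 0) (ha : 0 < (a / z).re)
    (hb : 0 < (b / z).re) :
    IntegrableOn (fun t : ℝ => (gkzCurve w₀ w₁).hatOmega₂ a (t * b)) (Ioi 1) :=
  (integrableOn_one_div_add_sq hz ha hb).congr (ae_hatOmega₂_eq w₀ w₁ ha hb)

/-- The integrand has the primitive `-1 / (b (a + t b))`, which tends to `0` at infinity. -/
theorem integralFromInfinity_hatOmega₂ (w₀ w₁ : ℂ) {z a b : ℂ} (hz : z ≠ 0)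
    (ha : 0 < (a / z).re) (hb : 0 < (b / z).re) :
    integralFromInfinity (fun t => (gkzCurve w₀ w₁).hatOmega₂ a t) b = -1 / (a + b) := by
  have hb0 : b ≠ 0 := by
    rintro rfl
    simp at hb
  have hne : ∀ t : ℝ, 0 ≤ t → a + t * b ≠ 0 := fun t ht => add_ofReal_mul_ne_zero ha hb ht
  have hd : ∀ t ∈ Ici (1 : ℝ), HasDerivAt (fun t : ℝ => -(b * (a + t * b))⁻¹)
      (1 / (a + t * b) ^ 2) t := by
    intro t ht
    have ht : (1 : ℝ) ≤ t := ht
    have h1 : HasDerivAt (fun t : ℝ => b * (a + (t : ℂ) * b)) (b * (1 * b)) t :=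
      (((Complex.ofRealCLM.hasDerivAt (x := t)).mul_const b).const_add a).const_mul b
    have h0 := hne t (by linarith)
    refine (h1.inv (mul_ne_zero hb0 h0)).neg.congr_deriv ?_
    field_simp
  have hlim : Tendsto (fun t : ℝ => -(b * (a + t * b))⁻¹) atTop (𝓝 0) := by
    rw [← neg_zero]
    refine Tendsto.neg (tendsto_inv₀_cobounded.comp ?_)
    exact (tendsto_mul_left_cobounded hb0).comp ((tendsto_const_add_cobounded a).comp
      ((tendsto_mul_right_cobounded hb0).comp (RCLike.tendsto_ofReal_atTop_cobounded ℂ)))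
  have h := integral_Ioi_of_hasDerivAt_of_tendsto' hd (integrableOn_one_div_add_sq hz ha hb) hlim
  rw [integralFromInfinity, ← integral_congr_ae (ae_hatOmega₂_eq w₀ w₁ ha hb), h]
  have h1 := hne 1 zero_le_one
  rw [Complex.ofReal_one, one_mul] at h1
  simp only [Complex.ofReal_one, one_mul]
  field_simp
  ring

theorem eventually_re_div_pos {z : ℂ} (hz : z ≠ 0) :
    ∀ᶠ p : ℂ × ℂ in 𝓝 (z, z), 0 < (p.1 / z).re ∧ 0 < (p.2 / z).re := by
  have h : (0 : ℝ) < (z / z).re := by rw [div_self hz]; simp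
  have h1 : Continuous fun p : ℂ × ℂ => (p.1 / z).re := by fun_prop
  have h2 : Continuous fun p : ℂ × ℂ => (p.2 / z).re := by fun_prop
  exact (h1.continuousAt.eventually (lt_mem_nhds h)).and (h2.continuousAt.eventually
    (lt_mem_nhds h))

/-! ### The constraints along the curve of times `tau z` -/

theorem hasDerivAt_tau {z : ℂ} (hz : z ≠ 0) (k : ℕ) :
    HasDerivAt (fun z => tau z k) (pw (z ^ 2)⁻¹ k) z := by
  have h : (2 * (k : ℂ) + 1) ≠ 0 := by exact_mod_cast (by positivity : (2 * k + 1 : ℕ) ≠ 0)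
  refine (((hasDerivAt_pow (2 * k + 1) z).inv (pow_ne_zero _ hz)).neg.div_const
    (2 * (k : ℂ) + 1)).congr_deriv ?_
  rw [pw, inv_pow, ← pow_mul]
  push_cast
  field_simp
  ring

theorem hasDerivAt_pw_inv_sq {z : ℂ} (hz : z ≠ 0) (k : ℕ) :
    HasDerivAt (fun z => pw (z ^ 2)⁻¹ k) (-(2 * k + 2) * (z ^ (2 * k + 3))⁻¹) z := by
  have h : (fun z : ℂ => pw (z ^ 2)⁻¹ k) = fun z => (z ^ (2 * k + 2))⁻¹ := by
    funext z
    rw [pw, inv_pow, ← pow_mul, show 2 * (k + 1) = 2 * k + 2 by ring]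
  rw [h]
  refine ((hasDerivAt_pow (2 * k + 2) z).inv (pow_ne_zero _ hz)).congr_deriv ?_
  push_cast
  field_simp
  ring

theorem hasDerivAt_eval_tau {z : ℂ} (hz : z ≠ 0) (φ : Poly) :
    HasDerivAt (fun z => eval (tau z) φ) (eval (tau z) (dir (pw (z ^ 2)⁻¹) φ)) z := by
  induction φ using MvPolynomial.induction_on with
  | C a =>
    simp only [eval_C, derivation_C, map_zero]
    exact hasDerivAt_const z a
  | add p q hp hq =>
    simp only [map_add]
    exact hp.add hq
  | mul_X p a hp =>
    simp only [map_mul, eval_X, Derivation.leibniz, map_add, smul_eq_mul, dir_X, eval_C]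
    refine (hp.mul (hasDerivAt_tau hz a)).congr_deriv ?_
    ring

theorem eval_shiftDer_zero {z : ℂ} (hz : z ≠ 0) (φ : Poly) :
    eval (tau z) (shiftDer 0 φ) = -2 * z⁻¹ * eval (tau z) (dir (pw (z ^ 2)⁻¹) φ) := by
  obtain ⟨N, hN⟩ := exists_pderiv_eq_zero φ
  rw [derivation_eq_sum_range _ hN, derivation_eq_sum_range (dir _) hN, map_sum, map_sum,
    Finset.mul_sum]
  refine Finset.sum_congr rfl fun a _ => ?_
  rw [map_mul, map_mul, shiftDer_X_of_le (a + 1) (by omega), dir_X, map_mul, eval_C, eval_X, eval_C,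
    tau, pw, inv_pow, ← pow_mul]
  have h : (2 * (a : ℂ) + 3) ≠ 0 := by exact_mod_cast (by positivity : (2 * a + 3 : ℕ) ≠ 0)
  push_cast
  rw [show (2 * ((a : ℂ) + 1) + 1) = 2 * a + 3 by ring]
  field_simp
  ring

/-- The factor `2k + 1` cancels the denominator of `tau`, so all `a + 2` summands coincide. -/
theorem eval_modeDer_X {z : ℂ} (hz : z ≠ 0) (a : ℕ) :
    eval (tau z) (modeDer (z ^ 2)⁻¹ (X a)) = -2 * (a + 2) * (z ^ (2 * a + 3))⁻¹ := by
  rw [modeDer_X, map_sum]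
  have h : ∀ k ∈ Finset.range (a + 2),
      eval (tau z) (C (2 * (2 * (k : ℂ) + 1) * (z ^ 2)⁻¹ ^ (a + 1 - k)) * X k) =
        -2 * (z ^ (2 * a + 3))⁻¹ := by
    intro k hk
    obtain ⟨l, hl⟩ := Nat.exists_eq_add_of_le (Nat.lt_succ_iff.mp (Finset.mem_range.mp hk))
    have h0 : (2 * (k : ℂ) + 1) ≠ 0 := by exact_mod_cast (by positivity : (2 * k + 1 : ℕ) ≠ 0)
    rw [map_mul, eval_C, eval_X, tau, hl, Nat.add_sub_cancel_left, inv_pow, ← pow_mul,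
      show 2 * a + 3 = 2 * l + (2 * k + 1) by omega, pow_add]
    field_simp
    ring
  rw [Finset.sum_congr rfl h, Finset.sum_const, Finset.card_range, nsmul_eq_mul]
  push_cast
  ring

/-- Besides the second directional derivative, `d/dz` also hits the coefficients `z^{-2i-2}`. By
`-(2i + 2) = -2 (i + 2) + 2` this contribution is `modeDer` plus `2 z⁻¹` times the first derivative:
the first order part of the constraint is what turns it into an equation in `z` alone. -/
theorem hasDerivAt_eval_tau_dir {z : ℂ} (hz : z ≠ 0) (φ : Poly) :
    HasDerivAt (fun z => eval (tau z) (dir (pw (z ^ 2)⁻¹) φ))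
      (eval (tau z) (dir (pw (z ^ 2)⁻¹) (dir (pw (z ^ 2)⁻¹) φ)) +
        eval (tau z) (modeDer (z ^ 2)⁻¹ φ) +
        2 * z⁻¹ * eval (tau z) (dir (pw (z ^ 2)⁻¹) φ)) z := by
  obtain ⟨N, hN⟩ := exists_pderiv_eq_zero φ
  have h1 : ∀ u, dir (pw u) φ = ∑ i ∈ Finset.range N, C (pw u i) * pderiv i φ := fun u => by
    rw [derivation_eq_sum_range _ hN]
    exact Finset.sum_congr rfl fun i _ => by rw [dir_X, mul_comm]
  have h2 : (fun z => eval (tau z) (dir (pw (z ^ 2)⁻¹) φ)) = fun z =>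
      ∑ i ∈ Finset.range N, pw (z ^ 2)⁻¹ i * eval (tau z) (pderiv i φ) := by
    funext z
    rw [h1, map_sum]
    exact Finset.sum_congr rfl fun i _ => by rw [map_mul, eval_C]
  have h3 : eval (tau z) (dir (pw (z ^ 2)⁻¹) (dir (pw (z ^ 2)⁻¹) φ)) =
      ∑ i ∈ Finset.range N, pw (z ^ 2)⁻¹ i *
        eval (tau z) (dir (pw (z ^ 2)⁻¹) (pderiv i φ)) := by
    rw [h1, map_sum, map_sum]
    exact Finset.sum_congr rfl fun i _ => by rw [derivation_const_mul, map_mul, eval_C]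
  have h4 := congrFun h2 z
  have h5 : eval (tau z) (modeDer (z ^ 2)⁻¹ φ) = ∑ i ∈ Finset.range N,
      eval (tau z) (pderiv i φ) * (-2 * (i + 2) * (z ^ (2 * i + 3))⁻¹) := by
    rw [derivation_eq_sum_range _ hN, map_sum]
    exact Finset.sum_congr rfl fun i _ => by rw [map_mul, eval_modeDer_X hz]
  have h6 := HasDerivAt.fun_sum (u := Finset.range N) fun i _ =>
    (hasDerivAt_pw_inv_sq hz i).mul (hasDerivAt_eval_tau hz (pderiv i φ))
  beta_reduce at h4
  rw [h2]
  refine h6.congr_deriv ?_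
  rw [h3, h5, h4, Finset.mul_sum, ← Finset.sum_add_distrib, ← Finset.sum_add_distrib]
  refine Finset.sum_congr rfl fun i _ => ?_
  rw [pw, inv_pow, ← pow_mul]
  field_simp
  ring

/-- The restriction of the partition function to the divisor `[z] - [∞]`. -/
noncomputable def specialCoeff (Λ : ℂ) (n : ℕ) (z : ℂ) : ℂ := eval (tau z) (partitionCoeff Λ n)

/-- The derivative of `specialCoeff`. -/
noncomputable def specialDeriv (Λ : ℂ) (n : ℕ) (z : ℂ) : ℂ :=
  eval (tau z) (dir (pw (z ^ 2)⁻¹) (partitionCoeff Λ n))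

/-- The operator `x d/dx` on the amplitude `z^(-1/2) specialCoeff`, divided by `z^(-1/2)`. -/
noncomputable def specialTheta (Λ : ℂ) (n : ℕ) (z : ℂ) : ℂ :=
  (z ^ 2 - Λ) * (-specialCoeff Λ n z / (4 * z ^ 2) + specialDeriv Λ n z / (2 * z))

theorem specialCoeff_zero (Λ z : ℂ) : specialCoeff Λ 0 z = 1 := by
  rw [specialCoeff, partitionCoeff, map_one]

theorem specialDeriv_zero (Λ z : ℂ) : specialDeriv Λ 0 z = 0 := by
  rw [specialDeriv, partitionCoeff, Derivation.map_one_eq_zero, map_zero]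

theorem hasDerivAt_specialCoeff (Λ : ℂ) (n : ℕ) {z : ℂ} (hz : z ≠ 0) :
    HasDerivAt (specialCoeff Λ n) (specialDeriv Λ n z) z := hasDerivAt_eval_tau hz _

theorem dir_pw_partitionCoeff_succ (Λ : ℂ) (n : ℕ) (u : ℂ) :
    dir (pw u) (partitionCoeff Λ (n + 1)) = C (-1 / 4) * (C (1 - Λ * u) *
      (dir (pw u) (dir (pw u) (partitionCoeff Λ n)) + modeDer u (partitionCoeff Λ n) +
        (C (u / 4) + X 0 ^ 2) * partitionCoeff Λ n) -
          shiftDer 0 (partitionCoeff Λ n) - X 0 ^ 2 * partitionCoeff Λ n) :=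
  dir_pw_eq_of_recOp (φ := partitionCoeff Λ (n + 1)) (φ' := partitionCoeff Λ n)
    (pderiv_partitionCoeff_succ Λ n) u

/-- In terms of `x = z² - Λ`, with `dx = 2z dz`, this says `(x d/dx)² (z^{-1/2} Z_n) = -x z^{-1/2}
Z_{n+1}'`, the prime being `d/dz`: the Virasoro constraints restricted to the times `tau z`. -/
theorem hasDerivAt_specialTheta (Λ : ℂ) (n : ℕ) {z : ℂ} (hz : z ≠ 0) :
    HasDerivAt (specialTheta Λ n)
      (2 * z * (specialTheta Λ n z / (4 * z ^ 2) - specialDeriv Λ (n + 1) z)) z := by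
  -- `W` is the sum of the second directional derivative and the `modeDer` term. It appears both in
  -- the derivative of `specialDeriv` and in the recursion, and eliminating it closes the equation.
  obtain ⟨W, hW, hrec⟩ : ∃ W, HasDerivAt (specialDeriv Λ n) (W + 2 * z⁻¹ * specialDeriv Λ n z) z ∧
      specialDeriv Λ (n + 1) z = -1 / 4 * ((1 - Λ * (z ^ 2)⁻¹) *
        (W + ((z ^ 2)⁻¹ / 4 + z⁻¹ ^ 2) * specialCoeff Λ n z) +
          2 * z⁻¹ * specialDeriv Λ n z - z⁻¹ ^ 2 * specialCoeff Λ n z) := by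
    have hf : specialDeriv Λ n = fun z => eval (tau z) (dir (pw (z ^ 2)⁻¹) (partitionCoeff Λ n)) :=
      rfl
    have h0 : tau z 0 = -z⁻¹ := by simp [tau]
    have h1 := congrArg (fun φ => eval (tau z) φ) (dir_pw_partitionCoeff_succ Λ n (z ^ 2)⁻¹)
    beta_reduce at h1
    have h2 := hasDerivAt_eval_tau_dir hz (partitionCoeff Λ n)
    simp only [map_mul, map_add, map_sub, map_pow, eval_C, eval_X, eval_shiftDer_zero hz, h0] at h1
    refine ⟨eval (tau z) (dir (pw (z ^ 2)⁻¹) (dir (pw (z ^ 2)⁻¹) (partitionCoeff Λ n))) +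
      eval (tau z) (modeDer (z ^ 2)⁻¹ (partitionCoeff Λ n)), ?_, ?_⟩
    · rw [hf]
      exact h2
    · rw [specialDeriv, h1, specialCoeff, specialDeriv]
      ring
  have hsq : HasDerivAt (fun z : ℂ => z ^ 2 - Λ) (2 * z) z := by
    simpa using (hasDerivAt_pow 2 z).sub_const Λ
  have h4 : HasDerivAt (fun z : ℂ => 4 * z ^ 2) (4 * (2 * z)) z := by
    simpa using (hasDerivAt_pow 2 z).const_mul 4
  have h2 : HasDerivAt (fun z : ℂ => 2 * z) (2 * 1) z := (hasDerivAt_id z).const_mul 2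
  have hz4 : 4 * z ^ 2 ≠ 0 := by simp [hz]
  have hz2 : 2 * z ≠ 0 := by simp [hz]
  have hd := hsq.fun_mul (((hasDerivAt_specialCoeff Λ n hz).fun_neg.fun_div h4 hz4).fun_add
    (hW.fun_div h2 hz2))
  have hf : specialTheta Λ n = fun z => (z ^ 2 - Λ) *
      (-specialCoeff Λ n z / (4 * z ^ 2) + specialDeriv Λ n z / (2 * z)) := rfl
  rw [hf]
  refine hd.congr_deriv ?_
  rw [hrec]
  beta_reduce
  generalize specialCoeff Λ n z = a
  generalize specialDeriv Λ n z = b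
  field_simp
  ring

/-! ### The wave function on a local branch and the GKZ equation -/

section LocalBranch

variable {w₀ w₁ : ℂ} {V : Set ℂ} {s : ℂ → ℂ} {F₁ : ℂ → ℂ} {F₂ : ℂ → ℂ → ℂ}

theorem branch_ne_zero (h : (gkzCurve w₀ w₁).IsLocalBranch V s F₁ F₂) {x : ℂ} (hx : x ∈ V) :
    s x ≠ 0 := fun h0 => h.not_ram x hx (by rw [h0]; simp [gkzCurve])

theorem branch_sq (h : (gkzCurve w₀ w₁).IsLocalBranch V s F₁ F₂) {x : ℂ} (hx : x ∈ V) :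
    s x ^ 2 - (w₀ - w₁) ^ 2 / 4 = x := h.x_s x hx

theorem hasDerivAt_branch (h : (gkzCurve w₀ w₁).IsLocalBranch V s F₁ F₂) {x : ℂ} (hx : x ∈ V) :
    HasDerivAt s (2 * s x)⁻¹ x := by
  have hsq : HasDerivAt (fun z : ℂ => z ^ 2 - (w₀ - w₁) ^ 2 / 4) (2 * s x) (s x) := by
    simpa using (hasDerivAt_pow 2 (s x)).sub_const ((w₀ - w₁) ^ 2 / 4)
  exact HasDerivAt.of_local_left_inverse (h.continuousOn.continuousAt (h.isOpen.mem_nhds hx)) hsq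
    (mul_ne_zero two_ne_zero (branch_ne_zero h hx))
    (mem_of_superset (h.isOpen.mem_nhds hx) fun y hy => branch_sq h hy)

/-- Both partial derivatives of `F₂` are `-1 / (a + b)` near the diagonal. Being continuous, they
give total differentiability, and along the diagonal they add up to `2 · (-1 / (2z))`. Hence
`e^{F_1}` has the logarithmic derivative of `z^{-1/2}`. -/
theorem hasDerivAt_diag (h : (gkzCurve w₀ w₁).IsLocalBranch V s F₁ F₂) {x : ℂ} (hx : x ∈ V) :
    HasDerivAt (fun z => F₂ z z) (-1 / s x) (s x) := by
  have hz := branch_ne_zero h hx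
  have hev := eventually_re_div_pos hz
  let f' : ℂ → ℂ → ℂ →L[ℂ] ℂ := fun a b => ContinuousLinearMap.toSpanSingleton ℂ (-1 / (a + b))
  have h1 : ∀ᶠ p in 𝓝 (s x, s x), HasFDerivAt (F₂ · p.2) (↿f' p) p.1 := by
    filter_upwards [hev, h.hasDerivAt_F₂_left x hx] with p hp hd
    rw [integralFromInfinity_hatOmega₂ w₀ w₁ hz hp.1 hp.2] at hd
    exact hd.hasFDerivAt
  have h2 : ∀ᶠ p in 𝓝 (s x, s x), HasFDerivAt (F₂ p.1 ·) (↿f' p) p.2 := by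
    filter_upwards [hev, h.hasDerivAt_F₂_right x hx] with p hp hd
    simp only [hatOmega₂_comm _ _ p.2] at hd
    rw [integralFromInfinity_hatOmega₂ w₀ w₁ hz hp.2 hp.1, add_comm p.2] at hd
    exact hd.hasFDerivAt
  have hne : s x + s x ≠ 0 := by
    rw [← two_mul]
    exact mul_ne_zero two_ne_zero hz
  have hc : ContinuousAt ↿f' (s x, s x) := by
    have hc0 : ContinuousAt (fun p : ℂ × ℂ => -1 / (p.1 + p.2)) (s x, s x) := by
      fun_prop (disch := exact hne)
    exact (ContinuousLinearMap.toSpanSingletonCLE (𝕜 := ℂ) (E := ℂ)).continuous.continuousAt.comp hc0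
  have hF := (hasStrictFDerivAt_uncurry_coprod h1 h2 hc hc).hasFDerivAt
  have hd : HasDerivAt (fun z : ℂ => (z, z)) ((1 : ℂ), (1 : ℂ)) (s x) :=
    (hasDerivAt_id (s x)).prodMk (hasDerivAt_id (s x))
  refine (HasFDerivAt.comp_hasDerivAt (f := fun z => (z, z)) (s x) hF hd).congr_deriv ?_
  simp only [f', Function.HasUncurry.uncurry, ContinuousLinearMap.coprod_apply, id,
    ContinuousLinearMap.toSpanSingleton_apply, one_smul]
  field_simp
  ring

/-- The factor `e^{F_1}` of the amplitude. -/
noncomputable def prefactor (s : ℂ → ℂ) (F₂ : ℂ → ℂ → ℂ) (x : ℂ) : ℂ :=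
  Complex.exp (1 / 2 * F₂ (s x) (s x))

/-- The logarithmic derivative of the prefactor in `x` is `-1 / (2z) · dz/dx = -1 / (4z²)`, since
`dz/dx = 1 / (2z)`. -/
theorem hasDerivAt_prefactor_mul (h : (gkzCurve w₀ w₁).IsLocalBranch V s F₁ F₂) {x : ℂ}
    (hx : x ∈ V) {f : ℂ → ℂ} {f' : ℂ} (hf : HasDerivAt f f' (s x)) :
    HasDerivAt (fun x => prefactor s F₂ x * f (s x))
      (prefactor s F₂ x * (-f (s x) / (4 * s x ^ 2) + f' / (2 * s x))) x := by
  have hz := branch_ne_zero h hx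
  have hs := hasDerivAt_branch h hx
  have h1 : HasDerivAt (fun x => F₂ (s x) (s x)) (-1 / s x * (2 * s x)⁻¹) x :=
    HasDerivAt.comp x (h₂ := fun z => F₂ z z) (hasDerivAt_diag h hx) hs
  have h2 : HasDerivAt (prefactor s F₂)
      (prefactor s F₂ x * (1 / 2 * (-1 / s x * (2 * s x)⁻¹))) x := (h1.const_mul (1 / 2)).cexp
  refine (h2.mul (HasDerivAt.comp x hf hs)).congr_deriv ?_
  simp only [Function.comp]
  field_simp
  ring

/-- Evaluation at `tau z` is a ring homomorphism, so it commutes with the formal exponential and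
carries `exp (log Z) = Z` over to the amplitude. -/
theorem coeff_amp_waveFunction (h : (gkzCurve w₀ w₁).IsLocalBranch V s F₁ F₂) {x : ℂ} (hx : x ∈ V)
    (k : ℕ) : PowerSeries.coeff k (((gkzCurve w₀ w₁).waveFunction s F₁ F₂).amp x) =
      prefactor s F₂ x * specialCoeff ((w₀ - w₁) ^ 2 / 4) k (s x) := by
  have hz := branch_ne_zero h hx
  have h1 : (PowerSeries.mk fun k => if k = 0 then 0 else
      (gkzCurve w₀ w₁).wkbF F₁ F₂ (k + 1) (s x)) =
      PowerSeries.map (eval (tau (s x))) (freeSeries ((w₀ - w₁) ^ 2 / 4)) := by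
    ext k
    rw [PowerSeries.coeff_mk, PowerSeries.coeff_map]
    change _ = eval _ (freeCoeff _ k)
    rcases k with _ | k
    · rw [if_pos rfl, freeCoeff_zero, map_zero]
    · rw [if_neg (Nat.succ_ne_zero k), wkbF_add_two w₀ w₁ F₁ F₂ k hz]
  rw [SpectralCurve.waveFunction]
  simp only []
  rw [h1, subst_exp_freeSeries, PowerSeries.coeff_C_mul, PowerSeries.coeff_map, partitionSeries,
    PowerSeries.coeff_mk, wkbF_one]
  rfl

theorem hasDerivAt_phase (h : (gkzCurve w₀ w₁).IsLocalBranch V s F₁ F₂) {x : ℂ} (hx : x ∈ V) :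
    HasDerivAt (fun x => (gkzCurve w₀ w₁).wkbF F₁ F₂ 0 (s x)) ((s x + (w₀ + w₁) / 2) / x) x := by
  have hz := branch_ne_zero h hx
  have hx0 := h.ne_zero x hx
  have h1 := HasDerivAt.comp x (h.hasDerivAt_F₁ x hx) (hasDerivAt_branch h hx)
  simp only [wkbF_zero]
  refine h1.congr_deriv ?_
  rw [oneForm_gkzCurve, branch_sq h hx]
  field_simp

theorem coeff_mulFun {S : ℂ → ℂ} (a : ℂ → ℂ) (ψ : WKBSeries S) (x : ℂ) (k : ℕ) :
    PowerSeries.coeff k ((WKBSeries.mulFun a ψ).amp x) = a x * PowerSeries.coeff k (ψ.amp x) :=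
  PowerSeries.coeff_C_mul _ _ _

theorem coeff_zero_thetaSub {S : ℂ → ℂ} (w : ℂ) (ψ : WKBSeries S) (x : ℂ) :
    PowerSeries.coeff 0 ((WKBSeries.thetaSub w ψ).amp x) =
      (x * deriv S x - w) * PowerSeries.coeff 0 (ψ.amp x) := by
  change PowerSeries.coeff 0 (_ + _ - _) = _
  rw [mul_assoc PowerSeries.X, map_sub, map_add, PowerSeries.coeff_C_mul, coeff_mulFun,
    PowerSeries.coeff_zero_X_mul]
  ring

theorem coeff_succ_thetaSub {S : ℂ → ℂ} (w : ℂ) (ψ : WKBSeries S) (x : ℂ) (k : ℕ) :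
    PowerSeries.coeff (k + 1) ((WKBSeries.thetaSub w ψ).amp x) =
      (x * deriv S x - w) * PowerSeries.coeff (k + 1) (ψ.amp x) +
        x * deriv (fun t => PowerSeries.coeff k (ψ.amp t)) x := by
  change PowerSeries.coeff (k + 1) (_ + _ - _) = _
  rw [mul_assoc PowerSeries.X, map_sub, map_add, PowerSeries.coeff_C_mul, coeff_mulFun,
    PowerSeries.coeff_succ_X_mul, PowerSeries.coeff_C_mul, PowerSeries.coeff_mk]
  ring

theorem mul_deriv_phase (h : (gkzCurve w₀ w₁).IsLocalBranch V s F₁ F₂) {x : ℂ} (hx : x ∈ V) :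
    x * deriv (fun x => (gkzCurve w₀ w₁).wkbF F₁ F₂ 0 (s x)) x = s x + (w₀ + w₁) / 2 := by
  rw [(hasDerivAt_phase h hx).deriv, mul_div_cancel₀ _ (h.ne_zero x hx)]

theorem deriv_eq_of_eqOn (h : (gkzCurve w₀ w₁).IsLocalBranch V s F₁ F₂) {x : ℂ} (hx : x ∈ V)
    {f g : ℂ → ℂ} {g' : ℂ} (hg : HasDerivAt g g' (s x))
    (hfg : ∀ t ∈ V, f t = prefactor s F₂ t * g (s t)) :
    deriv f x = prefactor s F₂ x * (-g (s x) / (4 * s x ^ 2) + g' / (2 * s x)) :=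
  ((hasDerivAt_prefactor_mul h hx hg).congr_of_eventuallyEq
    (mem_of_superset (h.isOpen.mem_nhds hx) fun t ht => hfg t ht)).deriv

theorem holomorphicOn_waveFunction (h : (gkzCurve w₀ w₁).IsLocalBranch V s F₁ F₂) :
    ((gkzCurve w₀ w₁).waveFunction s F₁ F₂).HolomorphicOn V := by
  refine ⟨fun x hx => (hasDerivAt_phase h hx).differentiableAt.differentiableWithinAt,
    fun k => DifferentiableOn.congr (fun x hx => ?_) fun x hx => coeff_amp_waveFunction h hx k⟩
  exact (hasDerivAt_prefactor_mul h hx (hasDerivAt_specialCoeff _ k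
    (branch_ne_zero h hx))).differentiableAt.differentiableWithinAt

theorem coeff_zero_thetaSub_waveFunction (h : (gkzCurve w₀ w₁).IsLocalBranch V s F₁ F₂) {x : ℂ}
    (hx : x ∈ V) : PowerSeries.coeff 0 ((WKBSeries.thetaSub w₁
        ((gkzCurve w₀ w₁).waveFunction s F₁ F₂)).amp x) =
      prefactor s F₂ x * (s x + (w₀ - w₁) / 2) := by
  rw [coeff_zero_thetaSub, mul_deriv_phase h hx, coeff_amp_waveFunction h hx, specialCoeff_zero]
  ring

theorem coeff_succ_thetaSub_waveFunction (h : (gkzCurve w₀ w₁).IsLocalBranch V s F₁ F₂) {x : ℂ}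
    (hx : x ∈ V) (k : ℕ) : PowerSeries.coeff (k + 1) ((WKBSeries.thetaSub w₁
        ((gkzCurve w₀ w₁).waveFunction s F₁ F₂)).amp x) =
      prefactor s F₂ x * ((s x + (w₀ - w₁) / 2) *
        specialCoeff ((w₀ - w₁) ^ 2 / 4) (k + 1) (s x) +
          specialTheta ((w₀ - w₁) ^ 2 / 4) k (s x)) := by
  rw [coeff_succ_thetaSub, mul_deriv_phase h hx, coeff_amp_waveFunction h hx,
    deriv_eq_of_eqOn h hx (hasDerivAt_specialCoeff _ k (branch_ne_zero h hx))
      fun t ht => coeff_amp_waveFunction h ht k, specialTheta, branch_sq h hx]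
  ring

/-- After removal of the phase the operator is `x + ħ (x / (2z) + 2z · x d/dx) + ħ² (x d/dx)²`. The
leading `x` cancels against the right side. The middle term maps `z^{-1/2} Z_{k+1}` to `x z^{-1/2}
Z_{k+1}'`, which `hasDerivAt_specialTheta` cancels against the last term applied to `z^{-1/2} Z_k`.
-/
theorem gkz_waveFunction (h : (gkzCurve w₀ w₁).IsLocalBranch V s F₁ F₂) {x : ℂ} (hx : x ∈ V) :
    (WKBSeries.thetaSub w₀ (WKBSeries.thetaSub w₁
        ((gkzCurve w₀ w₁).waveFunction s F₁ F₂))).amp x =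
      (WKBSeries.mulFun (fun x => x) ((gkzCurve w₀ w₁).waveFunction s F₁ F₂)).amp x := by
  have hz := branch_ne_zero h hx
  have hsq := branch_sq h hx
  have hr : ∀ k, PowerSeries.coeff k ((WKBSeries.mulFun (fun x => x)
      ((gkzCurve w₀ w₁).waveFunction s F₁ F₂)).amp x) =
      x * (prefactor s F₂ x * specialCoeff ((w₀ - w₁) ^ 2 / 4) k (s x)) := fun k => by
    rw [← coeff_amp_waveFunction h hx, coeff_mulFun]
  have hlin : HasDerivAt (fun z : ℂ => z + (w₀ - w₁) / 2) 1 (s x) :=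
    (hasDerivAt_id (s x)).add_const _
  -- The product of the two shifted symbols is `z² - Λ = x`, the equation of the curve; this is the
  -- order `ħ^0`.
  have e : (s x + (w₀ + w₁) / 2 - w₀) * (s x + (w₀ - w₁) / 2) = x := by
    linear_combination hsq
  ext k
  rw [hr]
  rcases k with _ | _ | k
  · rw [coeff_zero_thetaSub, mul_deriv_phase h hx, coeff_zero_thetaSub_waveFunction h hx,
      specialCoeff_zero]
    linear_combination prefactor s F₂ x * e
  · rw [coeff_succ_thetaSub, mul_deriv_phase h hx, coeff_succ_thetaSub_waveFunction h hx,
      deriv_eq_of_eqOn h hx hlin fun t ht => coeff_zero_thetaSub_waveFunction h ht,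
      specialTheta, specialCoeff_zero, specialDeriv_zero, hsq]
    -- The transport equation at order `ħ`, which holds because the prefactor behaves like
    -- `z^{-1/2}`.
    have key : (s x + (w₀ + w₁) / 2 - w₀) * (-1 / (4 * s x ^ 2) + 0 / (2 * s x)) +
        (-(s x + (w₀ - w₁) / 2) / (4 * s x ^ 2) + 1 / (2 * s x)) = 0 := by
      field_simp
      ring
    linear_combination prefactor s F₂ x * specialCoeff ((w₀ - w₁) ^ 2 / 4) (0 + 1) (s x) * e +
      x * prefactor s F₂ x * key
  · have hd := (hlin.mul (hasDerivAt_specialCoeff ((w₀ - w₁) ^ 2 / 4) (k + 1) hz)).add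
      (hasDerivAt_specialTheta ((w₀ - w₁) ^ 2 / 4) k hz)
    have hth : specialTheta ((w₀ - w₁) ^ 2 / 4) (k + 1) (s x) = x *
      (-specialCoeff ((w₀ - w₁) ^ 2 / 4) (k + 1) (s x) / (4 * s x ^ 2) +
        specialDeriv ((w₀ - w₁) ^ 2 / 4) (k + 1) (s x) / (2 * s x)) := by
      rw [specialTheta, hsq]
    rw [coeff_succ_thetaSub, mul_deriv_phase h hx, coeff_succ_thetaSub_waveFunction h hx,
      deriv_eq_of_eqOn h hx hd fun t ht => coeff_succ_thetaSub_waveFunction h ht k, hth]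
    simp only [Pi.add_apply, Pi.mul_apply]
    generalize specialCoeff ((w₀ - w₁) ^ 2 / 4) (k + 1) (s x) = a
    generalize specialCoeff ((w₀ - w₁) ^ 2 / 4) (k + 1 + 1) (s x) = b
    generalize specialDeriv ((w₀ - w₁) ^ 2 / 4) (k + 1) (s x) = c
    generalize specialTheta ((w₀ - w₁) ^ 2 / 4) k (s x) = d
    generalize prefactor s F₂ x = p
    have key : (s x + (w₀ + w₁) / 2 - w₀) * (-a / (4 * s x ^ 2) + c / (2 * s x)) +
        (-((s x + (w₀ - w₁) / 2) * a + d) / (4 * s x ^ 2) +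
          (1 * a + (s x + (w₀ - w₁) / 2) * c + 2 * s x * (d / (4 * s x ^ 2) - c)) /
            (2 * s x)) = 0 := by
      field_simp
      ring
    linear_combination p * b * e + x * p * key

end LocalBranch

/-! ### Existence of local branches -/

/-- Near every unramified point over `ℂ*` there is a local branch of the wave function. -/
theorem exists_isLocalBranch (w₀ w₁ : ℂ) {z : ℂ} (hx : (gkzCurve w₀ w₁).x z ≠ 0) (hz : z ≠ 0) :
    ∃ (V : Set ℂ) (s : ℂ → ℂ) (F₁ : ℂ → ℂ) (F₂ : ℂ → ℂ → ℂ),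
      (gkzCurve w₀ w₁).IsLocalBranch V s F₁ F₂ ∧ (gkzCurve w₀ w₁).x z ∈ V ∧
        s ((gkzCurve w₀ w₁).x z) = z := by
  set Λ := (w₀ - w₁) ^ 2 / 4 with hΛ
  have hxc : (gkzCurve w₀ w₁).x = fun z => z ^ 2 - Λ := rfl
  have hre : Continuous fun p : ℂ => (p / z).re := by fun_prop
  have hU : IsOpen {p : ℂ | p ^ 2 - Λ ≠ 0 ∧ 0 < (p / z).re} :=
    (isOpen_ne_fun (by fun_prop) continuous_const).inter
      (isOpen_lt continuous_const hre)
  -- On this ball `x ≠ 0`, so `y dx / x` is holomorphic and has a primitive. The half-plane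
  -- condition makes the logarithm below and the integrals of `hatOmega₂` available.
  obtain ⟨r, hr, hball⟩ := Metric.isOpen_iff.mp hU z ⟨hx, by rw [div_self hz]; simp⟩
  have hform : DifferentiableOn ℂ (gkzCurve w₀ w₁).oneForm (Metric.ball z r) := by
    have : (gkzCurve w₀ w₁).oneForm = fun z => (z + (w₀ + w₁) / 2) * (2 * z) / (z ^ 2 - Λ) :=
      funext fun z => oneForm_gkzCurve w₀ w₁ z
    rw [this]
    exact DifferentiableOn.div (by fun_prop) (by fun_prop) fun p hp => (hball hp).1
  obtain ⟨F₁, hF₁⟩ := hform.isExactOn_ball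
  -- The principal root is taken of a quantity equal to `1` at the base point, so that the branch
  -- passes through the given `z` and not through `-z`.
  let s : ℂ → ℂ := fun x => z * ((x + Λ) / z ^ 2) ^ (1 / 2 : ℂ)
  have hslit : IsOpen {x : ℂ | (x + Λ) / z ^ 2 ∈ Complex.slitPlane} :=
    Complex.isOpen_slitPlane.preimage (by fun_prop)
  have hs : ContinuousOn s {x : ℂ | (x + Λ) / z ^ 2 ∈ Complex.slitPlane} :=
    continuousOn_const.mul (ContinuousOn.cpow_const (by fun_prop) fun x hx => hx)
  have hs_sq : ∀ x, s x ^ 2 = x + Λ := fun x => by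
    have h1 : (((x + Λ) / z ^ 2) ^ (1 / 2 : ℂ)) ^ 2 = (x + Λ) / z ^ 2 := by
      rw [← Complex.cpow_nat_mul]
      simp
    simp only [s]
    rw [mul_pow, h1]
    field_simp
  have hone : ((gkzCurve w₀ w₁).x z + Λ) / z ^ 2 = 1 := by
    simp only [hxc]
    field_simp
    ring
  have hsz : s ((gkzCurve w₀ w₁).x z) = z := by
    simp only [s]
    rw [hone, Complex.one_cpow, mul_one]
  -- The choice of `F₂` integrates the partial derivatives `-1 / (u + v)`. Dividing by `z` moves `u
  -- + v` into the right half-plane, away from the cut of the logarithm, and changes only the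
  -- additive constant.
  refine ⟨{x : ℂ | (x + Λ) / z ^ 2 ∈ Complex.slitPlane} ∩ s ⁻¹' Metric.ball z r, s, F₁,
    fun u v => -Complex.log ((u + v) / z), ?_, ⟨?_, ?_⟩, hsz⟩
  · have hev : ∀ x ∈ {x : ℂ | (x + Λ) / z ^ 2 ∈ Complex.slitPlane} ∩ s ⁻¹' Metric.ball z r,
        ∀ᶠ p : ℂ × ℂ in 𝓝 (s x, s x), 0 < (p.1 / z).re ∧ 0 < (p.2 / z).re := by
      intro x hx
      have h1 : Continuous fun p : ℂ × ℂ => (p.1 / z).re := by fun_prop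
      have h2 : Continuous fun p : ℂ × ℂ => (p.2 / z).re := by fun_prop
      exact (h1.continuousAt.eventually (lt_mem_nhds (hball hx.2).2)).and
        (h2.continuousAt.eventually (lt_mem_nhds (hball hx.2).2))
    have hlog : ∀ a b : ℂ, 0 < (a / z).re → 0 < (b / z).re →
        HasDerivAt (fun u => -Complex.log ((u + b) / z)) (-1 / (a + b)) a := by
      intro a b ha hb
      have hmem : (a + b) / z ∈ Complex.slitPlane := by
        left
        rw [add_div, Complex.add_re]
        exact add_pos ha hb
      have hne : a + b ≠ 0 := by
        intro h0
        rw [h0, zero_div] at hmem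
        exact Complex.zero_notMem_slitPlane hmem
      refine (((((hasDerivAt_id a).add_const b).div_const z).clog hmem).neg).congr_deriv ?_
      simp only [id]
      field_simp
    refine ⟨hs.isOpen_inter_preimage hslit Metric.isOpen_ball, ?_, hs.mono inter_subset_left, ?_, ?_,
      fun x hx => hF₁ _ hx.2, ?_, ?_⟩
    · intro x hx h0
      apply (hball hx.2).1
      rw [hs_sq, h0]
      ring
    · intro x _
      simp only [hxc]
      rw [hs_sq]
      ring
    · intro x hx h0
      have h0 : s x = 0 := by simpa [gkzCurve] using h0
      have := (hball hx.2).2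
      rw [h0] at this
      simp at this
    · intro x hx
      filter_upwards [hev x hx] with p hp
      rw [integralFromInfinity_hatOmega₂ w₀ w₁ hz hp.1 hp.2]
      exact hlog _ _ hp.1 hp.2
    · intro x hx
      filter_upwards [hev x hx] with p hp
      simp only [hatOmega₂_comm _ _ p.2]
      rw [integralFromInfinity_hatOmega₂ w₀ w₁ hz hp.2 hp.1]
      simp only [add_comm p.1]
      exact hlog _ _ hp.2 hp.1
  · change _ ∈ Complex.slitPlane
    rw [hone]
    exact Complex.one_mem_slitPlane
  · change s _ ∈ Metric.ball z r
    rw [hsz]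
    exact Metric.mem_ball_self hr

end TopRec

theorem mainTheorem9 (w₀ w₁ : ℂ) :
    -- the integrals from `∞` which enter the wave function converge
    (∀ (g n : ℕ), 1 ≤ n → 2 < 2 * g + n → ∀ z : Fin n → ℂ, (∀ i, z i ≠ 0) →
      TopRec.ConvergesFromInfinity ((TopRec.gkzCurve w₀ w₁).omega g n) z) ∧
    (∀ z : ℂ, z ≠ 0 → ∀ᶠ p : ℂ × ℂ in nhds (z, z),
      MeasureTheory.IntegrableOn
          (fun t : ℝ => (TopRec.gkzCurve w₀ w₁).hatOmega₂ p.1 (t * p.2)) (Set.Ioi 1) ∧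
        MeasureTheory.IntegrableOn
          (fun t : ℝ => (TopRec.gkzCurve w₀ w₁).hatOmega₂ (t * p.1) p.2) (Set.Ioi 1)) ∧
    -- the wave function exists near every unramified point over `ℂ*`
    (∀ z : ℂ, (TopRec.gkzCurve w₀ w₁).x z ≠ 0 → z ∉ (TopRec.gkzCurve w₀ w₁).ram →
      ∃ (V : Set ℂ) (s : ℂ → ℂ) (F₁ : ℂ → ℂ) (F₂ : ℂ → ℂ → ℂ),
        (TopRec.gkzCurve w₀ w₁).IsLocalBranch V s F₁ F₂ ∧
          (TopRec.gkzCurve w₀ w₁).x z ∈ V ∧ s ((TopRec.gkzCurve w₀ w₁).x z) = z) ∧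
    -- every local branch of it is holomorphic and satisfies the GKZ equation
    (∀ (V : Set ℂ) (s : ℂ → ℂ) (F₁ : ℂ → ℂ) (F₂ : ℂ → ℂ → ℂ),
      (TopRec.gkzCurve w₀ w₁).IsLocalBranch V s F₁ F₂ →
        ((TopRec.gkzCurve w₀ w₁).waveFunction s F₁ F₂).HolomorphicOn V ∧
        ∀ x ∈ V,
          (TopRec.WKBSeries.thetaSub w₀ (TopRec.WKBSeries.thetaSub w₁
              ((TopRec.gkzCurve w₀ w₁).waveFunction s F₁ F₂))).amp x =
            (TopRec.WKBSeries.mulFun (fun x => x)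
              ((TopRec.gkzCurve w₀ w₁).waveFunction s F₁ F₂)).amp x) := by
  refine ⟨fun g n hn h z hz => ?_, fun z hz => ?_, fun z hx hz => ?_, fun V s F₁ F₂ h =>
    ⟨TopRec.holomorphicOn_waveFunction h, fun x hx => TopRec.gkz_waveFunction h hx⟩⟩
  · exact TopRec.convergesFromInfinity_corr (TopRec.omega_gkzCurve_of_stable w₀ w₁ hn h) hz
  · filter_upwards [TopRec.eventually_re_div_pos hz] with p hp
    refine ⟨TopRec.integrableOn_hatOmega₂ w₀ w₁ hz hp.1 hp.2, ?_⟩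
    simp only [TopRec.hatOmega₂_comm _ _ p.2]
    exact TopRec.integrableOn_hatOmega₂ w₀ w₁ hz hp.2 hp.1
  · exact TopRec.exists_isLocalBranch w₀ w₁ hx fun h0 => hz (by rw [h0]; simp [TopRec.gkzCurve])
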